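/- Let $G$ be a finite graph, possibly with loops and parallel edges, and let $A,B$ be sets with $V(G)=A\cup B$. Put $\overline A=B\setminus A$. The biconed graph $G^{A,B}$ is obtained from $G$ by adding two new vertices $0,\overline 0$, the edge $0\overline 0$, one edge $0a$ for every $a\in A$, and one edge $\overline 0b$ for every $b\in B$. The reduced graph $G^{A,B}_{\mathrm{red}}$ is obtained from $G^{A,B}$ by deleting the edges $0\overline 0$, $0a$ ($a\in A$), $\overline 0b$ ($b\in\overline A$) and the vertex $0$. An edge of $G^{A,B}_{\mathrm{red}}$ is called bridging if it joins a vertex of $A$ to a vertex of $\overline A\cup\{\overline 0\}$. Let $m$ be a finite multiset of edges of $G^{A,B}_{\mathrm{red}}$, with underlying set $F$. An edge of $F$ of multiplicity $k$ has $k-1$ edge roots, and is rooted if $k\ge 2$. A component of the spanning subgraph $(V(G^{A,B}_{\mathrm{red}}),F)$ is $n$-edge-rooted if $n$ is the total number of edge roots on its edges, plus $1$ if it contains $\overline 0$. The multiset $m$ is a (partially) 2-edge-rooted forest if $F$ is acyclic, at most one component is 2-edge-rooted, every other component is 0- or 1-edge-rooted, and, in a 2-edge-rooted component, the shortest path in $F$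 containing all its rooted edges (and also $\overline 0$, if $\overline 0$ lies in the component) has an odd number of bridging edges. Let $\mathcal F$ be the set of all 2-edge-rooted forests. Let $\mathcal M$ be the graphic matroid of $G^{A,B}$ (ground set: the edges; independent sets: the acyclic edge sets), let $d$ be its rank, and let $f_{i-1}$ be the number of its independent sets of size $i$. Its $h$-vector $(h_0,\dots,h_d)$ is defined by $\sum_{i=0}^d f_{i-1}(t-1)^{d-i}=\sum_{k=0}^d h_kt^{d-k}$; put $h_i=0$ for $i>d$. A multicomplex on a set $E$ is a collection of finite multisets of elements of $E$ closed under taking sub-multisets; it is pure if all its members that are maximal under inclusion have the same cardinality; its degree is the largest cardinality of a member. A sequence $(a_0,\dots,a_s)$ of positive integers is a pure $\mathcal O$-sequence if there is a pure multicomplex of degree $s$ on a finite set with exactly $a_i$ members of cardinality $i$ for $0\le i\le s$. Then $\mathcal F$ is a pure multicomplex on the edge set of $G^{A,B}_{\mathrm{red}}$, and for every $i\ge 0$ the number $h_i$ equals the number of members of $\mathcal F$ of cardinality $i$. Consequently Stanley's conjecture holds for $\mathcal M$: if $s$ is the degree of $\mathcal F$, then $s\le d$, $h_i=0$ for all $i>s$,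 and $(h_0,\dots,h_s)$, the $h$-vector without its trailing zeros, is a pure $\mathcal O$-sequence. -/

import Mathlib

universe u v

open scoped Graph

/-! ## Paths, acyclic multigraphs and graphic matroids -/

namespace Graph

variable {α : Type u} {β : Type v}

/-- `G.IsPathFrom x y vs es`: the list of vertices `vs` and the list of edges `es` form a path of
the multigraph `G` from `x` to `y` that repeats no vertex. -/
inductive IsPathFrom (G : Graph α β) : α → α → List α → List β → Prop
  | nil {x : α} (hx : x ∈ V(G)) : IsPathFrom G x x [x] []
  | cons {x y z : α} {e : β} {vs : List α} {es : List β} (he : G.IsLink e x y)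
      (hp : IsPathFrom G y z vs es) (hx : x ∉ vs) : IsPathFrom G x z (x :: vs) (e :: es)

/-- A multigraph is acyclic if no path can be closed up to a cycle by an edge that is not on it.
(A loop closes up a path with one vertex, and one of two parallel edges closes up the other.) -/
def IsAcyclic (G : Graph α β) : Prop :=
  ∀ (x y : α) (vs : List α) (es : List β) (e : β),
    G.IsPathFrom x y vs es → G.IsLink e x y → e ∈ es

/-- `x` and `y` lie in the same connected component of `G` (for vertices `x`, `y` of `G`). -/
def Reach (G : Graph α β) (x y : α) : Prop := Relation.ReflTransGen G.Adj x y

theorem Reach.symm {G : Graph α β} {x y : α} (h : G.Reach x y) : G.Reach y x := by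
  unfold Reach at h ⊢
  induction h with
  | refl => exact .refl
  | tail _ hbc ih => exact .head ((G.adj_comm _ _).1 hbc) ih

theorem Reach.mono {G : Graph α β} {I J : Set β} (hIJ : I ⊆ J) {x y : α}
    (h : (G.restrict I).Reach x y) : (G.restrict J).Reach x y :=
  Relation.ReflTransGen.mono (r := (G.restrict I).Adj) (p := (G.restrict J).Adj)
    (fun _ _ ⟨e, he⟩ => ⟨e, hIJ he.1, he.2⟩) _ _ h

theorem IsPathFrom.suffix {G : Graph α β} {x y : α} {vs : List α} {es : List β}
    (h : G.IsPathFrom x y vs es) : ∀ w ∈ vs, ∃ vs' es', G.IsPathFrom w y vs' es' := by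
  induction h with
  | nil hx =>
    intro w hw
    obtain rfl : w = _ := by simpa using hw
    exact ⟨_, _, .nil hx⟩
  | cons he hp hx ih =>
    intro w hw
    rcases List.mem_cons.1 hw with rfl | hw
    · exact ⟨_, _, .cons he hp hx⟩
    · exact ih w hw

theorem Reach.exists_path {G : Graph α β} {x y : α} (hy : y ∈ V(G)) (h : G.Reach x y) :
    ∃ vs es, G.IsPathFrom x y vs es := by
  unfold Reach at h
  induction h using Relation.ReflTransGen.head_induction_on with
  | refl => exact ⟨_, _, .nil hy⟩
  | @head a b hab _ ih =>
    obtain ⟨vs, es, hp⟩ := ih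
    obtain ⟨e, he⟩ := hab
    by_cases ha : a ∈ vs
    · exact hp.suffix a ha
    · exact ⟨_, _, .cons he hp ha⟩

theorem IsPathFrom.reach {G : Graph α β} {x y : α} {vs : List α} {es : List β}
    (h : G.IsPathFrom x y vs es) : G.Reach x y := by
  induction h with
  | nil => exact .refl
  | cons he _ _ ih => exact .head he.adj ih

theorem IsPathFrom.restrict_mono {G : Graph α β} {I J : Set β} {x y : α} {vs : List α}
    {es : List β} (h : (G.restrict I).IsPathFrom x y vs es) (hJ : ∀ e ∈ es, e ∈ I → e ∈ J) :
    (G.restrict J).IsPathFrom x y vs es := by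
  induction h with
  | nil hx => exact .nil hx
  | cons he hp hx ih =>
    exact .cons ⟨hJ _ (by simp) he.1, he.2⟩ (ih fun e h => hJ e (by simp [h])) hx

theorem IsPathFrom.mem_of_restrict {G : Graph α β} {I : Set β} {x y : α} {vs : List α}
    {es : List β} (h : (G.restrict I).IsPathFrom x y vs es) : ∀ e ∈ es, e ∈ I := by
  induction h with
  | nil => simp
  | cons he hp hx ih =>
    intro e h
    rcases List.mem_cons.1 h with rfl | h
    · exact he.1
    · exact ih e h

/-- A set of edges is acyclic iff no edge of it joins two vertices that the others connect. -/
theorem isAcyclic_restrict_iff {G : Graph α β} {I : Set β} :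
    (G.restrict I).IsAcyclic ↔
      ∀ e x y, e ∈ I → G.IsLink e x y → ¬ (G.restrict (I \ {e})).Reach x y := by
  constructor
  · intro h e x y he hl hr
    obtain ⟨vs, es, hp⟩ := hr.exists_path (by simpa using hl.right_mem)
    have h1 := h x y vs es e (hp.restrict_mono fun _ _ h => h.1) ⟨he, hl⟩
    exact (hp.mem_of_restrict e h1).2 rfl
  · intro h x y vs es e hp hl
    by_contra hne
    refine h e x y hl.1 hl.2 (hp.restrict_mono ?_).reach
    intro f hf hfI
    refine ⟨hfI, ?_⟩
    rintro rfl
    exact hne hf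

theorem Reach.insert_cases {G : Graph α β} {K : Set β} {f : β} {a b : α} (hf : G.IsLink f a b)
    {x y : α} (h : (G.restrict (insert f K)).Reach x y) :
    (G.restrict K).Reach x y ∨
      ((G.restrict K).Reach x a ∧ (G.restrict K).Reach b y) ∨
      ((G.restrict K).Reach x b ∧ (G.restrict K).Reach a y) := by
  unfold Reach at h
  induction h with
  | refl => exact .inl .refl
  | tail _ hbc ih =>
    rename_i c d _
    obtain ⟨e, he, hl⟩ := hbc
    rcases he with rfl | he
    · rcases hl.eq_and_eq_or_eq_and_eq hf with ⟨rfl, rfl⟩ | ⟨rfl, rfl⟩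
      · rcases ih with h | ⟨h, -⟩ | ⟨h, -⟩
        · exact .inr (.inl ⟨h, .refl⟩)
        · exact .inr (.inl ⟨h, .refl⟩)
        · exact .inl h
      · rcases ih with h | ⟨h, -⟩ | ⟨h, -⟩
        · exact .inr (.inr ⟨h, .refl⟩)
        · exact .inl h
        · exact .inr (.inr ⟨h, .refl⟩)
    · have hs : (G.restrict K).Adj c d := ⟨e, he, hl⟩
      rcases ih with h | ⟨h, h'⟩ | ⟨h, h'⟩
      · exact .inl (h.tail hs)
      · exact .inr (.inl ⟨h, h'.tail hs⟩)
      · exact .inr (.inr ⟨h, h'.tail hs⟩)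

theorem IsAcyclic.insert_edge {G : Graph α β} {K : Set β} (hK : (G.restrict K).IsAcyclic) {f : β}
    (hf : ∀ a b, G.IsLink f a b → ¬ (G.restrict K).Reach a b) :
    (G.restrict (insert f K)).IsAcyclic := by
  rw [isAcyclic_restrict_iff] at hK ⊢
  intro e x y he hl hr
  by_cases hef : e = f
  · subst hef
    refine hf x y hl (hr.mono ?_)
    rintro g ⟨rfl | hg, hne⟩
    · exact absurd rfl hne
    · exact hg
  have heK : e ∈ K := he.resolve_left hef
  have hsub : insert f K \ {e} ⊆ insert f (K \ {e}) := by
    rintro g ⟨rfl | hg, hne⟩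
    · exact .inl rfl
    · exact .inr ⟨hg, hne⟩
  by_cases hfl : ∃ a b, G.IsLink f a b
  · obtain ⟨a, b, hab⟩ := hfl
    have hm : K \ {e} ⊆ K := Set.sdiff_subset
    have hxy : (G.restrict K).Adj x y := ⟨e, heK, hl⟩
    rcases (hr.mono hsub).insert_cases hab with h | ⟨h, h'⟩ | ⟨h, h'⟩
    · exact hK e x y heK hl h
    · exact hf a b hab (((h.mono hm).symm.tail hxy).trans (h'.mono hm).symm)
    · exact hf a b hab ((Relation.ReflTransGen.tail (h'.mono hm)
        ((Graph.adj_comm _ _).1 hxy)).trans (h.mono hm))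
  · refine hK e x y heK hl (Relation.ReflTransGen.mono (r := (G.restrict (insert f (K \ {e}))).Adj)
      (p := (G.restrict (K \ {e})).Adj) ?_ _ _ (hr.mono hsub))
    rintro c d ⟨g, rfl | hg, hgl⟩
    · exact absurd ⟨c, d, hgl⟩ hfl
    · exact ⟨g, hg, hgl⟩

theorem IsAcyclic.restrict_mono {G : Graph α β} {I J : Set β} (hIJ : I ⊆ J)
    (hJ : (G.restrict J).IsAcyclic) : (G.restrict I).IsAcyclic :=
  fun x y vs es e hp hl =>
    hJ x y vs es e (hp.restrict_mono fun _ _ h => hIJ h) ⟨hIJ hl.1, hl.2⟩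

theorem exists_isLink_not_reach {G H : Graph α β} {x y : α} (h : G.Reach x y)
    (hn : ¬ H.Reach x y) : ∃ e a b, G.IsLink e a b ∧ ¬ H.Reach a b := by
  unfold Reach at h
  induction h with
  | refl => exact absurd .refl hn
  | tail _ hbc ih =>
    rename_i c d _
    by_cases hc : H.Reach x c
    · obtain ⟨e, he⟩ := hbc
      exact ⟨e, c, d, he, fun hcd => hn (hc.trans hcd)⟩
    · exact ih hc

/-- An acyclic set whose edges are spanned by `I` has at most as many elements as `I`. -/
theorem IsAcyclic.ncard_le {G : Graph α β} {I : Set β} (hI : I.Finite) :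
    ∀ (n : ℕ) (J : Set β), J.Finite → (G.restrict J).IsAcyclic → (J \ I).ncard = n →
      (∀ e ∈ J, ∃ x y, G.IsLink e x y ∧ (G.restrict I).Reach x y) → J.ncard ≤ I.ncard := by
  intro n
  induction n with
  | zero =>
    intro J hJ _ h0 _
    have : J \ I = ∅ := (Set.ncard_eq_zero (hJ.subset Set.sdiff_subset)).1 h0
    exact Set.ncard_le_ncard (Set.sdiff_eq_empty.1 this) hI
  | succ n ih =>
    intro J hJ hac hn hspan
    have hJI : (J \ I).Finite := hJ.subset Set.sdiff_subset
    obtain ⟨e, heJ, heI⟩ : (J \ I).Nonempty := by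
      rw [← Set.ncard_pos hJI]; omega
    obtain ⟨x, y, hl, hr⟩ := hspan e heJ
    obtain ⟨f, a, b, ⟨hfI, hfl⟩, hnr⟩ :=
      exists_isLink_not_reach hr (isAcyclic_restrict_iff.1 hac e x y heJ hl)
    have hfn : f ∉ J \ {e} := fun h => hnr (.single ⟨f, h, hfl⟩)
    have hac' : (G.restrict (insert f (J \ {e}))).IsAcyclic := by
      refine (hac.restrict_mono Set.sdiff_subset).insert_edge fun c d hcd hcr => ?_
      rcases hcd.eq_and_eq_or_eq_and_eq hfl with ⟨rfl, rfl⟩ | ⟨rfl, rfl⟩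
      · exact hnr hcr
      · exact hnr hcr.symm
    have hfin : (J \ {e}).Finite := hJ.subset Set.sdiff_subset
    have hc : (insert f (J \ {e})).ncard = J.ncard := by
      rw [Set.ncard_insert_of_notMem hfn hfin, Set.ncard_sdiff_singleton_add_one heJ hJ]
    have hd : insert f (J \ {e}) \ I = (J \ I) \ {e} := by
      ext g
      simp only [Set.mem_sdiff, Set.mem_insert_iff, Set.mem_singleton_iff]
      constructor
      · rintro ⟨rfl | h, h'⟩
        · exact absurd hfI h'
        · exact ⟨⟨h.1, h'⟩, h.2⟩
      · rintro ⟨⟨h, h'⟩, h''⟩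
        exact ⟨.inr ⟨h, h''⟩, h'⟩
    have hd' : (insert f (J \ {e}) \ I).ncard = n := by
      have := Set.ncard_sdiff_singleton_add_one (s := J \ I) ⟨heJ, heI⟩ hJI
      rw [hd]; omega
    rw [← hc]
    refine ih _ (hfin.insert f) hac' hd' ?_
    rintro g (rfl | hg)
    · exact ⟨a, b, hfl, .single ⟨g, hfI, hfl⟩⟩
    · exact hspan g hg.1

/-- The graphic matroid of a multigraph: the ground set is the edge set, and the independent sets
are the acyclic sets of edges. -/
def graphicMatroid (G : Graph α β) : Matroid β :=
  (IndepMatroid.ofFinitaryCardAugment E(G) (fun I => I ⊆ E(G) ∧ (G.restrict I).IsAcyclic)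
    ⟨Set.empty_subset _, fun _ _ _ _ _ _ hl => absurd hl.1 (Set.notMem_empty _)⟩
    (fun _ _ hJ hIJ => ⟨hIJ.trans hJ.1, hJ.2.restrict_mono hIJ⟩)
    (by
      rintro I J ⟨hIE, hIa⟩ hI ⟨hJE, hJa⟩ hJ hlt
      by_contra hcon
      refine absurd hlt (not_lt.2 (IsAcyclic.ncard_le hI _ J hJ hJa rfl ?_))
      intro e he
      by_contra hne
      have hr : ∀ a b, G.IsLink e a b → ¬ (G.restrict I).Reach a b :=
        fun a b hab hr => hne ⟨a, b, hab, hr⟩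
      obtain ⟨x, y, hxy⟩ := G.exists_isLink_of_mem_edgeSet (hJE he)
      exact hcon ⟨e, he, fun heI => hr x y hxy (.single ⟨e, heI, hxy⟩),
        Set.insert_subset (hJE he) hIE, hIa.insert_edge hr⟩)
    (by
      intro I h
      refine ⟨fun e he => (h {e} (by simpa using he) (Set.finite_singleton e)).1 rfl, ?_⟩
      intro x y vs es e hp hl
      have hfin : (insert e {f | f ∈ es}).Finite := (List.finite_toSet es).insert e
      refine (h _ ?_ hfin).2 x y vs es e (hp.restrict_mono fun f hf _ => .inr hf) ⟨.inl rfl, hl.2⟩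
      rintro f (rfl | hf)
      · exact hl.1
      · exact hp.mem_of_restrict f hf)
    (fun _ h => h.1)).matroid

theorem graphicMatroid_indep_iff (G : Graph α β) (I : Set β) :
    G.graphicMatroid.Indep I ↔ I ⊆ E(G) ∧ (G.restrict I).IsAcyclic := Iff.rfl

theorem graphicMatroid_ground (G : Graph α β) : G.graphicMatroid.E = E(G) := rfl

end Graph

/-! ## The `h`-vector of a matroid -/

namespace Matroid

open Polynomial

variable {ε : Type v}

/-- `M.indepCount i` is `f_{i-1}`: the number of faces with `i` elements of the independence
complex of `M`. -/
noncomputable def indepCount (M : Matroid ε) (i : ℕ) : ℕ :=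
  {I : Set ε | M.Indep I ∧ I.encard = i}.ncard

/-- The polynomial `∑_{i=0}^{d} f_{i-1} (t-1)^{d-i}`, where `d` is the rank of `M`. -/
noncomputable def hPolynomial (M : Matroid ε) : ℤ[X] :=
  ∑ i ∈ Finset.range (M.eRank.toNat + 1),
    C (M.indepCount i : ℤ) * (X - 1) ^ (M.eRank.toNat - i)

/-- The `h`-vector `(h_0, …, h_d)` of (the independence complex of) a matroid `M` of finite rank
`d`, given by `∑_{i=0}^{d} f_{i-1} (t-1)^{d-i} = ∑_{k=0}^{d} h_k t^{d-k}`, and extended by `0`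
beyond `h_d`. -/
noncomputable def hVector (M : Matroid ε) (k : ℕ) : ℤ :=
  if k ≤ M.eRank.toNat then M.hPolynomial.coeff (M.eRank.toNat - k) else 0

end Matroid

/-! ## Multicomplexes and pure `O`-sequences -/

/-- `M` is a multicomplex on the ground set `E`: a collection of multisets of elements of `E`
that is closed under taking sub-multisets. -/
structure IsMulticomplex {ε : Type v} (E : Set ε) (M : Set (Multiset ε)) : Prop where
  subset_ground : ∀ σ ∈ M, ∀ e ∈ σ, e ∈ E
  down_closed : ∀ σ ∈ M, ∀ τ, τ ≤ σ → τ ∈ M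

/-- All facets (members that are maximal under inclusion) have the same cardinality. -/
def IsPureMulticomplex {ε : Type v} (M : Set (Multiset ε)) : Prop :=
  ∀ σ τ, Maximal (· ∈ M) σ → Maximal (· ∈ M) τ → σ.card = τ.card

/-- The largest cardinality of a member of `M` is `s`. -/
def HasDegree {ε : Type v} (M : Set (Multiset ε)) (s : ℕ) : Prop :=
  (∃ σ ∈ M, σ.card = s) ∧ ∀ σ ∈ M, σ.card ≤ s

/-- The number of members of `M` of cardinality `i`. -/
noncomputable def faceCount {ε : Type v} (M : Set (Multiset ε)) (i : ℕ) : ℕ :=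
  {σ | σ ∈ M ∧ σ.card = i}.ncard

/-- The finite sequence `(a 0, …, a s)` is a pure `O`-sequence: its entries are positive, and they
are the face numbers of a pure multicomplex of degree `s` on a finite ground set. -/
def IsPureOSequence (s : ℕ) (a : ℕ → ℤ) : Prop :=
  (∀ i ≤ s, 0 < a i) ∧
  ∃ (j : ℕ) (M : Set (Multiset (Fin j))),
    IsMulticomplex Set.univ M ∧ IsPureMulticomplex M ∧ HasDegree M s ∧
      ∀ i ≤ s, a i = faceCount M i

/-! ## Biconed graphs -/

/-- Vertices of a biconed graph: the coning vertices `0` and `0̄`, and the vertices of `G`. -/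
inductive BiconeVertex (α : Type u) : Type u
  | zero : BiconeVertex α
  | zeroBar : BiconeVertex α
  | old (x : α) : BiconeVertex α

/-- Edges of a biconed graph: the edge `00̄`, the edges `0a`, the edges `0̄b`, and the edges
of `G`. -/
inductive BiconeEdge (α : Type u) (β : Type v) : Type (max u v)
  | cone : BiconeEdge α β
  | toZero (a : α) : BiconeEdge α β
  | toZeroBar (b : α) : BiconeEdge α β
  | old (e : β) : BiconeEdge α β

namespace Bicone

variable {α : Type u} {β : Type v}

/-- The ends of the edges of the biconing of `G` with respect to `A` and `B`. -/
inductive IsLink (G : Graph α β) (A B : Set α) :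
    BiconeEdge α β → BiconeVertex α → BiconeVertex α → Prop
  | cone : IsLink G A B .cone .zero .zeroBar
  | cone' : IsLink G A B .cone .zeroBar .zero
  | toZero {a : α} (ha : a ∈ A) : IsLink G A B (.toZero a) .zero (.old a)
  | toZero' {a : α} (ha : a ∈ A) : IsLink G A B (.toZero a) (.old a) .zero
  | toZeroBar {b : α} (hb : b ∈ B) : IsLink G A B (.toZeroBar b) .zeroBar (.old b)
  | toZeroBar' {b : α} (hb : b ∈ B) : IsLink G A B (.toZeroBar b) (.old b) .zeroBar
  | old {e : β} {x y : α} (h : G.IsLink e x y) : IsLink G A B (.old e) (.old x) (.old y)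

/-- The biconed graph `G^{A,B}`, for a multigraph `G` with vertex set `A ∪ B`. -/
def graph (G : Graph α β) (A B : Set α) (hAB : V(G) = A ∪ B) :
    Graph (BiconeVertex α) (BiconeEdge α β) where
  vertexSet := {.zero, .zeroBar} ∪ BiconeVertex.old '' V(G)
  IsLink := IsLink G A B
  isLink_symm e _ := ⟨fun x y h => by
    cases h with
    | cone => exact .cone'
    | cone' => exact .cone
    | toZero ha => exact .toZero' ha
    | toZero' ha => exact .toZero ha
    | toZeroBar hb => exact .toZeroBar' hb
    | toZeroBar' hb => exact .toZeroBar hb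
    | old h => exact .old h.symm⟩
  eq_or_eq_of_isLink_of_isLink e x y z w h h' := by
    cases h <;> cases h' <;> try simp
    rename_i h _ _ h'
    exact h.left_eq_or_eq h'
  left_mem_of_isLink e x y h := by
    cases h with
    | cone => simp
    | cone' => simp
    | toZero ha => simp
    | toZero' ha => simp [hAB, ha]
    | toZeroBar hb => simp
    | toZeroBar' hb => simp [hAB, hb]
    | old h => simpa using h.left_mem

/-- The edges of the spanning tree `T₀`: the edge `00̄`, all `0a` with `a ∈ A`, and all `0̄b` with
`b ∈ Ā = B \ A`. -/
def baseTree (A B : Set α) : Set (BiconeEdge α β) :=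
  {.cone} ∪ BiconeEdge.toZero '' A ∪ BiconeEdge.toZeroBar '' (B \ A)

/-- The reduced graph `G^{A,B}_red`: remove the edges of `T₀` and the vertex `0`. -/
def reduced (G : Graph α β) (A B : Set α) (hAB : V(G) = A ∪ B) :
    Graph (BiconeVertex α) (BiconeEdge α β) :=
  ((graph G A B hAB).deleteEdges (baseTree A B)).deleteVerts {.zero}

/-- A bridging edge of the reduced graph connects a vertex of `A` to a vertex of `Ā ∪ {0̄}`. -/
def IsBridging (G : Graph α β) (A B : Set α) (hAB : V(G) = A ∪ B) (e : BiconeEdge α β) : Prop :=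
  ∃ x ∈ BiconeVertex.old '' A, ∃ y ∈ BiconeVertex.old '' (B \ A) ∪ {.zeroBar},
    (reduced G A B hAB).IsLink e x y

/-! ### `2`-edge-rooted forests -/

/-- The spanning subgraph of the reduced graph whose edges are those that occur in `m`. -/
def support (G : Graph α β) (A B : Set α) (hAB : V(G) = A ∪ B) (m : Multiset (BiconeEdge α β)) :
    Graph (BiconeVertex α) (BiconeEdge α β) :=
  (reduced G A B hAB).restrict {e | e ∈ m}

/-- The edge `e` of the support of `m` lies in the component of the vertex `x`. -/
def InComponent (G : Graph α β) (A B : Set α) (hAB : V(G) = A ∪ B)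
    (m : Multiset (BiconeEdge α β)) (x : BiconeVertex α) (e : BiconeEdge α β) : Prop :=
  ∃ y, (support G A B hAB m).Inc e y ∧ (support G A B hAB m).Reach x y

open Classical in
/-- The component of the vertex `x` is `rootNumber x`-edge-rooted: the sum of the numbers of edge
roots (multiplicity minus one) of its edges, plus one if the component contains `0̄`. -/
noncomputable def rootNumber (G : Graph α β) (A B : Set α) (hAB : V(G) = A ∪ B)
    (m : Multiset (BiconeEdge α β)) (x : BiconeVertex α) : ℕ :=
  (∑ e ∈ m.toFinset with InComponent G A B hAB m x e, (m.count e - 1)) +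
    if (support G A B hAB m).Reach x .zeroBar then 1 else 0

open Classical in
/-- A path of the support of `m` that contains all rooted edges of the component of `x`, and
contains `0̄` if that component does. -/
def IsRootPath (G : Graph α β) (A B : Set α) (hAB : V(G) = A ∪ B)
    (m : Multiset (BiconeEdge α β)) (x : BiconeVertex α)
    (vs : List (BiconeVertex α)) (es : List (BiconeEdge α β)) : Prop :=
  (∃ y z, (support G A B hAB m).IsPathFrom y z vs es) ∧
  (∀ e, InComponent G A B hAB m x e → 2 ≤ m.count e → e ∈ es) ∧
  ((support G A B hAB m).Reach x .zeroBar → .zeroBar ∈ vs)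

/-- A shortest path as in `IsRootPath`. -/
def IsShortestRootPath (G : Graph α β) (A B : Set α) (hAB : V(G) = A ∪ B)
    (m : Multiset (BiconeEdge α β)) (x : BiconeVertex α)
    (vs : List (BiconeVertex α)) (es : List (BiconeEdge α β)) : Prop :=
  IsRootPath G A B hAB m x vs es ∧
    ∀ vs' es', IsRootPath G A B hAB m x vs' es' → es.length ≤ es'.length

open Classical in
/-- The multiset `m` of edges of the reduced graph is a `2`-edge-rooted forest. -/
structure IsTwoEdgeRootedForest (G : Graph α β) (A B : Set α) (hAB : V(G) = A ∪ B)
    (m : Multiset (BiconeEdge α β)) : Prop where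
  edges_mem : ∀ e ∈ m, e ∈ E(reduced G A B hAB)
  forest : (support G A B hAB m).IsAcyclic
  /-- At most one component is `2`-edge-rooted. -/
  unique_two : ∀ x ∈ V(reduced G A B hAB), ∀ y ∈ V(reduced G A B hAB),
    rootNumber G A B hAB m x = 2 → rootNumber G A B hAB m y = 2 →
      (support G A B hAB m).Reach x y
  /-- Every other component is `0`- or `1`-edge-rooted. -/
  le_two : ∀ x ∈ V(reduced G A B hAB), rootNumber G A B hAB m x ≤ 2
  /-- In a `2`-edge-rooted component, the shortest path containing the rooted edges (and `0̄`, if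
  it lies in the component) has an odd number of bridging edges. -/
  odd_bridging : ∀ x ∈ V(reduced G A B hAB), rootNumber G A B hAB m x = 2 →
    ∃ vs es, IsShortestRootPath G A B hAB m x vs es ∧
      Odd (es.countP fun e => IsBridging G A B hAB e)

/-- The set of all `2`-edge-rooted forests of the reduced graph. -/
def twoEdgeRootedForests (G : Graph α β) (A B : Set α) (hAB : V(G) = A ∪ B) :
    Set (Multiset (BiconeEdge α β)) :=
  {m | IsTwoEdgeRootedForest G A B hAB m}

end Bicone

/-! ### Connectivity and separating edges in forests -/

namespace Graph

variable {α : Type u} {β : Type v} {G : Graph α β} {I J : Set β} {x y z : α} {e f : β}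

/-! Colour the vertices by membership in `A`. The bridging edges are exactly the edges of the
reduced graph with ends of different colours, so a path contains an odd number of them iff its ends
differ in colour. Let the edge 00̄ join every forest and always carry one root; this accounts for
the extra root that 0̄ gives to its component. A 2-edge-rooted forest then becomes a forest with a
multiset of roots, at most one per component, except possibly for one pair of roots in one component
whose outermost ends have different colours (`IsRooting`, `isTwoEdgeRootedForest_iff`). In this form
closure under sub-multisets is easy.

Purity. In a maximal member every component without a root is a vertex that is isolated up to loops,
and a doubly rooted component occurs iff the reduced graph has a bridging edge at all. Since a
forest has as many components as it has more vertices than edges, the graph alone determines the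
cardinality (`isRooting_nodup_iff`, `card_of_maximal`).

The h-vector. Both sides are sorted by a forest F of the reduced graph. An independent set is
uniquely F together with some edges of the spanning tree T₀, and these edges are indexed by the
vertices other than 0. Let D be the set of components of F other than that of 0̄. The vertex sets T
that keep the union acyclic are: the partial transversals of D; these with 00̄ added; and those that
connect 0 with 0̄ in another way. The last kind is given by a pair (a, b), a in `A` and b not, in
one component of D, with a partial transversal of the rest of D, or by a vertex a of `A` in the
component of 0̄, written as the pair (a, 0), with a partial transversal of D
(`sum_acyclic_treeEdge`). The edge roots of the members with underlying set F have the same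
description with edges in place of vertices: the pair (a, b) becomes the first and the last edge of
the path from a to b, where 00̄ is not counted (`sum_isTwoEdgeRootedForest`).

A sum over partial transversals factors as the product of t + n(c) over the components c, with n(c)
the number of vertices or of edges of c. A tree has one vertex more than edges, so t - 1 on the
vertex side matches t on the edge side; the prefactor (t - 1) + 1 from the optional edge 00̄ matches
the prefactor t as well. Summing over F identifies the h-polynomial with the sum of t^(d-|m|) over
the 2-edge-rooted forests m. -/

theorem Reach.refl (G : Graph α β) (x : α) : G.Reach x x := Relation.ReflTransGen.refl

theorem Reach.trans (h : G.Reach x y) (h' : G.Reach y z) : G.Reach x z :=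
  Relation.ReflTransGen.trans h h'

theorem IsLink.reach_restrict (h : G.IsLink e x y) (he : e ∈ I) : (G.restrict I).Reach x y :=
  .single ⟨e, he, h⟩

theorem Inc.reach_restrict (h : G.Inc e x) (h' : G.Inc e y) (he : e ∈ I) :
    (G.restrict I).Reach x y := by
  obtain ⟨z, hz⟩ := h
  obtain ⟨w, hw⟩ := h'
  rcases hz.eq_and_eq_or_eq_and_eq hw with ⟨rfl, rfl⟩ | ⟨rfl, rfl⟩
  · exact .refl _ _
  · exact hz.reach_restrict he

/-- A set of vertices that no edge of `I` leaves is a union of components. -/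
theorem Reach.mem_of_closed {U : Set α} (hU : ∀ e ∈ I, ∀ x y, G.IsLink e x y → x ∈ U → y ∈ U)
    (h : (G.restrict I).Reach x y) (hx : x ∈ U) : y ∈ U := by
  unfold Reach at h
  induction h with
  | refl => exact hx
  | tail _ hbc ih =>
    obtain ⟨e, he⟩ := hbc
    exact hU e he.1 _ _ he.2 ih

theorem Reach.eq_of_forall_not_inc (h : (G.restrict I).Reach x y)
    (hx : ∀ e ∈ I, ¬ G.Inc e x) : x = y := by
  refine (h.mem_of_closed (U := {x}) (fun e he a b hl ha => ?_) rfl).symm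
  obtain rfl : a = x := ha
  exact absurd ⟨b, hl⟩ (hx e he)

theorem isAcyclic_insert_iff {a b : α} (hf : f ∉ I) (hl : G.IsLink f a b) :
    (G.restrict (insert f I)).IsAcyclic ↔
      (G.restrict I).IsAcyclic ∧ ¬ (G.restrict I).Reach a b := by
  constructor
  · intro h
    refine ⟨h.restrict_mono (Set.subset_insert _ _), fun hr => ?_⟩
    have hsub : I ⊆ insert f I \ {f} := by
      intro g hg
      exact ⟨.inr hg, by rintro rfl; exact hf hg⟩
    exact isAcyclic_restrict_iff.1 h f a b (.inl rfl) hl (hr.mono hsub)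
  · rintro ⟨h, hr⟩
    refine h.insert_edge fun c d hcd hcr => ?_
    rcases hcd.eq_and_eq_or_eq_and_eq hl with ⟨rfl, rfl⟩ | ⟨rfl, rfl⟩
    · exact hr hcr
    · exact hr hcr.symm

theorem insert_sdiff_self (he : e ∈ I) : insert e (I \ {e}) = I := by
  rw [Set.insert_sdiff_singleton, Set.insert_eq_of_mem he]

/-- Removing an edge of a forest disconnects a vertex of its component from exactly one end. -/
theorem IsAcyclic.reach_sdiff_cases (hI : (G.restrict I).IsAcyclic) (he : e ∈ I)
    (hl : G.IsLink e x y) (hr : (G.restrict I).Reach x z) :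
    ((G.restrict (I \ {e})).Reach x z ∧ ¬ (G.restrict (I \ {e})).Reach y z) ∨
      ((G.restrict (I \ {e})).Reach y z ∧ ¬ (G.restrict (I \ {e})).Reach x z) := by
  have hxy := isAcyclic_restrict_iff.1 hI e x y he hl
  rw [← insert_sdiff_self he] at hr
  rcases hr.insert_cases hl with h | ⟨-, h⟩ | ⟨h, -⟩
  · exact .inl ⟨h, fun h' => hxy (h.trans h'.symm)⟩
  · exact .inr ⟨h, fun h' => hxy (h'.trans h.symm)⟩
  · exact absurd h hxy

theorem IsPathFrom.left_mem {vs : List α} {es : List β} (h : G.IsPathFrom x y vs es) :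
    x ∈ vs := by
  cases h <;> simp

theorem IsPathFrom.right_mem {vs : List α} {es : List β} (h : G.IsPathFrom x y vs es) :
    y ∈ vs := by
  induction h with
  | nil => simp
  | cons _ _ _ ih => exact List.mem_cons_of_mem _ ih

theorem IsPathFrom.mem_of_inc {vs : List α} {es : List β} (h : G.IsPathFrom x y vs es)
    (he : e ∈ es) (hz : G.Inc e z) : z ∈ vs := by
  induction h with
  | nil => simp at he
  | cons hl hp _ ih =>
    rcases List.mem_cons.1 he with rfl | he
    · obtain ⟨w, hw⟩ := hz
      rcases hw.eq_and_eq_or_eq_and_eq hl with ⟨rfl, -⟩ | ⟨rfl, -⟩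
      · simp
      · exact List.mem_cons_of_mem _ hp.left_mem
    · exact List.mem_cons_of_mem _ (ih he)

theorem IsPathFrom.nodup_edges {vs : List α} {es : List β} (h : G.IsPathFrom x y vs es) :
    es.Nodup := by
  induction h with
  | nil => simp
  | cons hl hp hx ih => exact List.nodup_cons.2 ⟨fun he => hx (hp.mem_of_inc he hl.inc_left), ih⟩

/-- All vertices of a path are connected by its edges. -/
theorem IsPathFrom.reach_of_mem {vs : List α} {es : List β} (h : G.IsPathFrom x y vs es)
    (hI : ∀ e ∈ es, e ∈ I) : ∀ w ∈ vs, (G.restrict I).Reach x w := by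
  induction h with
  | nil => 
    intro w hw
    obtain rfl : w = _ := by simpa using hw
    exact .refl _ _
  | cons hl hp hx ih =>
    intro w hw
    rcases List.mem_cons.1 hw with rfl | hw
    · exact .refl _ _
    · exact (hl.reach_restrict (hI _ (by simp))).trans (ih (fun e he => hI e (by simp [he])) w hw)

theorem IsPathFrom.of_restrict {vs : List α} {es : List β}
    (h : (G.restrict I).IsPathFrom x y vs es) : G.IsPathFrom x y vs es := by
  induction h with
  | nil hx => exact .nil hx
  | cons he hp hx ih => exact .cons he.2 ih hx

/-- Every edge of a path in a forest separates the ends of the path. -/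
theorem IsPathFrom.not_reach_sdiff {vs : List α} {es : List β} (hI : (G.restrict I).IsAcyclic)
    (h : (G.restrict I).IsPathFrom x y vs es) :
    ∀ e ∈ es, ¬ (G.restrict (I \ {e})).Reach x y := by
  induction h with
  | nil => simp
  | @cons x y z e vs es hl hp hx ih =>
    intro g hg hr
    have hnot : e ∉ es := fun he => hx (hp.mem_of_inc he hl.inc_left)
    rcases List.mem_cons.1 hg with rfl | hg
    · refine isAcyclic_restrict_iff.1 hI g x y hl.1 hl.2 (hr.trans (Reach.symm ?_))
      exact (hp.restrict_mono (J := I \ {g}) fun f hf h => ⟨h, by rintro rfl; exact hnot hf⟩).reach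
    · refine ih g hg (Reach.trans (Reach.symm (hl.2.reach_restrict ⟨hl.1, ?_⟩)) hr)
      rintro rfl
      exact hnot hg

/-- The first edge of a path in a forest. -/
theorem IsAcyclic.exists_inc_not_reach (hI : (G.restrict I).IsAcyclic) (hy : y ∈ V(G))
    (h : (G.restrict I).Reach x y) (hne : x ≠ y) :
    ∃ e ∈ I, G.Inc e x ∧ ¬ (G.restrict (I \ {e})).Reach x y := by
  obtain ⟨vs, es, hp⟩ := h.exists_path (by simpa using hy)
  have hs := hp.not_reach_sdiff hI
  cases hp with
  | nil => exact absurd rfl hne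
  | cons hl hp hx => exact ⟨_, hl.1, hl.2.inc_left, hs _ (by simp)⟩

/-- The first edge of a path in a forest is unique. If `e` and `f` were different, then `y` could be
reached by crossing `e` and continuing on its far side, where `f` is never needed; so `f` would not
separate `x` from `y`. -/
theorem IsAcyclic.eq_of_inc_not_reach (hI : (G.restrict I).IsAcyclic) (he : e ∈ I) (hf : f ∈ I)
    (hex : G.Inc e x) (hfx : G.Inc f x) (hr : (G.restrict I).Reach x y)
    (hen : ¬ (G.restrict (I \ {e})).Reach x y) (hfn : ¬ (G.restrict (I \ {f})).Reach x y) :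
    e = f := by
  by_contra hne
  obtain ⟨u, hu⟩ := hex
  obtain ⟨w, hw⟩ := hfx
  have hu' : (G.restrict (I \ {e})).Reach u y := by
    rcases hI.reach_sdiff_cases he hu hr with h | h
    · exact absurd h.1 hen
    · exact h.1
  have hfe : f ∈ I \ {e} := ⟨hf, fun h => hne h.symm⟩
  have hux := isAcyclic_restrict_iff.1 hI e x u he hu
  have hsub : ((I \ {e}) \ {f} : Set β) ⊆ I \ {f} := fun g hg => ⟨hg.1.1, hg.2⟩
  rw [← insert_sdiff_self hfe] at hu'
  have hm : (G.restrict ((I \ {e}) \ {f})).Reach u y := by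
    rcases hu'.insert_cases hw with h | ⟨h, -⟩ | ⟨-, h⟩
    · exact h
    · exact absurd (h.mono Set.sdiff_subset).symm hux
    · exact absurd (h.mono Set.sdiff_subset) hen
  exact hfn ((hu.reach_restrict (show e ∈ I \ {f} from ⟨he, hne⟩)).trans (hm.mono hsub))

/-! ### Extreme ends of two edges of a forest -/

/-- `a` and `b` are ends of the edges `e` and `f` of `I`, and each of the two edges separates `a`
from `b`: so `e` is the first and `f` the last edge of the path from `a` to `b`. -/
structure EndPair (G : Graph α β) (I : Set β) (a b : α) (e f : β) : Prop where
  left_mem : e ∈ I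
  right_mem : f ∈ I
  inc_left : G.Inc e a
  inc_right : G.Inc f b
  reach : (G.restrict I).Reach a b
  cut_left : ¬ (G.restrict (I \ {e})).Reach a b
  cut_right : ¬ (G.restrict (I \ {f})).Reach a b

theorem EndPair.symm {a b : α} (h : G.EndPair I a b e f) : G.EndPair I b a f e :=
  ⟨h.right_mem, h.left_mem, h.inc_right, h.inc_left, h.reach.symm,
    fun h' => h.cut_right h'.symm, fun h' => h.cut_left h'.symm⟩

theorem IsAcyclic.exists_endPair (hI : (G.restrict I).IsAcyclic) (hxy : (G.restrict I).Reach x y)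
    (hy : y ∈ V(G)) (hne : x ≠ y) : ∃ e f, G.EndPair I x y e f := by
  have hx : x ∈ V(G) := by
    obtain ⟨e, -, he, -⟩ := hI.exists_inc_not_reach hy hxy hne
    exact he.vertex_mem
  obtain ⟨e, he, hi, hr⟩ := hI.exists_inc_not_reach hy hxy hne
  obtain ⟨f, hf, hi', hr'⟩ := hI.exists_inc_not_reach hx hxy.symm hne.symm
  exact ⟨e, f, he, hf, hi, hi', hxy, hr, fun h => hr' h.symm⟩

theorem IsAcyclic.exists_far_end (hI : (G.restrict I).IsAcyclic) (he : e ∈ I) (hx : G.Inc e x)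
    (hr : (G.restrict I).Reach x z) : ∃ p, G.Inc e p ∧ ¬ (G.restrict (I \ {e})).Reach p z := by
  obtain ⟨y, hl⟩ := hx
  rcases hI.reach_sdiff_cases he hl hr with h | h
  · exact ⟨y, hl.inc_right, h.2⟩
  · exact ⟨x, hl.inc_left, h.2⟩

theorem IsAcyclic.far_end_unique (hI : (G.restrict I).IsAcyclic) (he : e ∈ I) (hx : G.Inc e x)
    (hy : G.Inc e y) (hr : (G.restrict I).Reach x z)
    (hxz : ¬ (G.restrict (I \ {e})).Reach x z) (hyz : ¬ (G.restrict (I \ {e})).Reach y z) :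
    x = y := by
  obtain ⟨x', hl⟩ := hx
  obtain ⟨y', hl'⟩ := hy
  rcases hl.eq_and_eq_or_eq_and_eq hl' with ⟨h, -⟩ | ⟨-, h⟩
  · exact h
  · subst h
    rcases hI.reach_sdiff_cases he hl hr with h | h
    · exact absurd h.1 hxz
    · exact absurd h.1 hyz

/-- Two edges of the same component of a forest have extreme ends. -/
theorem IsAcyclic.exists_extreme_ends (hI : (G.restrict I).IsAcyclic) (he : e ∈ I) (hf : f ∈ I)
    (hx : G.Inc e x) (hy : G.Inc f y) (hr : (G.restrict I).Reach x y) :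
    ∃ a b, G.EndPair I a b e f := by
  -- The case `e = f` is needed for an edge of multiplicity three, which is a root twice; its
  -- extreme ends are its own two ends.
  by_cases hef : e = f
  · subst hef
    obtain ⟨z, hl⟩ := hx
    have := isAcyclic_restrict_iff.1 hI e _ _ he hl
    exact ⟨_, _, he, he, hl.inc_left, hl.inc_right, hl.reach_restrict he, this, this⟩
  -- `p` is the end of `e` away from `f`, and then `q` is the end of `f` away from `p`.
  obtain ⟨p, hp, hpn⟩ := hI.exists_far_end he hx hr
  have hpy : (G.restrict I).Reach p y := (hp.reach_restrict hx he).trans hr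
  obtain ⟨q, hq, hqn⟩ := hI.exists_far_end hf hy hpy.symm
  have hqy : (G.restrict (I \ {e})).Reach q y :=
    hq.reach_restrict hy ⟨hf, fun h => hef h.symm⟩
  exact ⟨p, q, he, hf, hp, hq, hpy.trans (hq.reach_restrict hy hf).symm,
    fun h => hpn (h.trans hqy), fun h => hqn h.symm⟩

theorem IsAcyclic.endPair_unique (hI : (G.restrict I).IsAcyclic) {a b : α} {e' f' : β}
    (h : G.EndPair I a b e f) (h' : G.EndPair I a b e' f') : e = e' ∧ f = f' :=
  ⟨hI.eq_of_inc_not_reach h.left_mem h'.left_mem h.inc_left h'.inc_left h.reach h.cut_left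
    h'.cut_left, hI.eq_of_inc_not_reach h.right_mem h'.right_mem h.inc_right h'.inc_right
    h.reach.symm (fun k => h.cut_right k.symm) fun k => h'.cut_right k.symm⟩

/-- In a vertex colouring with two colours, extreme ends of different colours are determined by the
unordered pair of edges. -/
theorem IsAcyclic.ends_unique (hI : (G.restrict I).IsAcyclic) {p : α → Prop} {a b a' b' : α}
    {e' f' : β} (h : G.EndPair I a b e f) (h' : G.EndPair I a' b' e' f') (ha : p a) (hb : ¬ p b)
    (ha' : p a') (hb' : ¬ p b') (hm : (e = e' ∧ f = f') ∨ (e = f' ∧ f = e')) :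
    a = a' ∧ b = b' := by
  have hab {u w} (hu : p u) (hw : ¬ p w) : u ≠ w := by rintro rfl; exact hw hu
  by_cases hef : e = f
  · subst hef
    obtain ⟨rfl, rfl⟩ : e' = e ∧ f' = e := by rcases hm with ⟨h, h'⟩ | ⟨h, h'⟩ <;> simp [← h, ← h']
    have h1 := h.inc_left.eq_or_eq_or_eq h.inc_right h'.inc_left
    have h2 := h.inc_left.eq_or_eq_or_eq h.inc_right h'.inc_right
    have := hab ha hb
    have := hab ha' hb
    have := hab ha hb'
    grind
  · rcases hm with ⟨rfl, rfl⟩ | ⟨rfl, rfl⟩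
    · have h1 : (G.restrict (I \ {e})).Reach b b' :=
        h.inc_right.reach_restrict h'.inc_right ⟨h.right_mem, fun k => hef k.symm⟩
      have h2 : (G.restrict (I \ {f})).Reach a a' :=
        h.inc_left.reach_restrict h'.inc_left ⟨h.left_mem, hef⟩
      exact ⟨hI.far_end_unique h.left_mem h.inc_left h'.inc_left h.reach h.cut_left
          fun k => h'.cut_left (k.trans h1),
        hI.far_end_unique h.right_mem h.inc_right h'.inc_right h.reach.symm
          (fun k => h.cut_right k.symm) fun k => h'.cut_right (k.trans h2).symm⟩
    -- With the two edges interchanged, `a` and `b'` would both be the end of `e` away from `f`,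
    -- although their colours differ.
    · have h1 : (G.restrict (I \ {e})).Reach a' b :=
        h'.inc_left.reach_restrict h.inc_right ⟨h.right_mem, fun k => hef k.symm⟩
      exact absurd (hI.far_end_unique h.left_mem h.inc_left h'.inc_right h.reach h.cut_left
        fun k => h'.cut_right (h1.trans k.symm)) (hab ha hb')

/-! ### Components -/

/-- The component of the vertex `x` in the spanning subgraph with edge set `I`. -/
def comp (G : Graph α β) (I : Set β) (x : α) : Set α := {y | (G.restrict I).Reach x y}

/-- The component of the edge `e` of `I` in the spanning subgraph with edge set `I`. -/
def edgeComp (G : Graph α β) (I : Set β) (e : β) : Set α :=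
  {y | ∃ x, G.Inc e x ∧ (G.restrict I).Reach x y}

theorem comp_eq_iff : G.comp I x = G.comp I y ↔ (G.restrict I).Reach x y := by
  constructor
  · intro h
    have : y ∈ G.comp I x := by rw [h]; exact .refl _ _
    exact this
  · intro h
    ext z
    exact ⟨fun k => h.symm.trans k, fun k => h.trans k⟩

theorem edgeComp_eq (he : e ∈ I) (hx : G.Inc e x) : G.edgeComp I e = G.comp I x := by
  ext z
  exact ⟨fun ⟨y, hy, h⟩ => (hx.reach_restrict hy he).trans h, fun h => ⟨x, hx, h⟩⟩

theorem EndPair.edgeComp_left {a b : α} (h : G.EndPair I a b e f) :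
    G.edgeComp I e = G.comp I a := edgeComp_eq h.left_mem h.inc_left

theorem EndPair.edgeComp_right {a b : α} (h : G.EndPair I a b e f) :
    G.edgeComp I f = G.comp I a := by
  rw [edgeComp_eq h.right_mem h.inc_right, comp_eq_iff.2 h.reach]

open Classical in
/-- A tree has one more vertex than it has edges. -/
theorem IsAcyclic.card_comp {K : Finset β} (hK : (G.restrict (K : Set β)).IsAcyclic)
    (hKE : (K : Set β) ⊆ E(G)) {V : Finset α} (hV : ∀ v, v ∈ V ↔ v ∈ V(G)) (hx : x ∈ V) :
    (V.filter fun v => G.comp K v = G.comp K x).card =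
      (K.filter fun e => G.edgeComp K e = G.comp K x).card + 1 := by
  have hxm : x ∈ V.filter fun v => G.comp K v = G.comp K x := by simp [hx]
  rw [← Finset.card_erase_add_one hxm, Nat.add_right_cancel_iff]
  -- Root the tree at `x`. Sending a vertex to the first edge of its path to `x` is a bijection onto
  -- the edges of the tree; the inverse picks the end of an edge that is away from `x`.
  have key : ∀ v ∈ (V.filter fun v => G.comp K v = G.comp K x).erase x,
      ∃ e ∈ (K : Set β), G.Inc e v ∧ ¬ (G.restrict (K \ {e})).Reach v x := by
    intro v hv
    simp only [Finset.mem_erase, Finset.mem_filter] at hv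
    exact hK.exists_inc_not_reach ((hV x).1 hx) (comp_eq_iff.1 hv.2.2) hv.1
  choose φ hφK hφi hφn using key
  refine Finset.card_bij φ ?_ ?_ ?_
  · intro v hv
    have hv' := hv
    simp only [Finset.mem_erase, Finset.mem_filter] at hv ⊢
    exact ⟨hφK v hv', (edgeComp_eq (hφK v hv') (hφi v hv')).trans hv.2.2⟩
  · intro v hv w hw hvw
    have hv' := hv
    simp only [Finset.mem_erase, Finset.mem_filter] at hv
    exact hK.far_end_unique (hφK v hv') (hφi v hv') (hvw ▸ hφi w hw) (comp_eq_iff.1 hv.2.2)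
      (hφn v hv') (hvw ▸ hφn w hw)
  · intro e he
    simp only [Finset.mem_filter] at he
    obtain ⟨p, q, hpq⟩ := G.exists_isLink_of_mem_edgeSet (hKE he.1)
    have hp : G.comp K p = G.comp K x := by rw [← he.2, edgeComp_eq he.1 hpq.inc_left]
    obtain ⟨v, hv, hvn⟩ := hK.exists_far_end he.1 hpq.inc_left (comp_eq_iff.1 hp)
    have hvc : G.comp K v = G.comp K x := by rw [← he.2, edgeComp_eq he.1 hv]
    have hvx : v ≠ x := by rintro rfl; exact hvn (.refl _ _)
    have hvm : v ∈ (V.filter fun v => G.comp K v = G.comp K x).erase x := by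
      simp [hvx, hvc, hV, hv.vertex_mem]
    exact ⟨v, hvm, hK.eq_of_inc_not_reach (hφK v hvm) he.1 (hφi v hvm) hv (comp_eq_iff.1 hvc)
      (hφn v hvm) hvn⟩

end Graph

/-! ## Partial transversals -/

section PartialTransversals

open Classical in
/-- The sets of elements of `s` with at most one element in each of the fibres of `κ` over `D`, and
none in the other fibres. -/
noncomputable def partialTransversals {ι : Type*} {γ : Type*} (κ : ι → γ) (s : Finset ι)
    (D : Finset γ) : Finset (Finset ι) :=
  s.powerset.filter fun T => Set.InjOn κ T ∧ ∀ x ∈ T, κ x ∈ D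

variable {ι : Type*} {γ : Type*} {κ : ι → γ} {s : Finset ι} {D : Finset γ} {T : Finset ι}

theorem mem_partialTransversals : T ∈ partialTransversals κ s D ↔
    T ⊆ s ∧ Set.InjOn κ T ∧ ∀ x ∈ T, κ x ∈ D := by
  simp [partialTransversals]

theorem card_le_of_mem_partialTransversals (h : T ∈ partialTransversals κ s D) :
    T.card ≤ D.card := by
  obtain ⟨-, h1, h2⟩ := mem_partialTransversals.1 h
  exact Finset.card_le_card_of_injOn κ h2 h1

/-- The choices in different fibres are independent: a fibre contributes `t` if it is left empty and
1 for each element that may be chosen in it. The truncated subtraction is harmless by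
`card_le_of_mem_partialTransversals`. -/
theorem sum_partialTransversals [DecidableEq γ] {R : Type*} [CommRing R] (t : R) :
    ∑ T ∈ partialTransversals κ s D, t ^ (D.card - T.card) =
      ∏ c ∈ D, (t + ((s.filter fun x => κ x = c).card : R)) := by
  classical
  induction D using Finset.induction_on with
  | empty =>
    have : partialTransversals κ s ∅ = {∅} := by
      ext T
      simp only [mem_partialTransversals, Finset.mem_singleton]
      constructor
      · rintro ⟨-, -, h⟩
        exact Finset.eq_empty_of_forall_notMem fun x hx => by simpa using h x hx
      · rintro rfl; simp
    simp [this]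
  | @insert c D hc ih =>
    have hnot {T} (hT : T ∈ partialTransversals κ s D) {x} (hx : κ x = c) : x ∉ T := fun h =>
      hc (hx ▸ (mem_partialTransversals.1 hT).2.2 x h)
    have hsplit : partialTransversals κ s (insert c D) = partialTransversals κ s D ∪
        ((s.filter fun x => κ x = c) ×ˢ partialTransversals κ s D).image
          (fun p => insert p.1 p.2) := by
      ext T
      simp only [Finset.mem_union, Finset.mem_image, Finset.mem_product, Prod.exists,
        Finset.mem_filter]
      constructor
      · intro hT
        obtain ⟨h1, h2, h3⟩ := mem_partialTransversals.1 hT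
        by_cases h : ∃ x ∈ T, κ x = c
        · obtain ⟨x, hxT, hx⟩ := h
          refine .inr ⟨x, T.erase x, ⟨⟨h1 hxT, hx⟩, mem_partialTransversals.2 ⟨?_, ?_, ?_⟩⟩,
            Finset.insert_erase hxT⟩
          · exact (Finset.erase_subset _ _).trans h1
          · exact h2.mono (by simp)
          · intro y hy
            rw [Finset.mem_erase] at hy
            refine (Finset.mem_insert.1 (h3 y hy.2)).resolve_left fun hyc => hy.1 ?_
            exact h2 hy.2 hxT (hyc.trans hx.symm)
        · push Not at h
          exact .inl (mem_partialTransversals.2 ⟨h1, h2, fun x hx =>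
            (Finset.mem_insert.1 (h3 x hx)).resolve_left (h x hx)⟩)
      · rintro (hT | ⟨x, T, ⟨⟨hxs, hx⟩, hT⟩, rfl⟩)
        · obtain ⟨h1, h2, h3⟩ := mem_partialTransversals.1 hT
          exact mem_partialTransversals.2 ⟨h1, h2, fun x hx => Finset.mem_insert_of_mem (h3 x hx)⟩
        · obtain ⟨h1, h2, h3⟩ := mem_partialTransversals.1 hT
          refine mem_partialTransversals.2 ⟨Finset.insert_subset hxs h1, ?_, ?_⟩
          · rw [Finset.coe_insert, Set.injOn_insert (by simpa using hnot hT hx)]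
            refine ⟨h2, ?_⟩
            rintro ⟨y, hy, hyx⟩
            exact hnot hT (hyx.trans hx) hy
          · intro y hy
            rcases Finset.mem_insert.1 hy with rfl | hy
            · simp [hx]
            · exact Finset.mem_insert_of_mem (h3 y hy)
    have hdisj : Disjoint (partialTransversals κ s D)
        (((s.filter fun x => κ x = c) ×ˢ partialTransversals κ s D).image
          (fun p => insert p.1 p.2)) := by
      rw [Finset.disjoint_left]
      simp only [Finset.mem_image, Finset.mem_product, Prod.exists, Finset.mem_filter]
      rintro _ hT ⟨x, T, ⟨⟨-, hx⟩, -⟩, rfl⟩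
      exact hnot hT hx (by simp)
    have hinj : Set.InjOn (fun p : ι × Finset ι => insert p.1 p.2)
        ((s.filter fun x => κ x = c) ×ˢ partialTransversals κ s D : Finset _) := by
      rintro ⟨x, T⟩ hx ⟨y, U⟩ hy hxy
      simp only [Finset.coe_product, Set.mem_prod, Finset.mem_coe, Finset.mem_filter] at hx hy hxy
      have hxU : x ∉ U := hnot hy.2 hx.1.2
      have hyT : y ∉ T := hnot hx.2 hy.1.2
      have hxT : x ∉ T := hnot hx.2 hx.1.2
      have hyU : y ∉ U := hnot hy.2 hy.1.2
      obtain rfl : x = y := by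
        have : x ∈ insert y U := hxy ▸ Finset.mem_insert_self _ _
        exact (Finset.mem_insert.1 this).resolve_right hxU
      rw [Prod.mk.injEq]
      refine ⟨rfl, ?_⟩
      rw [← Finset.erase_insert hxT, hxy, Finset.erase_insert hyU]
    rw [hsplit, Finset.sum_union hdisj, Finset.sum_image hinj, Finset.sum_product,
      Finset.prod_insert hc, ← ih, add_mul, Finset.mul_sum, Finset.card_insert_of_notMem hc]
    congr 1
    · refine Finset.sum_congr rfl fun T hT => ?_
      rw [← pow_succ', Nat.succ_sub (card_le_of_mem_partialTransversals hT)]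
    · rw [← nsmul_eq_mul, ← Finset.sum_const]
      refine Finset.sum_congr rfl fun x hx => Finset.sum_congr rfl fun T hT => ?_
      rw [Finset.card_insert_of_notMem (hnot hT (Finset.mem_filter.1 hx).2), Nat.add_sub_add_right]

end PartialTransversals

/-! ### Rootings of a vertex-coloured forest -/

namespace Graph

variable {α : Type u} {β : Type v} {G : Graph α β}

theorem reach_congr {H : Graph α β} (h : ∀ e x y, G.IsLink e x y ↔ H.IsLink e x y) {x y : α} :
    G.Reach x y ↔ H.Reach x y := by
  have : G.Adj = H.Adj := by
    ext x y
    exact exists_congr fun e => h e x y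
  simp [Reach, this]

/-- `R` is a rooting of the forest `K`, whose vertices are coloured by `p`: no two elements of `R`
lie in the same component, except possibly for one pair, which then has extreme ends of different
colours. -/
def IsRooting (G : Graph α β) (K : Set β) (p : α → Prop) (R : Multiset β) : Prop :=
  (R.map (G.edgeComp K)).Nodup ∨ ∃ e f S, R = e ::ₘ f ::ₘ S ∧
    ((f ::ₘ S).map (G.edgeComp K)).Nodup ∧ ∃ a b, p a ∧ ¬ p b ∧ G.EndPair K a b e f

/-- Removes the asymmetry in `IsRooting`: if it is `b` that has colour `p`, the pair is read
backwards, and the condition on `f ::ₘ S` carries over to `e ::ₘ S` because both edges lie in the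
same component. -/
theorem EndPair.isRooting {K : Set β} {p : α → Prop} {S : Multiset β} {a b : α} {e f : β}
    (h : G.EndPair K a b e f) (hS : ((f ::ₘ S).map (G.edgeComp K)).Nodup) (hp : ¬ (p a ↔ p b)) :
    G.IsRooting K p (e ::ₘ f ::ₘ S) := by
  by_cases ha : p a
  · exact .inr ⟨e, f, S, rfl, hS, a, b, ha, fun hb => hp (by simp [ha, hb]), h⟩
  · have hb : p b := by by_contra hb; exact hp (by simp [ha, hb])
    refine .inr ⟨f, e, S, Multiset.cons_swap _ _ _, ?_, b, a, hb, ha, h.symm⟩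
    rwa [Multiset.map_cons, h.edgeComp_left, ← h.edgeComp_right, ← Multiset.map_cons]

theorem _root_.Multiset.le_cons_iff {ι : Type*} {a : ι} {s t : Multiset ι} :
    s ≤ a ::ₘ t ↔ s ≤ t ∨ ∃ s', s = a ::ₘ s' ∧ s' ≤ t := by
  classical
  constructor
  · intro h
    by_cases ha : a ∈ s
    · exact .inr ⟨s.erase a, (Multiset.cons_erase ha).symm, Multiset.erase_le_iff_le_cons.2 h⟩
    · exact .inl ((Multiset.le_cons_of_notMem ha).1 h)
  · rintro (h | ⟨s', rfl, h⟩)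
    · exact h.trans (Multiset.le_cons_self _ _)
    · exact Multiset.cons_le_cons _ h

theorem comp_mono {I J : Set β} (hIJ : I ⊆ J) {x y : α} (h : G.comp I x = G.comp I y) :
    G.comp J x = G.comp J y := comp_eq_iff.2 ((comp_eq_iff.1 h).mono hIJ)

theorem edgeComp_mono {I J : Set β} (hIJ : I ⊆ J) (hJ : J ⊆ E(G)) {e f : β} (he : e ∈ I)
    (hf : f ∈ I) (h : G.edgeComp I e = G.edgeComp I f) : G.edgeComp J e = G.edgeComp J f := by
  obtain ⟨x, y, hl⟩ := G.exists_isLink_of_mem_edgeSet (hJ (hIJ he))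
  obtain ⟨x', y', hl'⟩ := G.exists_isLink_of_mem_edgeSet (hJ (hIJ hf))
  rw [edgeComp_eq he hl.inc_left, edgeComp_eq hf hl'.inc_left] at h
  rw [edgeComp_eq (hIJ he) hl.inc_left, edgeComp_eq (hIJ hf) hl'.inc_left]
  exact comp_mono hIJ h

theorem nodup_map_edgeComp_mono {I J : Set β} (hIJ : I ⊆ J) (hJ : J ⊆ E(G)) {R S : Multiset β}
    (hRS : R ≤ S) (hR : ∀ e ∈ R, e ∈ I) (hS : (S.map (G.edgeComp J)).Nodup) :
    (R.map (G.edgeComp I)).Nodup := by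
  have hR' := Multiset.nodup_of_le (Multiset.map_le_map hRS) hS
  refine Multiset.Nodup.map_on ?_ (Multiset.Nodup.of_map _ hR')
  intro e he f hf hef
  exact Multiset.inj_on_of_nodup_map hR' e he f hf (edgeComp_mono hIJ hJ (hR e he) (hR f hf) hef)

/-- Components only get finer in a smaller edge set, so distinct components stay distinct. The
exceptional pair either loses a member, or is split between two components, or keeps its extreme
ends, because an edge that separates them in `J` still does so in `I`. -/
theorem IsRooting.mono {I J : Set β} {p : α → Prop} {R S : Multiset β} (h : G.IsRooting J p S)
    (hIJ : I ⊆ J) (hJ : J ⊆ E(G)) (hRS : R ≤ S) (hR : ∀ e ∈ R, e ∈ I) : G.IsRooting I p R := by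
  rcases h with h | ⟨e, f, T, rfl, hT, a, b, ha, hb, hab⟩
  · exact .inl (nodup_map_edgeComp_mono hIJ hJ hRS hR h)
  -- `e` and `f` play symmetric roles, so the roots lie in distinct components whichever member of
  -- the pair is dropped.
  have hT' : ((e ::ₘ T).map (G.edgeComp J)).Nodup := by
    rwa [Multiset.map_cons, hab.edgeComp_left, ← hab.edgeComp_right, ← Multiset.map_cons]
  rcases Multiset.le_cons_iff.1 hRS with h | ⟨R, rfl, hR'⟩
  · exact .inl (nodup_map_edgeComp_mono hIJ hJ h hR hT)
  rcases Multiset.le_cons_iff.1 hR' with h | ⟨R, rfl, hR''⟩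
  · exact .inl (nodup_map_edgeComp_mono hIJ hJ (Multiset.cons_le_cons _ h) hR hT')
  have he : e ∈ I := hR e (by simp)
  have hf : f ∈ I := hR f (by simp)
  have hn : ((f ::ₘ R).map (G.edgeComp I)).Nodup :=
    nodup_map_edgeComp_mono hIJ hJ (Multiset.cons_le_cons _ hR'')
      (fun g hg => hR g (Multiset.mem_cons_of_mem hg)) hT
  by_cases hef : G.edgeComp I e = G.edgeComp I f
  · refine .inr ⟨e, f, R, rfl, hn, a, b, ha, hb, he, hf, hab.inc_left, hab.inc_right, ?_,
      fun h => hab.cut_left (h.mono (Set.sdiff_subset_sdiff_left hIJ)),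
      fun h => hab.cut_right (h.mono (Set.sdiff_subset_sdiff_left hIJ))⟩
    rwa [edgeComp_eq he hab.inc_left, edgeComp_eq hf hab.inc_right, comp_eq_iff] at hef
  · left
    rw [Multiset.map_cons, Multiset.nodup_cons]
    refine ⟨?_, hn⟩
    rw [Multiset.map_cons, Multiset.mem_cons, not_or]
    refine ⟨hef, ?_⟩
    rw [Multiset.mem_map]
    rintro ⟨g, hg, hge⟩
    rw [Multiset.map_cons, Multiset.nodup_cons] at hT'
    exact hT'.1 (Multiset.mem_map.2 ⟨g, Multiset.mem_of_le hR'' hg,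
      edgeComp_mono hIJ hJ (hR g (by simp [hg])) he hge⟩)

end Graph

/-! ### The reduced graph inside the biconed graph -/

namespace Bicone

variable {α : Type u} {β : Type v} {G : Graph α β} {A B : Set α} {hAB : V(G) = A ∪ B}

/-- The vertices in `A`; the bridging edges join them to other vertices. -/
def IsLeft (A : Set α) (x : BiconeVertex α) : Prop := x ∈ BiconeVertex.old '' A

/-- All edges at the vertex 0 belong to T₀, so the deletion of this vertex removes no further edge.
-/
theorem reduced_isLink {e : BiconeEdge α β} {x y : BiconeVertex α} :
    (reduced G A B hAB).IsLink e x y ↔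
      (graph G A B hAB).IsLink e x y ∧ e ∉ baseTree (β := β) A B := by
  simp only [reduced, Graph.deleteVerts_isLink, Graph.deleteEdges_isLink]
  constructor
  · rintro ⟨⟨h, h'⟩, -⟩
    exact ⟨h, h'⟩
  · rintro ⟨h, h'⟩
    refine ⟨⟨h, h'⟩, ?_, ?_⟩
    · rintro rfl
      cases h <;> simp_all [baseTree]
    · rintro rfl
      cases h <;> simp_all [baseTree]

theorem mem_edgeSet_reduced {e : BiconeEdge α β} : e ∈ E(reduced G A B hAB) ↔
    e ∈ E(graph G A B hAB) ∧ e ∉ baseTree (β := β) A B := by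
  simp only [Graph.edge_mem_iff_exists_isLink, reduced_isLink]
  grind

theorem mem_vertexSet_reduced {x : BiconeVertex α} : x ∈ V(reduced G A B hAB) ↔
    x ∈ V(graph G A B hAB) ∧ x ≠ .zero := by
  simp [reduced]

theorem inc_cone {x : BiconeVertex α} :
    (graph G A B hAB).Inc .cone x ↔ x = .zero ∨ x = .zeroBar := by
  constructor
  · rintro ⟨y, h⟩
    cases h <;> simp
  · rintro (rfl | rfl)
    · exact ⟨_, IsLink.cone⟩
    · exact ⟨_, IsLink.cone'⟩

theorem isLink_cone : (graph G A B hAB).IsLink .cone .zero .zeroBar := IsLink.cone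

theorem not_inc_zero {e : BiconeEdge α β} (he : e ∈ E(reduced G A B hAB)) :
    ¬ (graph G A B hAB).Inc e .zero := by
  rintro ⟨x, h⟩
  have := (mem_edgeSet_reduced.1 he).2
  cases h <;> simp_all [baseTree]

theorem cone_notMem : (.cone : BiconeEdge α β) ∉ E(reduced G A B hAB) := fun h =>
  not_inc_zero h (inc_cone.2 (.inl rfl))

/-- The vertices of the reduced graph outside `A` are precisely those of Ā together with 0̄, so
bridging edges are the bicoloured ones. -/
theorem isBridging_iff {e : BiconeEdge α β} {x y : BiconeVertex α}
    (h : (reduced G A B hAB).IsLink e x y) :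
    IsBridging G A B hAB e ↔ ¬ (IsLeft A x ↔ IsLeft A y) := by
  have key : ∀ z ∈ V(reduced G A B hAB),
      z ∈ BiconeVertex.old '' (B \ A) ∪ {.zeroBar} ↔ ¬ IsLeft A z := by
    intro z hz
    obtain ⟨hz, hz'⟩ := mem_vertexSet_reduced.1 hz
    cases z with
    | zero => exact absurd rfl hz'
    | zeroBar => simp [IsLeft]
    | old z => 
      have : z ∈ A ∪ B := by rw [← hAB]; simpa [graph] using hz
      simp [IsLeft]
      grind
  constructor
  · rintro ⟨x', hx', y', hy', h'⟩
    have hx' : IsLeft A x' := hx'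
    rw [key _ h'.right_mem] at hy'
    rcases h.eq_and_eq_or_eq_and_eq h' with ⟨rfl, rfl⟩ | ⟨rfl, rfl⟩ <;> simp [hx', hy']
  · intro hxy
    by_cases hx : IsLeft A x
    · exact ⟨x, hx, y, (key y h.right_mem).2 fun hy => hxy (by simp [hx, hy]), h⟩
    · have hy : IsLeft A y := by by_contra hy; exact hxy (by simp [hx, hy])
      exact ⟨y, hy, x, (key x h.left_mem).2 hx, h.symm⟩

theorem reach_reduced {I : Set (BiconeEdge α β)} (hI : I ⊆ E(reduced G A B hAB))
    {x y : BiconeVertex α} : ((reduced G A B hAB).restrict I).Reach x y ↔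
      ((graph G A B hAB).restrict I).Reach x y := by
  refine Graph.reach_congr fun e x y => ?_
  simp only [Graph.restrict_isLink, reduced_isLink]
  constructor
  · rintro ⟨h, h', -⟩
    exact ⟨h, h'⟩
  · rintro ⟨h, h'⟩
    exact ⟨h, h', (mem_edgeSet_reduced.1 (hI h)).2⟩

theorem acyclic_reduced {I : Set (BiconeEdge α β)} (hI : I ⊆ E(reduced G A B hAB)) :
    ((reduced G A B hAB).restrict I).IsAcyclic ↔ ((graph G A B hAB).restrict I).IsAcyclic := by
  rw [Graph.isAcyclic_restrict_iff, Graph.isAcyclic_restrict_iff]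
  simp only [reach_reduced (Set.sdiff_subset.trans hI), reduced_isLink]
  constructor
  · intro h e x y he hl
    exact h e x y he ⟨hl, (mem_edgeSet_reduced.1 (hI he)).2⟩
  · intro h e x y he hl
    exact h e x y he hl.1

/-- The edge 00̄ is the only one at 0, so 0 is pendant and is never passed on the way between other
vertices. -/
theorem reach_insert_cone {I : Set (BiconeEdge α β)} (hI : I ⊆ E(reduced G A B hAB))
    {x y : BiconeVertex α} (hx : x ≠ .zero) (hy : y ≠ .zero) :
    ((graph G A B hAB).restrict (insert .cone I)).Reach x y ↔
      ((graph G A B hAB).restrict I).Reach x y := by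
  have hz : ∀ e ∈ I, ¬ (graph G A B hAB).Inc e .zero := fun e he => not_inc_zero (hI he)
  refine ⟨fun h => ?_, fun h => h.mono (Set.subset_insert _ _)⟩
  rcases h.insert_cases isLink_cone with h | ⟨h, -⟩ | ⟨-, h⟩
  · exact h
  · exact absurd (h.symm.eq_of_forall_not_inc hz).symm hx
  · exact absurd (h.eq_of_forall_not_inc hz).symm hy

theorem acyclic_insert_cone {I : Set (BiconeEdge α β)} (hI : I ⊆ E(reduced G A B hAB)) :
    ((graph G A B hAB).restrict (insert .cone I)).IsAcyclic ↔
      ((graph G A B hAB).restrict I).IsAcyclic := by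
  rw [Graph.isAcyclic_insert_iff (fun h => cone_notMem (hI h)) isLink_cone]
  refine and_iff_left fun h => ?_
  exact nomatch h.eq_of_forall_not_inc fun e he => not_inc_zero (hI he)

end Bicone

/-! ### 2-edge-rooted forests as rootings -/

namespace Bicone

variable {α : Type u} {β : Type v} {G : Graph α β} {A B : Set α} {hAB : V(G) = A ∪ B}

/-- Move the vertex `0` to `0̄`. -/
def projZero : BiconeVertex α → BiconeVertex α
  | .zero => .zeroBar
  | x => x

theorem projZero_ne (x : BiconeVertex α) : projZero x ≠ .zero := by cases x <;> simp [projZero]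

theorem projZero_of_ne {x : BiconeVertex α} (hx : x ≠ .zero) : projZero x = x := by
  cases x <;> simp_all [projZero]

theorem isLeft_projZero {x : BiconeVertex α} : IsLeft A (projZero x) ↔ IsLeft A x := by
  cases x <;> simp [projZero, IsLeft]

theorem reach_projZero {J : Set (BiconeEdge α β)} (hJ : .cone ∈ J) (x : BiconeVertex α) :
    ((graph G A B hAB).restrict J).Reach x (projZero x) := by
  cases x
  · exact isLink_cone.reach_restrict hJ
  · exact .refl _ _
  · exact .refl _ _

theorem projZero_mem {x : BiconeVertex α} (hx : x ∈ V(graph G A B hAB)) :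
    projZero x ∈ V(reduced G A B hAB) := by
  refine mem_vertexSet_reduced.2 ⟨?_, projZero_ne x⟩
  cases x
  · simp [projZero, graph]
  · exact hx
  · exact hx

open Classical in
/-- The edge roots of `m`, together with the edge `00̄` as a root of the component of `0̄`. -/
noncomputable def coneRoots (m : Multiset (BiconeEdge α β)) : Multiset (BiconeEdge α β) :=
  .cone ::ₘ (m - m.dedup)

/-- The edges of `m`, together with the edge `00̄`. -/
def coneSupport (m : Multiset (BiconeEdge α β)) : Set (BiconeEdge α β) :=
  insert .cone {e | e ∈ m}

open Classical in
theorem mem_sub_dedup {ι : Type*} {m : Multiset ι} {e : ι} : e ∈ m - m.dedup ↔ 2 ≤ m.count e := by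
  rw [← Multiset.count_pos, Multiset.count_sub, Multiset.count_dedup]
  split_ifs with h
  · omega
  · rw [Multiset.count_eq_zero.2 h]; omega

theorem mem_of_mem_coneRoots {m : Multiset (BiconeEdge α β)} {e : BiconeEdge α β}
    (he : e ∈ coneRoots m) : e ∈ coneSupport m := by
  classical
  rcases Multiset.mem_cons.1 he with rfl | he
  · exact .inl rfl
  · refine .inr (Multiset.count_pos.1 ?_)
    have := mem_sub_dedup.1 he
    omega

section Support

variable {m : Multiset (BiconeEdge α β)}

theorem support_edges_subset (hm : ∀ e ∈ m, e ∈ E(reduced G A B hAB)) :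
    {e | e ∈ m} ⊆ E(reduced G A B hAB) := hm

theorem coneSupport_subset (hm : ∀ e ∈ m, e ∈ E(reduced G A B hAB)) :
    coneSupport m ⊆ E(graph G A B hAB) := by
  rintro e (rfl | he)
  · exact isLink_cone.edge_mem
  · exact (mem_edgeSet_reduced.1 (hm e he)).1

theorem comp_coneSupport_eq (hm : ∀ e ∈ m, e ∈ E(reduced G A B hAB)) {x y : BiconeVertex α}
    (hx : x ≠ .zero) (hy : y ≠ .zero) :
    (graph G A B hAB).comp (coneSupport m) x = (graph G A B hAB).comp (coneSupport m) y ↔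
      (support G A B hAB m).Reach x y := by
  rw [Graph.comp_eq_iff, coneSupport, reach_insert_cone (support_edges_subset hm) hx hy, support,
    reach_reduced (support_edges_subset hm)]

theorem edgeComp_cone : (graph G A B hAB).edgeComp (coneSupport m) .cone =
    (graph G A B hAB).comp (coneSupport m) .zeroBar :=
  Graph.edgeComp_eq (.inl rfl) (inc_cone.2 (.inr rfl))

theorem inComponent_iff (hm : ∀ e ∈ m, e ∈ E(reduced G A B hAB)) {x : BiconeVertex α}
    (hx : x ≠ .zero) {e : BiconeEdge α β} : InComponent G A B hAB m x e ↔
      e ∈ m ∧ (graph G A B hAB).edgeComp (coneSupport m) e =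
        (graph G A B hAB).comp (coneSupport m) x := by
  have hinc {e y} : (support G A B hAB m).Inc e y ↔ e ∈ m ∧ (graph G A B hAB).Inc e y := by
    constructor
    · rintro ⟨z, h, hl⟩
      exact ⟨h, z, (reduced_isLink.1 hl).1⟩
    · rintro ⟨h, z, hl⟩
      exact ⟨z, h, reduced_isLink.2 ⟨hl, (mem_edgeSet_reduced.1 (hm e h)).2⟩⟩
  have hy0 {e y} (he : e ∈ m) (hy : (graph G A B hAB).Inc e y) : y ≠ .zero := by
    rintro rfl
    exact not_inc_zero (hm e he) hy
  constructor
  · rintro ⟨y, hy, hr⟩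
    rw [hinc] at hy
    refine ⟨hy.1, ?_⟩
    rw [Graph.edgeComp_eq (.inr hy.1) hy.2, eq_comm]
    exact (comp_coneSupport_eq hm hx (hy0 hy.1 hy.2)).2 hr
  · rintro ⟨he, h⟩
    obtain ⟨y, z, hl⟩ := (graph G A B hAB).exists_isLink_of_mem_edgeSet
      (mem_edgeSet_reduced.1 (hm e he)).1
    rw [Graph.edgeComp_eq (.inr he) hl.inc_left, eq_comm,
      comp_coneSupport_eq hm hx (hy0 he hl.inc_left)] at h
    exact ⟨y, hinc.2 ⟨he, hl.inc_left⟩, h⟩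

open Classical in
-- In `m - m.dedup` an edge of multiplicity k occurs k - 1 times, once for each edge root, and the
-- additional root 00̄ lies in the component of 0̄. Conditions on root numbers thus become
-- conditions on multiplicities in a multiset of components.
theorem rootNumber_eq (hm : ∀ e ∈ m, e ∈ E(reduced G A B hAB)) {x : BiconeVertex α}
    (hx : x ≠ .zero) : rootNumber G A B hAB m x =
      ((coneRoots m).map ((graph G A B hAB).edgeComp (coneSupport m))).count
        ((graph G A B hAB).comp (coneSupport m) x) := by
  rw [coneRoots, Multiset.map_cons, Multiset.count_cons, rootNumber]
  congr 1
  · rw [Multiset.count_map, ← Multiset.sum_count_eq_card (s := m.toFinset)]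
    · rw [Finset.sum_filter]
      refine Finset.sum_congr rfl fun e he => ?_
      have he : e ∈ m := by simpa using he
      rw [inComponent_iff hm hx, Multiset.count_filter, Multiset.count_sub, Multiset.count_dedup,
        if_pos he]
      simp [he, eq_comm]
    · intro e he
      rw [Multiset.mem_toFinset]
      exact Multiset.mem_of_le (Multiset.sub_le_self _ _) (Multiset.mem_of_mem_filter he)
  · simp only [edgeComp_cone, comp_coneSupport_eq hm hx (by simp : BiconeVertex.zeroBar ≠ .zero)]

end Support

open Classical in
-- Along a path the colour changes at the bridging edges and nowhere else.
theorem odd_countP_isBridging {I : Set (BiconeEdge α β)} {x y : BiconeVertex α}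
    {vs : List (BiconeVertex α)} {es : List (BiconeEdge α β)}
    (h : ((reduced G A B hAB).restrict I).IsPathFrom x y vs es) :
    Odd (es.countP fun e => IsBridging G A B hAB e) ↔ ¬ (IsLeft A x ↔ IsLeft A y) := by
  induction h with
  | nil => simp
  | @cons x y z e vs es hl hp hx ih =>
    rw [List.countP_cons]
    by_cases hb : IsBridging G A B hAB e
    · rw [if_pos (by simpa using hb), Nat.odd_add_one, ih]
      rw [isBridging_iff hl.2] at hb
      tauto
    · rw [if_neg (by simpa using hb), add_zero, ih]
      rw [isBridging_iff hl.2] at hb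
      tauto

open Classical in
/-- The path between extreme ends of the roots of a component is a shortest root path, and all
shortest root paths have the same bridging edges. -/
theorem EndPair.exists_isShortestRootPath {m : Multiset (BiconeEdge α β)}
    (hm : ∀ e ∈ m, e ∈ E(reduced G A B hAB)) (hac : (support G A B hAB m).IsAcyclic)
    {x : BiconeVertex α} (hx : x ≠ .zero) {u w : BiconeVertex α} {e f : BiconeEdge α β}
    (huw : (graph G A B hAB).EndPair (coneSupport m) u w e f)
    (hroots : ∀ g, g ∈ coneRoots m ∧ (graph G A B hAB).edgeComp (coneSupport m) g =
      (graph G A B hAB).comp (coneSupport m) x ↔ g = e ∨ g = f) :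
    (∃ vs es, IsShortestRootPath G A B hAB m x vs es) ∧
      ∀ vs es, IsShortestRootPath G A B hAB m x vs es →
        (Odd (es.countP fun e => IsBridging G A B hAB e) ↔ ¬ (IsLeft A u ↔ IsLeft A w)) := by
  set K := coneSupport m with hK
  have hcone : .cone ∈ K := .inl rfl
  -- An extreme end may be 0, which the reduced graph lacks; it is replaced by 0̄, which has the
  -- same colour.
  have hreach : (support G A B hAB m).Reach (projZero u) (projZero w) := by
    rw [← comp_coneSupport_eq hm (projZero_ne u) (projZero_ne w), Graph.comp_eq_iff]
    exact ((reach_projZero hcone u).symm.trans huw.reach).trans (reach_projZero hcone w)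
  obtain ⟨vs, es, hp⟩ := Graph.Reach.exists_path (G := support G A B hAB m)
    (projZero_mem huw.inc_right.vertex_mem) hreach
  have hsep := hp.not_reach_sdiff hac
  -- facts about the two roots
  have hcut : ∀ g, g = e ∨ g = f → ¬ ((graph G A B hAB).restrict (K \ {g})).Reach u w := by
    rintro g (rfl | rfl)
    · exact huw.cut_left
    · exact huw.cut_right
  have hinc : ∀ g, g = e ∨ g = f → (graph G A B hAB).Inc g u ∨ (graph G A B hAB).Inc g w := by
    rintro g (rfl | rfl)
    · exact .inl huw.inc_left
    · exact .inr huw.inc_right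
  -- An edge root separates `u` from `w` and hence lies on the path. If 0̄ is in the component, then
  -- 00̄ is one of the two roots, and 0̄ is an end of the path.
  have hroot : IsRootPath G A B hAB m x vs es := by
    refine ⟨⟨_, _, hp⟩, fun g hg hg2 => ?_, fun h0 => ?_⟩
    · rw [inComponent_iff hm hx] at hg
      have hgef := (hroots g).1 ⟨Multiset.mem_cons_of_mem (mem_sub_dedup.2 hg2), hg.2⟩
      by_contra hges
      have hgc : .cone ∈ K \ {g} := ⟨hcone, by rintro rfl; exact cone_notMem (hm _ hg.1)⟩
      refine hcut g hgef (((reach_projZero hgc u).trans ?_).trans (reach_projZero hgc w).symm)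
      have h1 : (((reduced G A B hAB).restrict ({e | e ∈ m} \ {g}))).Reach
          (projZero u) (projZero w) :=
        (hp.restrict_mono (J := {e | e ∈ m} \ {g}) fun k hk hk' => ⟨hk', by rintro rfl; exact hges hk⟩).reach
      rw [reach_reduced (Set.sdiff_subset.trans (support_edges_subset hm))] at h1
      exact h1.mono (Set.sdiff_subset_sdiff_left (Set.subset_insert _ _))
    · have hc := (hroots .cone).1 ⟨Multiset.mem_cons_self _ _, by
        rw [hK, edgeComp_cone, eq_comm, comp_coneSupport_eq hm hx (by simp)]; exact h0⟩
      rcases hinc _ hc with h | h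
      · rcases inc_cone.1 h with rfl | rfl <;> exact hp.left_mem
      · rcases inc_cone.1 h with rfl | rfl <;> exact hp.right_mem
  have hmem : ∀ vs' es', IsRootPath G A B hAB m x vs' es' → ∀ g v, g = e ∨ g = f →
      (graph G A B hAB).Inc g v → projZero v ∈ vs' := by
    rintro vs' es' ⟨⟨y, z, hp'⟩, h1, h2⟩ g v hg hv
    obtain ⟨hgr, hgx⟩ := (hroots g).2 hg
    rcases Multiset.mem_cons.1 hgr with rfl | hgr
    · have : projZero v = .zeroBar := by rcases inc_cone.1 hv with rfl | rfl <;> rfl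
      rw [this]
      refine h2 ?_
      rwa [edgeComp_cone, eq_comm, comp_coneSupport_eq hm hx (by simp)] at hgx
    · have hg2 := mem_sub_dedup.1 hgr
      have hgm : g ∈ m := Multiset.count_pos.1 (by omega)
      have hv0 : v ≠ .zero := by rintro rfl; exact not_inc_zero (hm g hgm) hv
      rw [projZero_of_ne hv0]
      refine hp'.mem_of_inc (h1 g ((inComponent_iff hm hx).2 ⟨hgm, hgx⟩) hg2) ?_
      obtain ⟨v', hv'⟩ := hv
      exact ⟨v', hgm, reduced_isLink.2 ⟨hv', (mem_edgeSet_reduced.1 (hm g hgm)).2⟩⟩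
  -- Every root path visits both ends of the path `es`, and each edge of `es` separates these ends,
  -- so it cannot be avoided.
  have hsub : ∀ vs' es', IsRootPath G A B hAB m x vs' es' → es.Subperm es' := by
    intro vs' es' hr
    have hu := hmem vs' es' hr e u (.inl rfl) huw.inc_left
    have hw := hmem vs' es' hr f w (.inr rfl) huw.inc_right
    obtain ⟨⟨y, z, hp'⟩, -, -⟩ := hr
    refine List.subperm_of_subset hp.nodup_edges fun g hg => ?_
    by_contra hg'
    have hall : ∀ k ∈ es', k ∈ {e | e ∈ m} \ {g} := fun k hk =>
      ⟨hp'.mem_of_restrict k hk, by rintro rfl; exact hg' hk⟩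
    exact hsep g hg ((hp'.of_restrict.reach_of_mem hall _ hu).symm.trans
      (hp'.of_restrict.reach_of_mem hall _ hw))
  refine ⟨⟨vs, es, hroot, fun vs' es' h => (hsub vs' es' h).length_le⟩, ?_⟩
  intro vs' es' h
  have hperm : es.Perm es' := (hsub vs' es' h.1).perm_of_length_le (h.2 vs es hroot)
  rw [← hperm.countP_eq, odd_countP_isBridging hp, isLeft_projZero, isLeft_projZero]

open Classical in
/-- The `2`-edge-rooted forests in terms of rootings. -/
theorem isTwoEdgeRootedForest_iff {m : Multiset (BiconeEdge α β)} :
    IsTwoEdgeRootedForest G A B hAB m ↔ (∀ e ∈ m, e ∈ E(reduced G A B hAB)) ∧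
      ((graph G A B hAB).restrict (coneSupport m)).IsAcyclic ∧
      (graph G A B hAB).IsRooting (coneSupport m) (IsLeft A) (coneRoots m) := by
  set κ := (graph G A B hAB).edgeComp (coneSupport m) with hκ
  constructor
  · intro h
    have hm := h.edges_mem
    have hac : ((graph G A B hAB).restrict (coneSupport m)).IsAcyclic := by
      rw [coneSupport, acyclic_insert_cone (support_edges_subset hm),
        ← acyclic_reduced (support_edges_subset hm)]
      exact h.forest
    refine ⟨hm, hac, ?_⟩
    by_cases hnd : ((coneRoots m).map κ).Nodup
    · exact .inl hnd
    -- every component of a root is the component of a vertex of the reduced graph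
    have hrep : ∀ g ∈ coneRoots m, ∃ x ∈ V(reduced G A B hAB),
        κ g = (graph G A B hAB).comp (coneSupport m) x := by
      intro g hg
      obtain ⟨x, y, hl⟩ := (graph G A B hAB).exists_isLink_of_mem_edgeSet
        (coneSupport_subset hm (mem_of_mem_coneRoots hg))
      refine ⟨projZero x, projZero_mem hl.left_mem, ?_⟩
      rw [hκ, Graph.edgeComp_eq (mem_of_mem_coneRoots hg) hl.inc_left, Graph.comp_eq_iff]
      exact reach_projZero (.inl rfl) x
    have hle : ∀ c, ((coneRoots m).map κ).count c ≤ 2 := by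
      intro c
      by_cases hc : c ∈ (coneRoots m).map κ
      · obtain ⟨g, hg, rfl⟩ := Multiset.mem_map.1 hc
        obtain ⟨x, hx, hgx⟩ := hrep g hg
        rw [hgx, ← rootNumber_eq hm (mem_vertexSet_reduced.1 hx).2]
        exact h.le_two x hx
      · rw [Multiset.count_eq_zero.2 hc]; omega
    obtain ⟨c, hc⟩ : ∃ c, 2 ≤ ((coneRoots m).map κ).count c := by
      by_contra hcon
      push Not at hcon
      exact hnd (Multiset.nodup_iff_count_le_one.2 fun c => Nat.lt_succ_iff.1 (hcon c))
    have huniq : ∀ c', 2 ≤ ((coneRoots m).map κ).count c' → c' = c := by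
      intro c' hc'
      obtain ⟨g, hg, rfl⟩ := Multiset.mem_map.1 (Multiset.count_pos.1
      (lt_of_lt_of_le zero_lt_two hc))
      obtain ⟨g', hg', rfl⟩ := Multiset.mem_map.1 (Multiset.count_pos.1
        (lt_of_lt_of_le zero_lt_two hc'))
      obtain ⟨x, hx, hgx⟩ := hrep g hg
      obtain ⟨x', hx', hgx'⟩ := hrep g' hg'
      have h0 := (mem_vertexSet_reduced.1 hx).2
      have h0' := (mem_vertexSet_reduced.1 hx').2
      rw [hgx, hgx', comp_coneSupport_eq hm h0' h0]
      refine h.unique_two x' hx' x hx ?_ ?_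
      · rw [rootNumber_eq hm h0', ← hgx']
        exact le_antisymm (hle _) hc'
      · rw [rootNumber_eq hm h0, ← hgx]
        exact le_antisymm (hle _) hc
    -- `e` and `f`, possibly the same edge twice, are the two roots in the only component that is
    -- met twice; the other roots `S` avoid it.
    obtain ⟨e, he, rfl⟩ := Multiset.mem_map.1 (Multiset.count_pos.1
      (lt_of_lt_of_le zero_lt_two hc))
    obtain ⟨T, hT⟩ := Multiset.exists_cons_of_mem he
    have hc2 := le_antisymm (hle _) hc
    rw [hT, Multiset.map_cons, Multiset.count_cons_self] at hc2
    obtain ⟨f, hf, hfe⟩ := Multiset.mem_map.1 (Multiset.count_pos.1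
      (by omega : 0 < (T.map κ).count (κ e)))
    obtain ⟨S, rfl⟩ := Multiset.exists_cons_of_mem hf
    have heS : κ e ∉ S.map κ := by
      rw [← Multiset.count_eq_zero]
      rw [Multiset.map_cons, hfe, Multiset.count_cons_self] at hc2
      omega
    have hSnd : ((f ::ₘ S).map κ).Nodup := by
      rw [Multiset.nodup_iff_count_le_one]
      intro c
      by_cases hce : c = κ e
      · rw [hce]; omega
      · by_contra hcon
        refine hce (huniq c ?_)
        rw [hT, Multiset.map_cons]
        have := Multiset.count_le_count_cons c (κ e) ((f ::ₘ S).map κ)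
        omega
    have heK := mem_of_mem_coneRoots he
    have hfK : f ∈ coneSupport m := mem_of_mem_coneRoots (by simp [hT])
    obtain ⟨x, hx, hex⟩ := hrep e he
    have hx0 := (mem_vertexSet_reduced.1 hx).2
    obtain ⟨p, _, hp⟩ := (graph G A B hAB).exists_isLink_of_mem_edgeSet (coneSupport_subset hm heK)
    obtain ⟨q, _, hq⟩ := (graph G A B hAB).exists_isLink_of_mem_edgeSet (coneSupport_subset hm hfK)
    have hpq : ((graph G A B hAB).restrict (coneSupport m)).Reach p q := by
      rw [← Graph.comp_eq_iff, ← Graph.edgeComp_eq heK hp.inc_left,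
        ← Graph.edgeComp_eq hfK hq.inc_left]
      exact hfe.symm
    obtain ⟨u, w, huw⟩ := hac.exists_extreme_ends heK hfK hp.inc_left hq.inc_left hpq
    -- The odd number of bridging edges on a shortest root path says that `u` and `w` have different
    -- colours.
    obtain ⟨vs, es, hshort, hodd⟩ := h.odd_bridging x hx (by
      rw [rootNumber_eq hm hx0, ← hex]
      exact le_antisymm (hle _) hc)
    have hroots : ∀ g, g ∈ coneRoots m ∧ κ g = (graph G A B hAB).comp (coneSupport m) x ↔
        g = e ∨ g = f := by
      intro g
      rw [← hex, hT, Multiset.mem_cons, Multiset.mem_cons]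
      constructor
      · rintro ⟨rfl | rfl | hg, hge⟩
        · exact .inl rfl
        · exact .inr rfl
        · exact absurd (Multiset.mem_map.2 ⟨g, hg, hge⟩) heS
      · rintro (rfl | rfl)
        · exact ⟨.inl rfl, rfl⟩
        · exact ⟨.inr (.inl rfl), hfe⟩
    rw [hT]
    exact huw.isRooting hSnd
      (((EndPair.exists_isShortestRootPath hm h.forest hx0 huw hroots).2 vs es hshort).1 hodd)
  · rintro ⟨hm, hac, hroot⟩
    have hforest : (support G A B hAB m).IsAcyclic := by
      rw [support, acyclic_reduced (support_edges_subset hm),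
        ← acyclic_insert_cone (support_edges_subset hm)]
      exact hac
    rcases hroot with hnd | ⟨e, f, S, hS, hnd, a, b, ha, hb, hab⟩
    · have hle : ∀ x ∈ V(reduced G A B hAB), rootNumber G A B hAB m x ≤ 1 := by
        intro x hx
        rw [rootNumber_eq hm (mem_vertexSet_reduced.1 hx).2]
        exact Multiset.nodup_iff_count_le_one.1 hnd _
      refine ⟨hm, hforest, fun x hx _ _ h => ?_, fun x hx => (hle x hx).trans one_le_two,
        fun x hx h => ?_⟩
      · have := hle x hx; omega
      · have := hle x hx; omega
    · have hfe : κ e = κ f := hab.edgeComp_left.trans hab.edgeComp_right.symm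
      have hle (c) : ((coneRoots m).map κ).count c ≤ if c = κ e then 2 else 1 := by
        rw [hS, Multiset.map_cons, Multiset.count_cons]
        have : ((f ::ₘ S).map κ).count c ≤ 1 := Multiset.nodup_iff_count_le_one.1 hnd c
        split_ifs <;> omega
      have heq {x} (hx : x ∈ V(reduced G A B hAB)) (h : rootNumber G A B hAB m x = 2) :
          (graph G A B hAB).comp (coneSupport m) x = κ e := by
        rw [rootNumber_eq hm (mem_vertexSet_reduced.1 hx).2] at h
        by_contra hcon
        have := hle ((graph G A B hAB).comp (coneSupport m) x)
        rw [if_neg hcon, h] at this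
        omega
      refine ⟨hm, hforest, fun x hx y hy h h' => ?_, fun x hx => ?_, fun x hx h => ?_⟩
      · rw [← comp_coneSupport_eq hm (mem_vertexSet_reduced.1 hx).2
          (mem_vertexSet_reduced.1 hy).2, heq hx h, heq hy h']
      · rw [rootNumber_eq hm (mem_vertexSet_reduced.1 hx).2]
        refine (hle _).trans ?_
        split_ifs <;> omega
      · have hroots : ∀ g, g ∈ coneRoots m ∧ κ g = (graph G A B hAB).comp (coneSupport m) x ↔
            g = e ∨ g = f := by
          intro g
          rw [heq hx h, hS, Multiset.mem_cons, Multiset.mem_cons]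
          constructor
          · rintro ⟨rfl | rfl | hg, hge⟩
            · exact .inl rfl
            · exact .inr rfl
            · rw [Multiset.map_cons, Multiset.nodup_cons] at hnd
              exact absurd (Multiset.mem_map.2 ⟨g, hg, hge.trans hfe⟩) hnd.1
          · rintro (rfl | rfl)
            · exact ⟨.inl rfl, rfl⟩
            · exact ⟨.inr (.inl rfl), hfe.symm⟩
        obtain ⟨⟨vs, es, hp⟩, hodd⟩ := EndPair.exists_isShortestRootPath hm hforest
          (mem_vertexSet_reduced.1 hx).2 hab hroots
        exact ⟨vs, es, hp, (hodd vs es hp).2 fun h => hb (h.1 ha)⟩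

/-- A sub-multiset has a smaller support and, since truncated k - 1 is monotone in k, a smaller
multiset of roots; `IsRooting.mono` applies. -/
theorem isMulticomplex_twoEdgeRootedForests :
    IsMulticomplex E(reduced G A B hAB) (twoEdgeRootedForests G A B hAB) := by
  classical
  refine ⟨fun m hm => hm.edges_mem, fun m hm τ hτ => ?_⟩
  obtain ⟨h1, h2, h3⟩ := isTwoEdgeRootedForest_iff.1 hm
  have hsub : coneSupport τ ⊆ coneSupport m :=
    Set.insert_subset_insert fun e he => Multiset.mem_of_le hτ he
  refine isTwoEdgeRootedForest_iff.2 ⟨fun e he => h1 e (Multiset.mem_of_le hτ he),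
    h2.restrict_mono hsub, h3.mono hsub (coneSupport_subset h1) ?_ fun _ => mem_of_mem_coneRoots⟩
  refine Multiset.cons_le_cons _ (Multiset.le_iff_count.2 fun e => ?_)
  rw [Multiset.count_sub, Multiset.count_sub, Multiset.count_dedup, Multiset.count_dedup]
  have h := Multiset.le_iff_count.1 hτ e
  split_ifs with he he'
  · omega
  · exact absurd (Multiset.mem_of_le hτ he) he'
  · rw [Multiset.count_eq_zero.2 he]; omega
  · rw [Multiset.count_eq_zero.2 he]; omega

end Bicone

/-! ### Counting components and enlarging a rooting -/

namespace Graph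

variable {α : Type u} {β : Type v} {G : Graph α β}

open Classical in
/-- A forest has as many components as it has more vertices than edges. -/
theorem IsAcyclic.card_vertices {K : Finset β} (hK : (G.restrict (K : Set β)).IsAcyclic)
    (hKE : (K : Set β) ⊆ E(G)) {V : Finset α} (hV : ∀ v, v ∈ V ↔ v ∈ V(G)) :
    V.card = K.card + (V.image (G.comp K)).card := by
  have hmaps : ∀ e ∈ K, G.edgeComp K e ∈ V.image (G.comp K) := by
    intro e he
    obtain ⟨x, y, hl⟩ := G.exists_isLink_of_mem_edgeSet (hKE he)
    exact Finset.mem_image.2 ⟨x, (hV x).2 hl.left_mem, (edgeComp_eq he hl.inc_left).symm⟩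
  rw [Finset.card_eq_sum_card_image (G.comp K) V, Finset.card_eq_sum_card_fiberwise hmaps,
    Finset.card_eq_sum_ones, ← Finset.sum_add_distrib]
  refine Finset.sum_congr rfl fun c hc => ?_
  obtain ⟨x, hx, rfl⟩ := Finset.mem_image.1 hc
  exact hK.card_comp hKE hV hx

theorem IsRooting.cons {K : Set β} {p : α → Prop} {R : Multiset β} (h : G.IsRooting K p R) {g : β}
    (hg : G.edgeComp K g ∉ R.map (G.edgeComp K)) : G.IsRooting K p (g ::ₘ R) := by
  rcases h with h | ⟨e, f, S, rfl, hS, hab⟩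
  · left
    rw [Multiset.map_cons, Multiset.nodup_cons]
    exact ⟨hg, h⟩
  · refine .inr ⟨e, f, g ::ₘ S, ?_, ?_, hab⟩
    · rw [Multiset.cons_swap, Multiset.cons_swap g f]
    · rw [Multiset.cons_swap, Multiset.map_cons, Multiset.nodup_cons]
      refine ⟨fun h => hg ?_, hS⟩
      rw [Multiset.map_cons]
      exact Multiset.mem_cons_of_mem h

/-- Joining the component of `v` to another one does not merge other components. -/
theorem edgeComp_of_insert {K : Set β} (hK : K ⊆ E(G)) {g : β} {v w : α} (hl : G.IsLink g v w)
    {e f : β} (he : e ∈ K) (hf : f ∈ K) (hev : G.edgeComp K e ≠ G.comp K v)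
    (hfv : G.edgeComp K f ≠ G.comp K v)
    (h : G.edgeComp (insert g K) e = G.edgeComp (insert g K) f) :
    G.edgeComp K e = G.edgeComp K f := by
  obtain ⟨x, _, hx⟩ := G.exists_isLink_of_mem_edgeSet (hK he)
  obtain ⟨y, _, hy⟩ := G.exists_isLink_of_mem_edgeSet (hK hf)
  rw [edgeComp_eq (.inr he) hx.inc_left, edgeComp_eq (.inr hf) hy.inc_left, comp_eq_iff] at h
  rw [edgeComp_eq he hx.inc_left] at hev ⊢
  rw [edgeComp_eq hf hy.inc_left] at hfv ⊢
  rcases h.insert_cases hl with h | ⟨h, -⟩ | ⟨-, h⟩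
  · exact comp_eq_iff.2 h
  · exact absurd (comp_eq_iff.2 h) hev
  · exact absurd (comp_eq_iff.2 h).symm hfv

theorem nodup_map_edgeComp_insert {K : Set β} (hK : K ⊆ E(G)) {g : β} {v w : α}
    (hl : G.IsLink g v w) {R : Multiset β} (hR : ∀ e ∈ R, e ∈ K)
    (hv : G.comp K v ∉ R.map (G.edgeComp K)) (hnd : (R.map (G.edgeComp K)).Nodup) :
    (R.map (G.edgeComp (insert g K))).Nodup := by
  refine Multiset.Nodup.map_on ?_ (Multiset.Nodup.of_map _ hnd)
  intro e he f hf hef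
  refine Multiset.inj_on_of_nodup_map hnd e he f hf
    (edgeComp_of_insert hK hl (hR e he) (hR f hf) ?_ ?_ hef)
  · exact fun h => hv (h ▸ Multiset.mem_map_of_mem _ he)
  · exact fun h => hv (h ▸ Multiset.mem_map_of_mem _ hf)

/-- The component of `v` contains no root. Attaching it elsewhere therefore brings no two roots
together, and it opens no new route between the ends of the exceptional pair, since such a route
would have to start or end in that component. -/
theorem IsRooting.insert_edge {K : Set β} (hK : K ⊆ E(G)) {p : α → Prop} {R : Multiset β}
    (h : G.IsRooting K p R) {g : β} {v w : α} (hl : G.IsLink g v w) (hR : ∀ e ∈ R, e ∈ K)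
    (hv : G.comp K v ∉ R.map (G.edgeComp K)) : G.IsRooting (insert g K) p R := by
  rcases h with h | ⟨e, f, S, rfl, hS, a, b, ha, hb, hab⟩
  · exact .inl (nodup_map_edgeComp_insert hK hl hR hv h)
  have hva : ¬ (G.restrict K).Reach a v := fun k => hv (by
    rw [← comp_eq_iff.2 k, ← hab.edgeComp_left]
    exact Multiset.mem_map_of_mem _ (by simp))
  have hvb : ¬ (G.restrict K).Reach b v := fun k => hva (hab.reach.trans k)
  have key : ∀ k, ¬ (G.restrict (K \ {k})).Reach a b →
      ¬ (G.restrict (insert g K \ {k})).Reach a b := by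
    intro k hk hr
    have hsub : insert g K \ {k} ⊆ insert g (K \ {k}) := by
      rintro i ⟨rfl | hi, hik⟩
      · exact .inl rfl
      · exact .inr ⟨hi, hik⟩
    rcases (hr.mono hsub).insert_cases hl with h | ⟨h, -⟩ | ⟨-, h⟩
    · exact hk h
    · exact hva (h.mono Set.sdiff_subset)
    · exact hvb (h.mono Set.sdiff_subset).symm
  refine .inr ⟨e, f, S, rfl, nodup_map_edgeComp_insert hK hl
    (fun k hk => hR k (Multiset.mem_cons_of_mem hk)) (fun hk => hv ?_) hS, a, b, ha, hb,
    .inr hab.left_mem, .inr hab.right_mem, hab.inc_left, hab.inc_right,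
    hab.reach.mono (Set.subset_insert _ _), key e hab.cut_left, key f hab.cut_right⟩
  rw [Multiset.map_cons]
  exact Multiset.mem_cons_of_mem hk

/-- In a component with vertices of both colours, every edge is the first edge of a path with ends
of different colours. -/
theorem IsAcyclic.exists_bicoloured_endPair {K : Set β} (hK : (G.restrict K).IsAcyclic)
    (hKE : K ⊆ E(G)) {p : α → Prop} {e : β} (he : e ∈ K) {x y : α} (hx : x ∈ V(G)) (hy : y ∈ V(G))
    (hex : G.edgeComp K e = G.comp K x) (hey : G.edgeComp K e = G.comp K y) (hp : ¬ (p x ↔ p y)) :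
    ∃ a b f, G.EndPair K a b e f ∧ ¬ (p a ↔ p b) := by
  obtain ⟨r, s, hl⟩ := G.exists_isLink_of_mem_edgeSet (hKE he)
  by_cases hrs : p r ↔ p s
  -- If the ends of `e` agree in colour, choose a vertex `w` of the other colour and start from the
  -- end `u` of `e` away from `w`; then `e` is the first edge on the way.
  · obtain ⟨w, hw, hwe, hwr⟩ : ∃ w ∈ V(G), G.edgeComp K e = G.comp K w ∧ ¬ (p w ↔ p r) := by
      by_cases hxr : p x ↔ p r
      · exact ⟨y, hy, hey, by tauto⟩
      · exact ⟨x, hx, hex, hxr⟩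
    have hrw : (G.restrict K).Reach r w := by
      rw [← comp_eq_iff, ← edgeComp_eq he hl.inc_left, hwe]
    obtain ⟨u, hu, hun⟩ := hK.exists_far_end he hl.inc_left hrw
    have huw : (G.restrict K).Reach u w := (hu.reach_restrict hl.inc_left he).trans hrw
    have hur : p u ↔ p r := by
      rcases hu.eq_or_eq_of_isLink hl with rfl | rfl
      · rfl
      · exact hrs.symm
    have hne : w ≠ u := by rintro rfl; exact hwr hur
    obtain ⟨f, hf, hfw, hfn⟩ := hK.exists_inc_not_reach hu.vertex_mem huw.symm hne
    exact ⟨u, w, f, ⟨he, hf, hu, hfw, huw, hun, fun h => hfn h.symm⟩, by tauto⟩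
  · have := isAcyclic_restrict_iff.1 hK e r s he hl
    exact ⟨r, s, e, ⟨he, he, hl.inc_left, hl.inc_right, hl.reach_restrict he, this, this⟩, hrs⟩

end Graph

/-! ### Maximal 2-edge-rooted forests and purity -/

namespace Bicone

variable {α : Type u} {β : Type v} {G : Graph α β} {A B : Set α} {hAB : V(G) = A ∪ B}

theorem coneRoots_cons_of_mem {m : Multiset (BiconeEdge α β)} {e : BiconeEdge α β} (he : e ∈ m) :
    coneRoots (e ::ₘ m) = e ::ₘ coneRoots m := by
  classical
  rw [coneRoots, Multiset.dedup_cons_of_mem he, coneRoots, Multiset.cons_swap e]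
  congr 1
  ext f
  have : m.count e ≥ 1 := Multiset.one_le_count_iff_mem.2 he
  simp only [Multiset.count_sub, Multiset.count_cons, Multiset.count_dedup]
  split_ifs <;> grind

theorem coneSupport_cons {m : Multiset (BiconeEdge α β)} {e : BiconeEdge α β} :
    coneSupport (e ::ₘ m) = insert e (coneSupport m) := by
  ext f
  simp only [coneSupport, Multiset.mem_cons, Set.mem_insert_iff, Set.mem_ofPred_eq]
  tauto

theorem coneRoots_cons_of_notMem {m : Multiset (BiconeEdge α β)} {e : BiconeEdge α β}
    (he : e ∉ m) : coneRoots (e ::ₘ m) = coneRoots m := by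
  classical
  rw [coneRoots, Multiset.dedup_cons_of_notMem he, coneRoots]
  congr 1
  ext f
  simp only [Multiset.count_sub, Multiset.count_cons, Multiset.count_dedup]
  grind

theorem not_mem_cons_of_maximal {ι : Type*} {M : Set (Multiset ι)} {m : Multiset ι}
    (hm : Maximal (· ∈ M) m) (e : ι) : e ::ₘ m ∉ M := fun h => by
  have := Multiset.card_le_card (hm.2 h (Multiset.le_cons_self m e))
  simp at this

section Maximal

variable {m : Multiset (BiconeEdge α β)} (hmax : Maximal (· ∈ twoEdgeRootedForests G A B hAB) m)

include hmax

/-- Repeating an edge of `m` keeps the support and adds exactly one root. -/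
theorem not_isRooting_cons_root {e : BiconeEdge α β} (he : e ∈ m) :
    ¬ (graph G A B hAB).IsRooting (coneSupport m) (IsLeft A) (e ::ₘ coneRoots m) := by
  intro h
  obtain ⟨h1, h2, -⟩ := isTwoEdgeRootedForest_iff.1 hmax.1
  refine not_mem_cons_of_maximal hmax e (isTwoEdgeRootedForest_iff.2 ⟨?_, ?_, ?_⟩)
  · intro f hf
    rcases Multiset.mem_cons.1 hf with rfl | hf
    · exact h1 _ he
    · exact h1 _ hf
  all_goals rw [coneSupport_cons, Set.insert_eq_of_mem (.inr he)]
  · exact h2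
  · rwa [coneRoots_cons_of_mem he]

/-- A new edge between two components has multiplicity one, so it changes the support but adds no
root. -/
theorem not_isRooting_insert {g : BiconeEdge α β} {x y : BiconeVertex α}
    (hl : (reduced G A B hAB).IsLink g x y)
    (hxy : ¬ ((graph G A B hAB).restrict (coneSupport m)).Reach x y) :
    ¬ (graph G A B hAB).IsRooting (insert g (coneSupport m)) (IsLeft A) (coneRoots m) := by
  intro h
  obtain ⟨h1, h2, -⟩ := isTwoEdgeRootedForest_iff.1 hmax.1
  have hlg := (reduced_isLink.1 hl).1
  have hg : g ∉ coneSupport m := fun h => hxy (hlg.reach_restrict h)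
  refine not_mem_cons_of_maximal hmax g (isTwoEdgeRootedForest_iff.2 ⟨?_, ?_, ?_⟩)
  · intro f hf
    rcases Multiset.mem_cons.1 hf with rfl | hf
    · exact hl.edge_mem
    · exact h1 _ hf
  all_goals rw [coneSupport_cons]
  · exact (Graph.isAcyclic_insert_iff hg hlg).2 ⟨h2, hxy⟩
  · rwa [coneRoots_cons_of_notMem fun h => hg (.inr h)]

/-- In a maximal `2`-edge-rooted forest, only isolated vertices of the reduced graph lie in
components without roots. -/
theorem eq_of_isLink_of_not_mem_roots {v : BiconeVertex α}
    (hv : (graph G A B hAB).comp (coneSupport m) v ∉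
      (coneRoots m).map ((graph G A B hAB).edgeComp (coneSupport m)))
    {g : BiconeEdge α β} {w : BiconeVertex α} (hl : (reduced G A B hAB).IsLink g v w) : v = w := by
  obtain ⟨h1, h2, h3⟩ := isTwoEdgeRootedForest_iff.1 hmax.1
  have hlg := (reduced_isLink.1 hl).1
  by_contra hne
  -- If the rootless component has an edge at `v`, that edge can be made a root; if not, `g` can be
  -- added to the forest.
  by_cases hr : ((graph G A B hAB).restrict (coneSupport m)).Reach v w
  · obtain ⟨e, he, hev, -⟩ := h2.exists_inc_not_reach hlg.right_mem hr hne
    have hec := Graph.edgeComp_eq he hev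
    rcases he with rfl | he
    · exact hv (hec ▸ Multiset.mem_map_of_mem _ (Multiset.mem_cons_self _ _))
    · exact not_isRooting_cons_root hmax he (h3.cons (by rwa [hec]))
  · exact not_isRooting_insert hmax hl hr
      (h3.insert_edge (coneSupport_subset h1) hlg (fun _ => mem_of_mem_coneRoots) hv)

/-- In a maximal `2`-edge-rooted forest without `2`-edge-rooted component, components with roots
are monochromatic. -/
theorem isLeft_iff_of_edgeComp_eq
    (hnd : ((coneRoots m).map ((graph G A B hAB).edgeComp (coneSupport m))).Nodup)
    {e : BiconeEdge α β} (he : e ∈ coneRoots m) {x y : BiconeVertex α}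
    (hx : x ∈ V(graph G A B hAB)) (hy : y ∈ V(graph G A B hAB))
    (hex : (graph G A B hAB).edgeComp (coneSupport m) e = (graph G A B hAB).comp (coneSupport m) x)
    (hey : (graph G A B hAB).edgeComp (coneSupport m) e =
      (graph G A B hAB).comp (coneSupport m) y) : IsLeft A x ↔ IsLeft A y := by
  by_contra hp
  obtain ⟨h1, h2, h3⟩ := isTwoEdgeRootedForest_iff.1 hmax.1
  obtain ⟨a, b, f, hab, hpab⟩ := h2.exists_bicoloured_endPair (coneSupport_subset h1)
    (mem_of_mem_coneRoots he) hx hy hex hey hp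
  obtain ⟨S, hS⟩ := Multiset.exists_cons_of_mem he
  -- The last edge `f` of the bicoloured path would be admissible as a second root. It is not 00̄:
  -- otherwise the only root `e` of the component would also be 00̄, whose ends both lie outside
  -- `A`.
  have hf : f ∈ m := by
    refine hab.right_mem.resolve_left ?_
    rintro rfl
    have hce := Multiset.inj_on_of_nodup_map hnd _ (Multiset.mem_cons_self _ _) _ he
      (hab.edgeComp_right.trans hab.edgeComp_left.symm)
    subst hce
    have h0 : ∀ z, (graph G A B hAB).Inc .cone z → ¬ IsLeft A z := by
      intro z hz
      rcases inc_cone.1 hz with rfl | rfl <;> simp [IsLeft]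
    exact hpab (iff_of_false (h0 _ hab.inc_left) (h0 _ hab.inc_right))
  refine not_isRooting_cons_root hmax hf ?_
  rw [hS] at hnd ⊢
  exact hab.symm.isRooting hnd fun h => hpab h.symm

/-- The presence of a doubly rooted component in a maximal member depends on the graph alone.
Suppose there is none but some edge `g` is bicoloured. Its ends lie in components with a root, which
are monochromatic and hence distinct; adding `g` merges them into a component with two roots and
extreme ends of different colours, against maximality. Conversely, without bicoloured edges no
component contains both colours. -/
theorem isRooting_nodup_iff :
    ((coneRoots m).map ((graph G A B hAB).edgeComp (coneSupport m))).Nodup ↔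
      ∀ g x y, (reduced G A B hAB).IsLink g x y → (IsLeft A x ↔ IsLeft A y) := by
  obtain ⟨h1, h2, h3⟩ := isTwoEdgeRootedForest_iff.1 hmax.1
  constructor
  · intro hnd g x y hl
    by_contra hp
    have hlg := (reduced_isLink.1 hl).1
    have hne : x ≠ y := by rintro rfl; exact hp Iff.rfl
    have hex := not_imp_comm.1 (fun h => eq_of_isLink_of_not_mem_roots hmax h hl) hne
    have hey := not_imp_comm.1 (fun h => eq_of_isLink_of_not_mem_roots hmax h hl.symm) hne.symm
    obtain ⟨e, he, hex⟩ := Multiset.mem_map.1 hex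
    obtain ⟨f, hf, hfy⟩ := Multiset.mem_map.1 hey
    have hmono := fun {e} he {x y} => isLeft_iff_of_edgeComp_eq hmax hnd (e := e) he (x := x) (y := y)
    by_cases hr : ((graph G A B hAB).restrict (coneSupport m)).Reach x y
    · exact hp (hmono he hlg.left_mem hlg.right_mem hex (hex.trans (Graph.comp_eq_iff.2 hr)))
    have heK := mem_of_mem_coneRoots he
    have hfK := mem_of_mem_coneRoots hf
    have hg : g ∉ coneSupport m := fun h => hr (hlg.reach_restrict h)
    have hac' := (Graph.isAcyclic_insert_iff hg hlg).2 ⟨h2, hr⟩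
    obtain ⟨p, _, hpe⟩ := (graph G A B hAB).exists_isLink_of_mem_edgeSet (coneSupport_subset h1 heK)
    obtain ⟨q, _, hqf⟩ := (graph G A B hAB).exists_isLink_of_mem_edgeSet (coneSupport_subset h1 hfK)
    have hpx : ((graph G A B hAB).restrict (coneSupport m)).Reach p x := by
      rw [← Graph.comp_eq_iff, ← hex, Graph.edgeComp_eq heK hpe.inc_left]
    have hqy : ((graph G A B hAB).restrict (coneSupport m)).Reach q y := by
      rw [← Graph.comp_eq_iff, ← hfy, Graph.edgeComp_eq hfK hqf.inc_left]
    have hpq : ((graph G A B hAB).restrict (insert g (coneSupport m))).Reach p q :=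
      ((hpx.mono (Set.subset_insert _ _)).trans (hlg.reach_restrict (.inl rfl))).trans
        (hqy.mono (Set.subset_insert _ _)).symm
    obtain ⟨u, w, huw⟩ := hac'.exists_extreme_ends (.inr heK) (.inr hfK) hpe.inc_left
      hqf.inc_left hpq
    have hpu := hmono he hlg.left_mem huw.inc_left.vertex_mem hex
      (Graph.edgeComp_eq heK huw.inc_left)
    have hpw := hmono hf hlg.right_mem huw.inc_right.vertex_mem hfy
      (Graph.edgeComp_eq hfK huw.inc_right)
    obtain ⟨T, hT⟩ := Multiset.exists_cons_of_mem he
    have hfT : f ∈ T := by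
      rw [hT, Multiset.mem_cons] at hf
      refine hf.resolve_left ?_
      rintro rfl
      exact hr (Graph.comp_eq_iff.1 (hex.symm.trans hfy))
    obtain ⟨S, rfl⟩ := Multiset.exists_cons_of_mem hfT
    refine not_isRooting_insert hmax hl hr ?_
    have hR : ∀ k ∈ f ::ₘ S, k ∈ coneSupport m := fun k hk =>
      mem_of_mem_coneRoots (hT ▸ Multiset.mem_cons_of_mem hk)
    rw [hT] at hnd ⊢
    rw [Multiset.map_cons, Multiset.nodup_cons, hex] at hnd
    exact huw.isRooting (Graph.nodup_map_edgeComp_insert (coneSupport_subset h1) hlg hR hnd.1 hnd.2)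
      (by tauto)
  · intro h
    rcases h3 with h3 | ⟨e, f, S, -, -, a, b, ha, hb, hab⟩
    · exact h3
    refine absurd (hab.reach.mem_of_closed (U := {x | IsLeft A x}) ?_ ha) hb
    rintro k (rfl | hk) x y hl hx
    · have hx : IsLeft A x := hx
      rcases inc_cone.1 hl.inc_left with rfl | rfl <;> simp [IsLeft] at hx
    · exact (h k x y (reduced_isLink.2 ⟨hl, (mem_edgeSet_reduced.1 (h1 k hk)).2⟩)).1 hx

omit hmax in
-- An edge of multiplicity k counts once in `K` and k - 1 times as a root; 00̄ is counted both as an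
-- edge and as a root, whence the 2.
theorem card_coneRoots (m : Multiset (BiconeEdge α β)) {K : Finset (BiconeEdge α β)}
    (hK : (K : Set (BiconeEdge α β)) = coneSupport m) (hc : .cone ∉ m) :
    K.card + (coneRoots m).card = m.card + 2 := by
  classical
  have hK' : K = insert .cone m.toFinset := by
    ext e
    rw [← Finset.mem_coe, hK]
    simp [coneSupport]
  rw [hK', Finset.card_insert_of_notMem (by simpa using hc), coneRoots, Multiset.card_cons,
    Multiset.card_sub (Multiset.dedup_le m), Multiset.toFinset, Finset.card_mk]
  have := Multiset.card_le_card (Multiset.dedup_le m)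
  omega

open Classical in
/-- The cardinality of a maximal `2`-edge-rooted forest. -/
theorem card_of_maximal {V : Finset (BiconeVertex α)}
    (hV : ∀ v, v ∈ V ↔ v ∈ V(graph G A B hAB)) :
    m.card + 2 + (V.filter fun v => v ≠ .zero ∧ v ≠ .zeroBar ∧
        ∀ g w, (reduced G A B hAB).IsLink g v w → v = w).card =
      V.card + if ∀ g x y, (reduced G A B hAB).IsLink g x y → (IsLeft A x ↔ IsLeft A y)
        then 0 else 1 := by
  obtain ⟨h1, h2, h3⟩ := isTwoEdgeRootedForest_iff.1 hmax.1
  set I := V.filter fun v => v ≠ .zero ∧ v ≠ .zeroBar ∧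
        ∀ g w, (reduced G A B hAB).IsLink g v w → v = w with hI
  set κ := (graph G A B hAB).edgeComp (coneSupport m) with hκ
  set σ := (graph G A B hAB).comp (coneSupport m) with hσ
  set K : Finset (BiconeEdge α β) := insert .cone m.toFinset with hKdef
  have hK : (K : Set (BiconeEdge α β)) = coneSupport m := by
    ext e
    simp [hKdef, coneSupport]
  have hcard := Graph.IsAcyclic.card_vertices (K := K) (by rwa [hK])
    (by rw [hK]; exact coneSupport_subset h1) hV
  rw [hK, ← hσ] at hcard
  have hsum := card_coneRoots m hK fun h => cone_notMem (h1 _ h)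
  have hIinc : ∀ v ∈ I, ∀ e ∈ coneSupport m, ¬ (graph G A B hAB).Inc e v := by
    rintro v hv e he hev
    obtain ⟨-, hv0, hv0', hv⟩ := Finset.mem_filter.1 hv
    rcases he with rfl | he
    · rcases inc_cone.1 hev with rfl | rfl
      · exact hv0 rfl
      · exact hv0' rfl
    · obtain ⟨w, hw⟩ := hev
      obtain rfl := hv e w (reduced_isLink.2 ⟨hw, (mem_edgeSet_reduced.1 (h1 e he)).2⟩)
      exact Graph.isAcyclic_restrict_iff.1 h2 e v v (.inr he) hw (.refl _ _)
  -- Every component either contains a root or is one of the isolated vertices in `I`.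
  have hhit : (V.image σ).card = ((coneRoots m).map κ).toFinset.card + I.card := by
    have hI' : (I.image σ).card = I.card := by
      refine Finset.card_image_of_injOn fun v hv w _ hvw => ?_
      exact (Graph.comp_eq_iff.1 hvw).eq_of_forall_not_inc (hIinc v hv)
    rw [← hI', ← Finset.card_union_of_disjoint]
    · congr 1
      ext c
      rw [Finset.mem_union, Multiset.mem_toFinset, Finset.mem_image, Finset.mem_image]
      constructor
      · rintro ⟨v, hv, rfl⟩
        by_cases hc : σ v ∈ (coneRoots m).map κ
        · exact .inl hc
        · refine .inr ⟨v, Finset.mem_filter.2 ⟨hv, ?_, ?_, fun g w hl =>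
            eq_of_isLink_of_not_mem_roots hmax hc hl⟩, rfl⟩
          · rintro rfl
            refine hc (Multiset.mem_map.2 ⟨.cone, Multiset.mem_cons_self _ _, ?_⟩)
            exact Graph.edgeComp_eq (.inl rfl) (inc_cone.2 (.inl rfl))
          · rintro rfl
            refine hc (Multiset.mem_map.2 ⟨.cone, Multiset.mem_cons_self _ _, ?_⟩)
            exact Graph.edgeComp_eq (.inl rfl) (inc_cone.2 (.inr rfl))
      · rintro (hc | ⟨v, hv, rfl⟩)
        · obtain ⟨e, he, rfl⟩ := Multiset.mem_map.1 hc
          have heK := mem_of_mem_coneRoots he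
          obtain ⟨x, _, hx⟩ := (graph G A B hAB).exists_isLink_of_mem_edgeSet
            (coneSupport_subset h1 heK)
          exact ⟨x, (hV x).2 hx.left_mem, (Graph.edgeComp_eq heK hx.inc_left).symm⟩
        · exact ⟨v, (Finset.mem_filter.1 hv).1, rfl⟩
    · rw [Finset.disjoint_left]
      intro c hc hc'
      obtain ⟨e, he, rfl⟩ := Multiset.mem_map.1 (Multiset.mem_toFinset.1 hc)
      obtain ⟨v, hv, hve⟩ := Finset.mem_image.1 hc'
      have heK := mem_of_mem_coneRoots he
      obtain ⟨x, _, hx⟩ := (graph G A B hAB).exists_isLink_of_mem_edgeSet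
        (coneSupport_subset h1 heK)
      rw [hκ, Graph.edgeComp_eq heK hx.inc_left] at hve
      obtain rfl := (Graph.comp_eq_iff.1 hve).eq_of_forall_not_inc (hIinc v hv)
      exact hIinc v hv e heK hx.inc_left
  have hR : (coneRoots m).card = ((coneRoots m).map κ).toFinset.card +
      if ∀ g x y, (reduced G A B hAB).IsLink g x y → (IsLeft A x ↔ IsLeft A y)
        then 0 else 1 := by
    rw [← isRooting_nodup_iff hmax]
    split_ifs with hnd
    · rw [Multiset.toFinset_card_of_nodup hnd, Multiset.card_map, add_zero]
    · obtain ⟨e, f, S, hS, hfS, a, b, -, -, hab⟩ := h3.resolve_left hnd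
      rw [hS, Multiset.map_cons, Multiset.toFinset_cons, Finset.insert_eq_of_mem,
        Multiset.toFinset_card_of_nodup hfS, Multiset.card_map, Multiset.card_cons]
      rw [Multiset.mem_toFinset, hκ, hab.edgeComp_left, ← hab.edgeComp_right]
      exact Multiset.mem_map_of_mem _ (by simp)
  -- Combines: vertices = edges + components, components = rooted components + isolated vertices,
  -- roots = rooted components + (0 or 1), and edges + roots = `m.card + 2`.
  omega

end Maximal

theorem isPureMulticomplex_twoEdgeRootedForests (hV : V(G).Finite) :
    IsPureMulticomplex (twoEdgeRootedForests G A B hAB) := by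
  intro σ τ hσ hτ
  have hfin : V(graph G A B hAB).Finite := ((Set.finite_singleton _).insert _).union (hV.image _)
  have h1 := card_of_maximal hσ (V := hfin.toFinset) (by simp)
  have h2 := card_of_maximal hτ (V := hfin.toFinset) (by simp)
  omega

end Bicone

/-! ### Tree edges that extend a forest of the reduced graph -/

namespace Bicone

variable {α : Type u} {β : Type v} {G : Graph α β} {A B : Set α} {hAB : V(G) = A ∪ B}

open Classical in
/-- The edge of the spanning tree `T₀` that belongs to a vertex other than `0`. -/
noncomputable def treeEdge (A : Set α) : BiconeVertex α → BiconeEdge α β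
  -- A junk value: 0 is the root of T₀ and owns no tree edge, so `treeEdge` is injective only away
  -- from it.
  | .zero => .cone
  | .zeroBar => .cone
  | .old x => if x ∈ A then .toZero x else .toZeroBar x

open Classical in
/-- The end of `treeEdge A x` other than `x`. -/
noncomputable def treeRoot (A : Set α) (x : BiconeVertex α) : BiconeVertex α :=
  if x = .zeroBar ∨ IsLeft A x then .zero else .zeroBar

theorem treeRoot_zeroBar : treeRoot A .zeroBar = .zero := by simp [treeRoot]

theorem treeRoot_of_isLeft {x : BiconeVertex α} (hx : IsLeft A x) : treeRoot A x = .zero := by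
  simp [treeRoot, hx]

theorem treeRoot_of_not {x : BiconeVertex α} (hx : ¬ IsLeft A x) (h0 : x ≠ .zeroBar) :
    treeRoot A x = .zeroBar := by
  simp [treeRoot, hx, h0]

theorem isLink_treeEdge {x : BiconeVertex α} (hx : x ∈ V(reduced G A B hAB)) :
    (graph G A B hAB).IsLink (treeEdge A x) x (treeRoot A x) := by
  obtain ⟨hx, hx0⟩ := mem_vertexSet_reduced.1 hx
  cases x with
  | zero => exact absurd rfl hx0
  | zeroBar => rw [treeRoot_zeroBar]; exact IsLink.cone'
  | old x =>
    have hx : x ∈ A ∪ B := by rw [← hAB]; simpa [graph] using hx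
    by_cases hxA : x ∈ A
    · rw [treeRoot_of_isLeft ⟨x, hxA, rfl⟩, treeEdge, if_pos hxA]
      exact IsLink.toZero' hxA
    · rw [treeRoot_of_not (by simpa [IsLeft] using hxA) (by simp), treeEdge, if_neg hxA]
      exact IsLink.toZeroBar' (hx.resolve_left hxA)

theorem treeEdge_injOn : Set.InjOn (treeEdge A : _ → BiconeEdge α β) {x | x ≠ .zero} := by
  intro x hx y hy hxy
  cases x <;> cases y <;> simp_all [treeEdge] <;> grind

/-- Each vertex other than 0 stands for its tree edge towards 0, so subsets of T₀ can be handled as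
sets of vertices. -/
theorem image_treeEdge : (treeEdge A : _ → BiconeEdge α β) '' V(reduced G A B hAB) =
    baseTree A B := by
  ext e
  simp only [Set.mem_image, mem_vertexSet_reduced, baseTree, Set.mem_union, Set.mem_singleton_iff]
  constructor
  · rintro ⟨x, ⟨hx, hx0⟩, rfl⟩
    cases x with
    | zero => exact absurd rfl hx0
    | zeroBar => simp [treeEdge]
    | old x =>
      have hx : x ∈ A ∪ B := by rw [← hAB]; simpa [graph] using hx
      by_cases hxA : x ∈ A
      · simp [treeEdge, hxA]
      · simp [treeEdge, hxA, hx.resolve_left hxA]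
  · rintro ((rfl | ⟨x, hx, rfl⟩) | ⟨x, hx, rfl⟩)
    · exact ⟨.zeroBar, by simp [graph], rfl⟩
    · exact ⟨.old x, by simp [graph, hAB, hx], by simp [treeEdge, hx]⟩
    · exact ⟨.old x, by simp [graph, hAB, hx.1], by simp [treeEdge, hx.2]⟩

theorem treeEdge_notMem {F : Set (BiconeEdge α β)} (hF : F ⊆ E(reduced G A B hAB))
    {x : BiconeVertex α} (hx : x ∈ V(reduced G A B hAB)) : treeEdge A x ∉ F := fun h =>
  (mem_edgeSet_reduced.1 (hF h)).2 (by rw [← image_treeEdge (hAB := hAB)]; exact ⟨x, hx, rfl⟩)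

section TreeSets

variable {F : Set (BiconeEdge α β)} {T : Set (BiconeVertex α)}

theorem treeEdge_notMem_union (hF : F ⊆ E(reduced G A B hAB)) (hT : T ⊆ V(reduced G A B hAB))
    {x : BiconeVertex α} (hx : x ∈ V(reduced G A B hAB)) (hxT : x ∉ T) :
    treeEdge A x ∉ F ∪ treeEdge A '' T := by
  rintro (h | ⟨y, hy, hyx⟩)
  · exact treeEdge_notMem hF hx h
  · rw [treeEdge_injOn (mem_vertexSet_reduced.1 (hT hy)).2 (mem_vertexSet_reduced.1 hx).2 hyx] at hy
    exact hxT hy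

theorem comp_zero : (graph G A B hAB).comp (insert .cone F) .zero =
    (graph G A B hAB).comp (insert .cone F) .zeroBar :=
  Graph.comp_eq_iff.2 (isLink_cone.reach_restrict (.inl rfl))

theorem comp_insert_cone_eq (hF : F ⊆ E(reduced G A B hAB)) {x y : BiconeVertex α}
    (hx : x ∈ V(reduced G A B hAB)) (hy : y ∈ V(reduced G A B hAB)) :
    (graph G A B hAB).comp (insert .cone F) x = (graph G A B hAB).comp (insert .cone F) y ↔
      ((graph G A B hAB).restrict F).Reach x y := by
  rw [Graph.comp_eq_iff, reach_insert_cone hF (mem_vertexSet_reduced.1 hx).2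
    (mem_vertexSet_reduced.1 hy).2]

/-- At most one tree edge at each component other than that of `0̄`, and none there. -/
structure IsTransversal (G : Graph α β) (A B : Set α) (hAB : V(G) = A ∪ B)
    (F : Set (BiconeEdge α β)) (T : Set (BiconeVertex α)) : Prop where
  subset : T ⊆ V(reduced G A B hAB)
  injOn : Set.InjOn ((graph G A B hAB).comp (insert .cone F)) T
  ne : ∀ x ∈ T, (graph G A B hAB).comp (insert .cone F) x ≠
    (graph G A B hAB).comp (insert .cone F) .zeroBar

theorem IsTransversal.mono {S : Set (BiconeVertex α)} (h : IsTransversal G A B hAB F T)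
    (hST : S ⊆ T) : IsTransversal G A B hAB F S :=
  ⟨hST.trans h.subset, h.injOn.mono hST, fun x hx => h.ne x (hST hx)⟩

theorem insert_union_image (x : BiconeVertex α) :
    F ∪ treeEdge A '' (insert x T) = insert (treeEdge A x) (F ∪ treeEdge A '' T) := by
  rw [Set.image_insert_eq, Set.union_insert]

/-- Add the tree edges one by one. When that of `x` is added, the component of `x` in `F` has no
tree edge yet and contains neither 0 nor 0̄, so no edge leaves it and the other end of the new edge
is out of reach. -/
theorem IsTransversal.isAcyclic (hF : F ⊆ E(reduced G A B hAB))
    (hac : ((graph G A B hAB).restrict F).IsAcyclic) (hfin : T.Finite)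
    (hT : IsTransversal G A B hAB F T) :
    ((graph G A B hAB).restrict (F ∪ treeEdge A '' T)).IsAcyclic := by
  induction T, hfin using Set.Finite.induction_on with
  | empty => simpa using hac
  | @insert x T hxT hfin ih =>
    have hT' := hT.mono (Set.subset_insert x T)
    have hx := hT.subset (Set.mem_insert x T)
    rw [insert_union_image, Graph.isAcyclic_insert_iff
      (treeEdge_notMem_union hF hT'.subset hx hxT) (isLink_treeEdge hx)]
    refine ⟨ih hT', fun hr => ?_⟩
    set σ := (graph G A B hAB).comp (insert .cone F) with hσ
    have hx0 := hT.ne x (Set.mem_insert x T)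
    have hroot : ∀ y, σ (treeRoot A y) = σ .zeroBar := by
      intro y
      unfold treeRoot
      split_ifs
      · exact comp_zero
      · rfl
    have := hr.mem_of_closed (U := {y | σ y = σ x}) ?_ rfl
    · exact hx0 (this.symm.trans (hroot x))
    rintro e (he | ⟨w, hw, rfl⟩) y z hl hy
    · exact (Graph.comp_eq_iff.2 (hl.reach_restrict (Set.mem_insert_of_mem _ he))).symm.trans hy
    · have hy : σ y = σ x := hy
      exfalso
      rcases hl.left_eq_or_eq (isLink_treeEdge (hT'.subset hw)) with rfl | rfl
      · obtain rfl := hT.injOn (Set.mem_insert_of_mem _ hw) (Set.mem_insert x T) hy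
        exact hxT hw
      · exact hx0 (hy.symm.trans (hroot w))

/-- The new edge ends at 0. Before it is added, 0 reaches only the components that are attached to
it by a tree edge at a vertex of `A`. The vertex `x` is in none of them: its component is that of
0̄, or its only tree edge leads from `b` to 0̄. -/
theorem IsTransversal.isAcyclic_insert (hF : F ⊆ E(reduced G A B hAB))
    (hac : ((graph G A B hAB).restrict F).IsAcyclic) (hfin : T.Finite)
    (hT : IsTransversal G A B hAB F T) {x : BiconeVertex α} (hx : x ∈ V(reduced G A B hAB))
    (hxl : x = .zeroBar ∨ IsLeft A x) (hxT : x ∉ T)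
    (h : (graph G A B hAB).comp (insert .cone F) x =
        (graph G A B hAB).comp (insert .cone F) .zeroBar ∨
      ∃ b ∈ T, ¬ IsLeft A b ∧ (graph G A B hAB).comp (insert .cone F) b =
        (graph G A B hAB).comp (insert .cone F) x) :
    ((graph G A B hAB).restrict (F ∪ treeEdge A '' (insert x T))).IsAcyclic := by
  have hl := isLink_treeEdge hx
  rw [treeRoot, if_pos hxl] at hl
  rw [insert_union_image, Graph.isAcyclic_insert_iff (treeEdge_notMem_union hF hT.subset hx hxT) hl]
  refine ⟨hT.isAcyclic hF hac hfin, fun hr => ?_⟩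
  set σ := (graph G A B hAB).comp (insert .cone F) with hσ
  have hU := hr.symm.mem_of_closed
    (U := {y | y = .zero ∨ σ y ≠ σ .zeroBar ∧ ∃ w ∈ T, IsLeft A w ∧ σ w = σ y}) ?_ (.inl rfl)
  · rcases hU with rfl | ⟨h0, w, hw, hwl, hwx⟩
    · exact (mem_vertexSet_reduced.1 hx).2 rfl
    rcases h with h | ⟨b, hb, hbl, hbx⟩
    · exact h0 h
    · obtain rfl := hT.injOn hw hb (hwx.trans hbx.symm)
      exact hbl hwl
  rintro e (he | ⟨w, hw, rfl⟩) y z hyz hy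
  · have hyz' := Graph.comp_eq_iff.2 (hyz.reach_restrict (Set.mem_insert_of_mem .cone he))
    rcases hy with rfl | hy
    · exact absurd hyz.inc_left (not_inc_zero (hF he))
    · right
      rw [← hσ] at hyz'
      rwa [← hyz']
  · have hlw := isLink_treeEdge (hT.subset hw)
    have hw0 : w ≠ .zeroBar := by rintro rfl; exact hT.ne _ hw rfl
    by_cases hwl : IsLeft A w
    · rw [treeRoot_of_isLeft hwl] at hlw
      rcases hyz.symm.left_eq_or_eq hlw with rfl | rfl
      · exact .inr ⟨hT.ne _ hw, _, hw, hwl, rfl⟩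
      · exact .inl rfl
    · rw [treeRoot_of_not hwl hw0] at hlw
      exfalso
      rcases hyz.left_eq_or_eq hlw with rfl | rfl
      · rcases hy with rfl | ⟨-, w', hw', hwl', hww⟩
        · exact (mem_vertexSet_reduced.1 (hT.subset hw)).2 rfl
        · rw [hT.injOn hw' hw hww] at hwl'
          exact hwl hwl'
      · rcases hy with hy | hy
        · cases hy
        · exact hy.1 rfl

/-- The tree edges in `T` that connect `0` and `0̄`, together with `F` and the tree edges of
vertices outside `A`. -/
def IsConnector (G : Graph α β) (A B : Set α) (hAB : V(G) = A ∪ B)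
    (F : Set (BiconeEdge α β)) (T : Set (BiconeVertex α)) (x : BiconeVertex α) : Prop :=
  x = .zeroBar ∨ IsLeft A x ∧ ((graph G A B hAB).comp (insert .cone F) x =
        (graph G A B hAB).comp (insert .cone F) .zeroBar ∨
      ∃ b ∈ T, ¬ IsLeft A b ∧ (graph G A B hAB).comp (insert .cone F) b =
        (graph G A B hAB).comp (insert .cone F) x)

theorem zeroBar_mem : .zeroBar ∈ V(reduced G A B hAB) :=
  mem_vertexSet_reduced.2 ⟨by simp [graph], by simp⟩

/-- The route to 0̄ uses only `F` and tree edges that end at 0̄. With its own tree edge, which ends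
at 0, the connector thus links 0 to 0̄. -/
theorem IsConnector.reach (hF : F ⊆ E(reduced G A B hAB)) (hT : T ⊆ V(reduced G A B hAB))
    {x : BiconeVertex α} (hx : IsConnector G A B hAB F T x) (hxT : x ∈ T)
    {X : Set (BiconeEdge α β)} (hFX : F ⊆ X)
    (hX : ∀ b ∈ T, ¬ IsLeft A b → b ≠ .zeroBar → treeEdge A b ∈ X) :
    ((graph G A B hAB).restrict X).Reach x .zeroBar := by
  rcases hx with rfl | ⟨hl, h | ⟨b, hb, hbl, hbx⟩⟩
  · exact .refl _ _
  · exact ((comp_insert_cone_eq hF (hT hxT) zeroBar_mem).1 h).mono hFX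
  · have h1 := ((comp_insert_cone_eq hF (hT hb) (hT hxT)).1 hbx).mono hFX
    by_cases hb0 : b = .zeroBar
    · subst hb0; exact h1.symm
    · have h2 := isLink_treeEdge (hT hb)
      rw [treeRoot_of_not hbl hb0] at h2
      exact h1.symm.trans (h2.reach_restrict (hX b hb hbl hb0))

section Acyclic

variable (hF : F ⊆ E(reduced G A B hAB)) (hT : T ⊆ V(reduced G A B hAB))
  (hac : ((graph G A B hAB).restrict (F ∪ treeEdge A '' T)).IsAcyclic)

include hF hT hac

/-- Two connectors would give two routes from 0 to 0̄, the second of which avoids the tree edge of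
the first. -/
theorem IsConnector.unique {x y : BiconeVertex α} (hx : IsConnector G A B hAB F T x) (hxT : x ∈ T)
    (hy : IsConnector G A B hAB F T y) (hyT : y ∈ T) : x = y := by
  by_contra hne
  have hroot {z} (hz : IsConnector G A B hAB F T z) : treeRoot A z = .zero := by
    rw [treeRoot, if_pos]
    exact hz.imp_right And.left
  have hmem : ∀ b ∈ T, b ≠ x → treeEdge A b ∈ (F ∪ treeEdge A '' T) \ {treeEdge A x} :=
    fun b hb hbx => ⟨.inr ⟨b, hb, rfl⟩, fun h => hbx (treeEdge_injOn
      (mem_vertexSet_reduced.1 (hT hb)).2 (mem_vertexSet_reduced.1 (hT hxT)).2 h)⟩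
  have hFX : F ⊆ (F ∪ treeEdge A '' T) \ {treeEdge A x} := fun e he =>
    ⟨.inl he, by rintro rfl; exact treeEdge_notMem hF (hT hxT) he⟩
  have hX : ∀ b ∈ T, ¬ IsLeft A b → b ≠ .zeroBar →
      treeEdge A b ∈ (F ∪ treeEdge A '' T) \ {treeEdge A x} := by
    intro b hb hbl hb0
    refine hmem b hb ?_
    rintro rfl
    exact hx.elim hb0 fun h => hbl h.1
  have h1 := hx.reach hF hT hxT hFX hX
  have h2 := hy.reach hF hT hyT hFX hX
  have h3 := isLink_treeEdge (hT hyT)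
  rw [hroot hy] at h3
  have h4 := isLink_treeEdge (hT hxT)
  rw [hroot hx] at h4
  exact Graph.isAcyclic_restrict_iff.1 hac _ _ _ (.inr ⟨x, hxT, rfl⟩) h4
    ((h1.trans h2.symm).trans (h3.reach_restrict (hmem y hyT fun h => hne h.symm)))

/-- Two tree edges at one component close a cycle if they end at the same vertex; if one ends at 0
and the other at 0̄, the former belongs to a connector. In the component of 0̄, a tree edge to 0̄
closes a cycle, and one to 0 belongs to a connector. -/
theorem isTransversal_of_forall_not_isConnector
    (h : ∀ x ∈ T, ¬ IsConnector G A B hAB F T x) : IsTransversal G A B hAB F T := by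
  have hacT := Graph.isAcyclic_restrict_iff.1 hac
  have hmem : ∀ b ∈ T, ∀ x ∈ T, b ≠ x → treeEdge A b ∈ (F ∪ treeEdge A '' T) \ {treeEdge A x} :=
    fun b hb x hxT hbx => ⟨.inr ⟨b, hb, rfl⟩, fun h => hbx (treeEdge_injOn
      (mem_vertexSet_reduced.1 (hT hb)).2 (mem_vertexSet_reduced.1 (hT hxT)).2 h)⟩
  have hFX : ∀ x ∈ T, F ⊆ (F ∪ treeEdge A '' T) \ {treeEdge A x} := fun x hxT e he =>
    ⟨.inl he, by rintro rfl; exact treeEdge_notMem hF (hT hxT) he⟩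
  have h0 : ∀ x ∈ T, x ≠ .zeroBar := fun x hx hx0 => h x hx (.inl hx0)
  have hsame : ∀ x ∈ T, ∀ y ∈ T, treeRoot A x = treeRoot A y →
      (graph G A B hAB).comp (insert .cone F) x = (graph G A B hAB).comp (insert .cone F) y →
      x = y := by
    intro x hx y hy hroot hxy
    by_contra hne
    have h1 := ((comp_insert_cone_eq hF (hT hx) (hT hy)).1 hxy).mono (hFX x hx)
    have h2 := (isLink_treeEdge (hT hy)).reach_restrict (hmem y hy x hx fun h => hne h.symm)
    rw [← hroot] at h2
    exact hacT _ _ _ (.inr ⟨x, hx, rfl⟩) (isLink_treeEdge (hT hx)) (h1.trans h2)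
  refine ⟨hT, fun x hx y hy hxy => ?_, fun x hx hx0 => ?_⟩
  · by_cases hxl : IsLeft A x <;> by_cases hyl : IsLeft A y
    · exact hsame x hx y hy (by rw [treeRoot_of_isLeft hxl, treeRoot_of_isLeft hyl]) hxy
    · exact absurd (.inr ⟨hxl, .inr ⟨y, hy, hyl, hxy.symm⟩⟩) (h x hx)
    · exact absurd (.inr ⟨hyl, .inr ⟨x, hx, hxl, hxy⟩⟩) (h y hy)
    · exact hsame x hx y hy
        (by rw [treeRoot_of_not hxl (h0 x hx), treeRoot_of_not hyl (h0 y hy)]) hxy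
  · by_cases hxl : IsLeft A x
    · exact h x hx (.inr ⟨hxl, .inl hx0⟩)
    · have hl := isLink_treeEdge (hT hx)
      rw [treeRoot_of_not hxl (h0 x hx)] at hl
      exact hacT _ _ _ (.inr ⟨x, hx, rfl⟩) hl
        (((comp_insert_cone_eq hF (hT hx) zeroBar_mem).1 hx0).mono (hFX x hx))

theorem isTransversal_or_exists_insert : IsTransversal G A B hAB F T ∨
    ∃ x S, x ∉ S ∧ T = insert x S ∧ IsTransversal G A B hAB F S ∧ IsConnector G A B hAB F S x := by
  by_cases h : ∃ x ∈ T, IsConnector G A B hAB F T x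
  · obtain ⟨x, hxT, hx⟩ := h
    have hins : T = insert x (T \ {x}) := by
      rw [Set.insert_sdiff_singleton, Set.insert_eq_of_mem hxT]
    refine .inr ⟨x, T \ {x}, by simp, hins, ?_, ?_⟩
    · refine isTransversal_of_forall_not_isConnector hF (Set.sdiff_subset.trans hT)
        (hac.restrict_mono (Set.union_subset_union_right _ (Set.image_mono Set.sdiff_subset))) ?_
      rintro y ⟨hyT, hyx⟩ hy
      refine hyx (IsConnector.unique hF hT hac ?_ hyT hx hxT)
      exact hy.imp_right fun ⟨hl, hy⟩ => ⟨hl, hy.imp_right fun ⟨b, hb, h⟩ => ⟨b, hb.1, h⟩⟩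
    · refine hx.imp_right fun ⟨hl, hy⟩ => ⟨hl, hy.imp_right fun ⟨b, hb, hbl, h⟩ =>
        ⟨b, ⟨hb, ?_⟩, hbl, h⟩⟩
      rintro rfl
      exact hbl hl
  · push Not at h
    exact .inl (isTransversal_of_forall_not_isConnector hF hT hac h)

end Acyclic

end TreeSets

end Bicone

/-! ## Partial transversals with one enlarged fibre -/

section CoreUnion

variable {ι γ δ : Type*} {κ : ι → γ} {s : Finset ι} {D : Finset γ} {T : Finset ι}

theorem nodup_map_of_mem_partialTransversals (hT : T ∈ partialTransversals κ s D) :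
    (T.val.map κ).Nodup :=
  Finset.nodup_map_iff_injOn.2 (mem_partialTransversals.1 hT).2.1

theorem not_mem_map_of_mem_partialTransversals (hT : T ∈ partialTransversals κ s D) {x : γ}
    (hx : x ∉ D) : x ∉ T.val.map κ := by
  rw [Multiset.mem_map]
  rintro ⟨y, hy, rfl⟩
  exact hx ((mem_partialTransversals.1 hT).2.2 y hy)

/-- `R` is a partial transversal, or it consists of a multiset `C p` in the fibre over `c p` and of
a partial transversal of the other fibres. -/
def IsCoreUnion [DecidableEq γ] (κ : ι → γ) (s : Finset ι) (D : Finset γ) (P : Finset δ) (C : δ → Multiset ι)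
    (c : δ → γ) (R : Multiset ι) : Prop :=
  (∃ T ∈ partialTransversals κ s D, R = T.val) ∨
    ∃ p ∈ P, ∃ T ∈ partialTransversals κ s (D.erase (c p)), R = C p + T.val

/-- The common shape of the counts of tree edges and of edge roots. A core is either one element in
the extra fibre over `c₀` or two elements in a fibre over `D`, which is then closed to the
transversal; both types lower the exponent `D.card + 1` to that of the remaining fibres. The fibre
multiplicities reveal the core, so no `R` is counted twice. -/
theorem sum_isCoreUnion [DecidableEq γ] {S : Type*} [CommRing S] (t : S) {P : Finset δ} {C : δ → Multiset ι}
    {c : δ → γ} {c₀ : γ} (h₀ : c₀ ∉ D) (hC : ∀ p ∈ P, ∀ x ∈ C p, κ x = c p)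
    (hcard : ∀ p ∈ P, (c p = c₀ ∧ (C p).card = 1) ∨ (c p ∈ D ∧ (C p).card = 2))
    (hinj : Set.InjOn C P) {Ω : Finset (Multiset ι)}
    (hΩ : ∀ R, R ∈ Ω ↔ IsCoreUnion κ s D P C c R) :
    ∑ R ∈ Ω, t ^ (D.card + 1 - R.card) =
      t * ∑ T ∈ partialTransversals κ s D, t ^ (D.card - T.card) +
        ∑ p ∈ P, ∑ T ∈ partialTransversals κ s (D.erase (c p)),
          t ^ ((D.erase (c p)).card - T.card) := by
  classical
  have hnone : ∀ T ∈ partialTransversals κ s D,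
      t ^ (D.card + 1 - T.card) = t * t ^ (D.card - T.card) := by
    intro T hT
    rw [← pow_succ', Nat.succ_sub (card_le_of_mem_partialTransversals hT)]
  have hsome : ∀ p ∈ P, ∀ T ∈ partialTransversals κ s (D.erase (c p)),
      t ^ (D.card + 1 - (C p + T.val).card) = t ^ ((D.erase (c p)).card - T.card) := by
    intro p hp T hT
    rw [Multiset.card_add, Finset.card_val]
    rcases hcard p hp with ⟨h, h'⟩ | ⟨h, h'⟩
    · rw [h', h, Finset.erase_eq_of_notMem h₀, add_comm 1, Nat.add_sub_add_right]
    · have := Finset.card_pos.2 ⟨_, h⟩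
      rw [h', Finset.card_erase_of_mem h]
      congr 1
      omega
  have hcount0 : ∀ p ∈ P, ((C p).map κ).count (c p) = (C p).card := by
    intro p hp
    rw [← Multiset.card_map κ, Multiset.count_eq_card]
    intro x hx
    obtain ⟨y, hy, rfl⟩ := Multiset.mem_map.1 hx
    exact (hC p hp y hy).symm
  have hcount1 : ∀ p ∈ P, ∀ x, x ≠ c p → ((C p).map κ).count x = 0 := by
    intro p hp x hx
    rw [Multiset.count_eq_zero, Multiset.mem_map]
    rintro ⟨y, hy, rfl⟩
    exact hx (hC p hp y hy)
  have hcountT0 {E T} (hT : T ∈ partialTransversals κ s E) {x} (hx : x ∉ E) :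
      (T.val.map κ).count x = 0 :=
    Multiset.count_eq_zero.2 (not_mem_map_of_mem_partialTransversals hT hx)
  have hcountT1 {E T} (hT : T ∈ partialTransversals κ s E) (x) : (T.val.map κ).count x ≤ 1 :=
    Multiset.nodup_iff_count_le_one.1 (nodup_map_of_mem_partialTransversals hT) x
  have hfilter : ∀ p ∈ P, ∀ T ∈ partialTransversals κ s (D.erase (c p)),
      (C p + T.val).filter (fun x => κ x = c p) = C p := by
    intro p hp T hT
    rw [Multiset.filter_add, Multiset.filter_eq_self.2 (hC p hp), Multiset.filter_eq_nil.2, add_zero]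
    intro x hx hxp
    exact Finset.notMem_erase (c p) D (hxp ▸ (mem_partialTransversals.1 hT).2.2 x hx)
  have hne : ∀ p ∈ P, ∀ T ∈ partialTransversals κ s (D.erase (c p)),
      ∀ U ∈ partialTransversals κ s D, C p + T.val ≠ U.val := by
    intro p hp T hT U hU h
    have h1 := congrArg (fun R => (R.map κ).count (c p)) h
    simp only [Multiset.map_add, Multiset.count_add, hcount0 p hp,
      hcountT0 hT (Finset.notMem_erase (c p) D)] at h1
    rcases hcard p hp with ⟨h2, h3⟩ | ⟨h2, h3⟩
    · rw [hcountT0 hU (h2 ▸ h₀)] at h1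
      omega
    · have := hcountT1 hU (c p)
      omega
  have hinj' : ∀ p ∈ P, ∀ T ∈ partialTransversals κ s (D.erase (c p)), ∀ q ∈ P,
      ∀ U ∈ partialTransversals κ s (D.erase (c q)), C p + T.val = C q + U.val → p = q ∧ T = U := by
    intro p hp T hT q hq U hU h
    have hc : c p = c q := by
      by_contra hpq
      have h1 := congrArg (fun R => (R.map κ).count (c p)) h
      simp only [Multiset.map_add, Multiset.count_add, hcount0 p hp, hcount1 q hq _ hpq,
        hcountT0 hT (Finset.notMem_erase (c p) D)] at h1
      rcases hcard p hp with ⟨h2, h3⟩ | ⟨h2, h3⟩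
      · rw [hcountT0 hU (fun h => h₀ (h2 ▸ Finset.mem_of_mem_erase h))] at h1
        omega
      · have := hcountT1 hU (c p)
        omega
    have h2 := congrArg (Multiset.filter fun x => κ x = c p) h
    rw [hfilter p hp T hT, hc, hfilter q hq U hU] at h2
    obtain rfl := hinj hp hq h2
    exact ⟨rfl, Finset.val_inj.1 (add_left_cancel h)⟩
  have hsplit : Ω = (partialTransversals κ s D).image Finset.val ∪
      (P.sigma fun p => partialTransversals κ s (D.erase (c p))).image
        (fun x => C x.1 + x.2.val) := by
    ext R
    simp only [hΩ, IsCoreUnion, Finset.mem_union, Finset.mem_image, Finset.mem_sigma, Sigma.exists]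
    refine or_congr ?_ ?_
    · exact exists_congr fun T => and_congr_right fun _ => eq_comm
    · constructor
      · rintro ⟨p, hp, T, hT, rfl⟩
        exact ⟨p, T, ⟨hp, hT⟩, rfl⟩
      · rintro ⟨p, T, ⟨hp, hT⟩, rfl⟩
        exact ⟨p, hp, T, hT, rfl⟩
  rw [hsplit, Finset.sum_union, Finset.sum_image, Finset.sum_image, Finset.sum_sigma,
    Finset.mul_sum]
  · congr 1
    · exact Finset.sum_congr rfl hnone
    · exact Finset.sum_congr rfl fun p hp => Finset.sum_congr rfl (hsome p hp)
  · rintro ⟨p, T⟩ hx ⟨q, U⟩ hy h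
    rw [Finset.mem_coe, Finset.mem_sigma] at hx hy
    obtain ⟨rfl, rfl⟩ := hinj' p hx.1 T hx.2 q hy.1 U hy.2 h
    rfl
  · exact fun T _ U _ h => Finset.val_inj.1 h
  · rw [Finset.disjoint_left]
    intro R hR hR'
    obtain ⟨U, hU, rfl⟩ := Finset.mem_image.1 hR
    obtain ⟨⟨p, T⟩, hx, h⟩ := Finset.mem_image.1 hR'
    rw [Finset.mem_sigma] at hx
    exact hne p hx.1 T hx.2 U hU h

end CoreUnion

/-! ### Counting independent sets over a fixed forest -/

namespace Bicone

variable {α : Type u} {β : Type v} {G : Graph α β} {A B : Set α} {hAB : V(G) = A ∪ B}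
  {V : Finset (BiconeVertex α)} {F : Finset (BiconeEdge α β)}

open Classical in
/-- The components of the forest `F` other than that of `0̄`. -/
noncomputable def freeComps (G : Graph α β) (A B : Set α) (hAB : V(G) = A ∪ B)
    (V : Finset (BiconeVertex α)) (F : Finset (BiconeEdge α β)) : Finset (Set (BiconeVertex α)) :=
  (V.image ((graph G A B hAB).comp (insert .cone F))).erase
    ((graph G A B hAB).comp (insert .cone F) .zeroBar)

open Classical in
/-- The pairs of vertices of different colours in a component, where in the component of `0̄` only
the vertex `0` is allowed as the second vertex. -/
noncomputable def bicolouredPairs (G : Graph α β) (A B : Set α) (hAB : V(G) = A ∪ B)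
    (V : Finset (BiconeVertex α)) (F : Finset (BiconeEdge α β)) :
    Finset (BiconeVertex α × BiconeVertex α) :=
  (V ×ˢ insert .zero V).filter fun p => IsLeft A p.1 ∧ ¬ IsLeft A p.2 ∧
    (graph G A B hAB).comp (insert .cone F) p.1 = (graph G A B hAB).comp (insert .cone F) p.2 ∧
    ((graph G A B hAB).comp (insert .cone F) p.1 =
      (graph G A B hAB).comp (insert .cone F) .zeroBar → p.2 = .zero)

theorem mem_bicolouredPairs {p : BiconeVertex α × BiconeVertex α} :
    p ∈ bicolouredPairs G A B hAB V F ↔ p.1 ∈ V ∧ (p.2 = .zero ∨ p.2 ∈ V) ∧ IsLeft A p.1 ∧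
      ¬ IsLeft A p.2 ∧
      (graph G A B hAB).comp (insert .cone F) p.1 = (graph G A B hAB).comp (insert .cone F) p.2 ∧
      ((graph G A B hAB).comp (insert .cone F) p.1 =
        (graph G A B hAB).comp (insert .cone F) .zeroBar → p.2 = .zero) := by
  simp [bicolouredPairs, and_assoc]

theorem comp_eq_zeroBar_iff {p : BiconeVertex α × BiconeVertex α}
    (hp : p ∈ bicolouredPairs G A B hAB V F) : (graph G A B hAB).comp (insert .cone F) p.1 =
      (graph G A B hAB).comp (insert .cone F) .zeroBar ↔ p.2 = .zero := by
  obtain ⟨h1, h2, h3, h4, h5, h6⟩ := mem_bicolouredPairs.1 hp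
  refine ⟨h6, fun h => ?_⟩
  rw [h5, h]
  exact comp_zero

theorem snd_ne_zeroBar {p : BiconeVertex α × BiconeVertex α}
    (hp : p ∈ bicolouredPairs G A B hAB V F) : p.2 ≠ .zeroBar := by
  intro h
  obtain ⟨h1, h2, h3, h4, h5, h6⟩ := mem_bicolouredPairs.1 hp
  rw [h] at h5 h6
  exact nomatch h6 h5

theorem fst_ne_snd {p : BiconeVertex α × BiconeVertex α}
    (hp : p ∈ bicolouredPairs G A B hAB V F) : p.1 ≠ p.2 := by
  intro h
  obtain ⟨h1, h2, h3, h4, h5, h6⟩ := mem_bicolouredPairs.1 hp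
  exact h4 (h ▸ h3)

open Classical in
theorem zeroBar_notMem_freeComps :
    (graph G A B hAB).comp (insert .cone F) .zeroBar ∉ freeComps G A B hAB V F :=
  Finset.notMem_erase _ _

theorem comp_mem_freeComps {x : BiconeVertex α} (hx : x ∈ V)
    (h : (graph G A B hAB).comp (insert .cone F) x ≠
      (graph G A B hAB).comp (insert .cone F) .zeroBar) :
    (graph G A B hAB).comp (insert .cone F) x ∈ freeComps G A B hAB V F := by
  classical
  exact Finset.mem_erase.2 ⟨h, Finset.mem_image_of_mem _ hx⟩

open Classical in
/-- The vertices of a bicoloured pair, except `0`. -/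
noncomputable def pairVertices (p : BiconeVertex α × BiconeVertex α) : Multiset (BiconeVertex α) :=
  if p.2 = .zero then {p.1} else {p.1, p.2}

theorem isTransversal_iff (hV : ∀ x, x ∈ V ↔ x ∈ V(reduced G A B hAB)) {T : Finset (BiconeVertex α)} :
    T ∈ partialTransversals ((graph G A B hAB).comp (insert .cone F)) V
      (freeComps G A B hAB V F) ↔ IsTransversal G A B hAB F T := by
  rw [mem_partialTransversals]
  constructor
  · rintro ⟨h1, h2, h3⟩
    exact ⟨fun x hx => (hV x).1 (h1 hx), h2, fun x hx h =>
      zeroBar_notMem_freeComps (hAB := hAB) (V := V) (h ▸ h3 x hx)⟩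
  · rintro ⟨h1, h2, h3⟩
    exact ⟨fun x hx => (hV x).2 (h1 hx), h2, fun x hx =>
      comp_mem_freeComps ((hV x).2 (h1 hx)) (h3 x hx)⟩

theorem mem_partialTransversals_erase {ι γ : Type*} [DecidableEq γ] {κ : ι → γ} {s : Finset ι} {D : Finset γ}
    {T : Finset ι} {c : γ} : T ∈ partialTransversals κ s (D.erase c) ↔
      T ∈ partialTransversals κ s D ∧ ∀ x ∈ T, κ x ≠ c := by
  simp only [mem_partialTransversals, Finset.mem_erase]
  grind

/-- The sets of tree edges other than `00̄` that extend the forest `F`. -/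
theorem isAcyclic_union_treeEdge_iff (hV : ∀ x, x ∈ V ↔ x ∈ V(reduced G A B hAB))
    (hF : (F : Set (BiconeEdge α β)) ⊆ E(reduced G A B hAB))
    (hac : ((graph G A B hAB).restrict F).IsAcyclic) {T : Finset (BiconeVertex α)} :
    (T ⊆ V ∧ .zeroBar ∉ T ∧ ((graph G A B hAB).restrict (F ∪ treeEdge A '' T)).IsAcyclic) ↔
      IsCoreUnion ((graph G A B hAB).comp (insert .cone F)) V (freeComps G A B hAB V F)
        (bicolouredPairs G A B hAB V F) pairVertices
        (fun p => (graph G A B hAB).comp (insert .cone F) p.1) T.val := by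
  classical
  set σ := (graph G A B hAB).comp (insert .cone F) with hσ
  constructor
  · rintro ⟨hTV, hT0, hT⟩
    have hTV' : (T : Set (BiconeVertex α)) ⊆ V(reduced G A B hAB) := fun x hx => (hV x).1 (hTV hx)
    rcases isTransversal_or_exists_insert hF hTV' hT with h | ⟨x, S, hxS, hTS, hS, hx⟩
    · exact .inl ⟨T, (isTransversal_iff hV).2 h, rfl⟩
    have hxT : x ∈ T := by rw [← Finset.mem_coe, hTS]; exact Set.mem_insert _ _
    have hx0 : x ≠ .zeroBar := by rintro rfl; exact hT0 hxT
    obtain ⟨hxl, hx⟩ := hx.resolve_left hx0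
    obtain rfl : S = ↑(T.erase x) := by
      rw [Finset.coe_erase, hTS]
      simp [hxS]
    have hS' := (isTransversal_iff hV).2 hS
    right
    -- A connector in the component of 0̄ gives the pair `(x, 0)`; any other connector comes with a
    -- vertex `b` of its component that is attached to 0̄.
    by_cases hxc : σ x = σ .zeroBar
    · refine ⟨(x, .zero), mem_bicolouredPairs.2 ⟨hTV hxT, .inl rfl, hxl, by simp [IsLeft],
        hxc.trans comp_zero.symm, fun _ => rfl⟩, T.erase x, ?_, ?_⟩
      · simp only [hxc]
        rwa [Finset.erase_eq_of_notMem zeroBar_notMem_freeComps]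
      · rw [pairVertices, if_pos rfl, Multiset.singleton_add, Finset.erase_val,
          Multiset.cons_erase hxT]
    · obtain ⟨b, hb, hbl, hbx⟩ := hx.resolve_left hxc
      have hb' : b ∈ T.erase x := hb
      have hbT : b ∈ T := Finset.mem_of_mem_erase hb'
      have hb0 : b ≠ .zero := (mem_vertexSet_reduced.1 (hTV' hbT)).2
      refine ⟨(x, b), mem_bicolouredPairs.2 ⟨hTV hxT, .inr (hTV hbT), hxl, hbl, hbx.symm,
        fun h => absurd h hxc⟩, (T.erase x).erase b, mem_partialTransversals_erase.2 ⟨?_, ?_⟩, ?_⟩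
      · exact (isTransversal_iff hV).2 (hS.mono (by simp))
      · intro y hy hyx
        rw [Finset.mem_erase] at hy
        exact hy.1 (hS.injOn (Finset.mem_coe.2 hy.2) hb (hyx.trans hbx.symm))
      · rw [pairVertices, if_neg hb0, Multiset.insert_eq_cons, Multiset.cons_add,
          Multiset.singleton_add, Finset.erase_val, Multiset.cons_erase hb', Finset.erase_val,
          Multiset.cons_erase hxT]
  · rintro (⟨S, hS, h⟩ | ⟨p, hp, S, hS, h⟩)
    · obtain rfl := Finset.val_inj.1 h
      have hS' := (isTransversal_iff hV).1 hS
      exact ⟨(mem_partialTransversals.1 hS).1, fun h => hS'.ne _ h rfl,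
        hS'.isAcyclic hF hac T.finite_toSet⟩
    · obtain ⟨hS, hSp⟩ := mem_partialTransversals_erase.1 hS
      have hS' := (isTransversal_iff hV).1 hS
      obtain ⟨h1, h2, h3, h4, h5, h6⟩ := mem_bicolouredPairs.1 hp
      have hpS : p.1 ∉ S := fun h => hSp _ h rfl
      have hp0 : p.1 ≠ .zeroBar := by
        intro h
        rw [h] at h3
        simp [IsLeft] at h3
      by_cases hp2 : p.2 = .zero
      · rw [pairVertices, if_pos hp2, Multiset.singleton_add,
          ← Finset.insert_val_of_notMem hpS, Finset.val_inj] at h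
        subst h
        refine ⟨Finset.insert_subset h1 (mem_partialTransversals.1 hS).1, ?_, ?_⟩
        · rw [Finset.mem_insert, not_or]
          exact ⟨fun h => hp0 h.symm, fun h => hS'.ne _ h rfl⟩
        · rw [Finset.coe_insert]
          exact hS'.isAcyclic_insert hF hac S.finite_toSet ((hV _).1 h1) (.inr h3) hpS
            (.inl ((comp_eq_zeroBar_iff hp).2 hp2))
      · have h2 := h2.resolve_left hp2
        have hp2S : p.2 ∉ S := fun h => hSp _ h h5.symm
        have hpS2 : p.1 ∉ insert p.2 S := by
          rw [Finset.mem_insert, not_or]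
          exact ⟨fst_ne_snd hp, hpS⟩
        rw [pairVertices, if_neg hp2, Multiset.insert_eq_cons, Multiset.cons_add,
          Multiset.singleton_add, ← Finset.insert_val_of_notMem hp2S,
          ← Finset.insert_val_of_notMem hpS2, Finset.val_inj] at h
        subst h
        have hS2 : IsTransversal G A B hAB F (insert p.2 S : Finset (BiconeVertex α)) := by
          rw [Finset.coe_insert]
          refine ⟨Set.insert_subset ((hV _).1 h2) hS'.subset, ?_, ?_⟩
          · rw [Set.injOn_insert (by simpa using hp2S)]
            refine ⟨hS'.injOn, ?_⟩
            rintro ⟨y, hy, hyp⟩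
            exact hSp y hy (hyp.trans h5.symm)
          · rintro y (rfl | hy)
            · exact fun h => hp2 ((comp_eq_zeroBar_iff hp).1 (h5.trans h))
            · exact hS'.ne y hy
        refine ⟨Finset.insert_subset h1 (Finset.insert_subset h2 (mem_partialTransversals.1 hS).1),
          ?_, ?_⟩
        · simp only [Finset.mem_insert, not_or]
          exact ⟨fun h => hp0 h.symm, fun h => snd_ne_zeroBar hp h.symm, fun h => hS'.ne _ h rfl⟩
        · rw [Finset.coe_insert]
          exact hS2.isAcyclic_insert hF hac (Finset.finite_toSet _) ((hV _).1 h1) (.inr h3)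
            (by rwa [Finset.mem_coe]) (.inr ⟨p.2, by simp, h4, h5.symm⟩)

open Classical in
-- The sets that contain 0̄, whose tree edge is 00̄, arise from partial transversals by adding 0̄;
-- they account for the summand 1 in `t + 1`. The other sets are counted by `sum_isCoreUnion`.
theorem sum_acyclic_treeEdge {S : Type*} [CommRing S] (t : S)
    (hV : ∀ x, x ∈ V ↔ x ∈ V(reduced G A B hAB))
    (hF : (F : Set (BiconeEdge α β)) ⊆ E(reduced G A B hAB))
    (hac : ((graph G A B hAB).restrict F).IsAcyclic) :
    ∑ T ∈ V.powerset.filter fun T : Finset (BiconeVertex α) =>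
        ((graph G A B hAB).restrict (F ∪ treeEdge A '' T)).IsAcyclic,
      t ^ ((freeComps G A B hAB V F).card + 1 - T.card) =
    (t + 1) * ∑ T ∈ partialTransversals ((graph G A B hAB).comp (insert .cone F)) V
        (freeComps G A B hAB V F), t ^ ((freeComps G A B hAB V F).card - T.card) +
      ∑ p ∈ bicolouredPairs G A B hAB V F,
        ∑ T ∈ partialTransversals ((graph G A B hAB).comp (insert .cone F)) V
          ((freeComps G A B hAB V F).erase ((graph G A B hAB).comp (insert .cone F) p.1)),
          t ^ (((freeComps G A B hAB V F).erase
            ((graph G A B hAB).comp (insert .cone F) p.1)).card - T.card) := by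
  set D := freeComps G A B hAB V F
  set Ω := (V.powerset.filter fun T : Finset (BiconeVertex α) =>
        ((graph G A B hAB).restrict (F ∪ treeEdge A '' T)).IsAcyclic) with hΩ
  have hmem : ∀ T, T ∈ Ω ↔ T ⊆ V ∧
      ((graph G A B hAB).restrict (F ∪ treeEdge A '' T)).IsAcyclic := by simp [hΩ]
  have hcore := sum_isCoreUnion t (κ := (graph G A B hAB).comp (insert .cone F)) (s := V)
    (D := D) (P := bicolouredPairs G A B hAB V F) (C := pairVertices)
    (c := fun p => (graph G A B hAB).comp (insert .cone F) p.1)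
    (c₀ := (graph G A B hAB).comp (insert .cone F) .zeroBar)
    (Ω := (Ω.filter fun T => .zeroBar ∉ T).image Finset.val)
    zeroBar_notMem_freeComps ?_ ?_ ?_ ?_
  · rw [← Finset.sum_filter_not_add_sum_filter Ω (fun T => .zeroBar ∈ T), add_mul, one_mul,
      add_right_comm, ← hcore, Finset.sum_image fun _ _ _ _ h => Finset.val_inj.1 h]
    congr 1
    refine Finset.sum_nbij' (fun T => T.erase .zeroBar) (fun T => insert .zeroBar T) ?_ ?_ ?_ ?_ ?_
    · intro T hT
      obtain ⟨hT, h0⟩ := Finset.mem_filter.1 hT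
      obtain ⟨hTV, hT⟩ := (hmem T).1 hT
      rw [isTransversal_iff hV]
      rcases isTransversal_or_exists_insert hF (fun x hx => (hV x).1 (hTV hx)) hT with
        h | ⟨x, S, hxS, hTS, hS, hx⟩
      · exact absurd rfl (h.ne _ h0)
      · obtain rfl : x = .zeroBar := by
          have : .zeroBar ∈ insert x S := hTS ▸ Finset.mem_coe.2 h0
          exact (this.resolve_right fun h => hS.ne _ h rfl).symm
        rw [Finset.coe_erase, hTS]
        simpa [hxS] using hS
    · intro T hT
      have hT' := (isTransversal_iff hV).1 hT
      refine Finset.mem_filter.2 ⟨(hmem _).2 ⟨Finset.insert_subset ((hV _).2 zeroBar_mem)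
        (mem_partialTransversals.1 hT).1, ?_⟩, Finset.mem_insert_self _ _⟩
      rw [Finset.coe_insert]
      exact hT'.isAcyclic_insert hF hac T.finite_toSet zeroBar_mem (.inl rfl)
        (fun h => hT'.ne _ h rfl) (.inl rfl)
    · intro T hT
      exact Finset.insert_erase (Finset.mem_filter.1 hT).2
    · intro T hT
      exact Finset.erase_insert fun h => ((isTransversal_iff hV).1 hT).ne _ h rfl
    · intro T hT
      obtain ⟨hT, h0⟩ := Finset.mem_filter.1 hT
      have := Finset.card_pos.2 ⟨_, h0⟩
      rw [Finset.card_erase_of_mem h0]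
      congr 1
      omega
  · intro p hp x hx
    obtain ⟨h1, h2, h3, h4, h5, h6⟩ := mem_bicolouredPairs.1 hp
    unfold pairVertices at hx
    split_ifs at hx
    · rw [Multiset.mem_singleton.1 hx]
    · rcases Multiset.mem_cons.1 hx with rfl | hx
      · rfl
      · rw [Multiset.mem_singleton.1 hx, h5]
  · intro p hp
    rw [comp_eq_zeroBar_iff hp, pairVertices]
    split_ifs with h
    · exact .inl ⟨h, rfl⟩
    · exact .inr ⟨comp_mem_freeComps (mem_bicolouredPairs.1 hp).1
        fun h' => h ((comp_eq_zeroBar_iff hp).1 h'), rfl⟩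
  -- The colours tell the two vertices of a pair apart, and the component shows whether the second
  -- one is 0.
  · intro p hp q hq hpq
    obtain ⟨h1, h2, h3, h4, h5, h6⟩ := mem_bicolouredPairs.1 hp
    obtain ⟨k1, k2, k3, k4, k5, k6⟩ := mem_bicolouredPairs.1 hq
    have hmemp : ∀ r : BiconeVertex α × BiconeVertex α, ∀ x, x ∈ pairVertices r ↔
        x = r.1 ∨ r.2 ≠ .zero ∧ x = r.2 := by
      intro r x
      unfold pairVertices
      split_ifs with h <;> simp [h]
    have hx : ∀ x, (x = p.1 ∨ p.2 ≠ .zero ∧ x = p.2) ↔ (x = q.1 ∨ q.2 ≠ .zero ∧ x = q.2) := by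
      intro x
      rw [← hmemp, ← hmemp, hpq]
    have hne {x y} (hx : IsLeft A x) (hy : ¬ IsLeft A y) : x ≠ y := by rintro rfl; exact hy hx
    have e1 : p.1 = q.1 := by
      rcases (hx p.1).1 (.inl rfl) with h | ⟨-, h⟩
      · exact h
      · exact absurd h (hne h3 k4)
    have e2 : p.2 = q.2 := by
      by_cases hp2 : p.2 = .zero
      · have := (comp_eq_zeroBar_iff hp).2 hp2
        rw [e1] at this
        rw [hp2, k6 this]
      · rcases (hx p.2).1 (.inr ⟨hp2, rfl⟩) with h | ⟨-, h⟩
        · exact absurd h.symm (hne k3 h4)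
        · exact h
    exact Prod.ext e1 e2
  · intro R
    constructor
    · intro hR
      obtain ⟨T, hT, rfl⟩ := Finset.mem_image.1 hR
      obtain ⟨hT, h0⟩ := Finset.mem_filter.1 hT
      obtain ⟨hTV, hT⟩ := (hmem T).1 hT
      exact (isAcyclic_union_treeEdge_iff hV hF hac).1 ⟨hTV, h0, hT⟩
    · intro hR
      have hnd : R.Nodup := by
        rcases hR with ⟨T, -, rfl⟩ | ⟨p, hp, T, hT, rfl⟩
        · exact T.nodup
        · rw [Multiset.nodup_add]
          obtain ⟨-, hT⟩ := mem_partialTransversals_erase.1 hT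
          have h5 := (mem_bicolouredPairs.1 hp).2.2.2.2.1
          refine ⟨?_, T.nodup, ?_⟩
          · unfold pairVertices
            split_ifs
            · simp
            · simp [fst_ne_snd hp]
          · rw [Multiset.disjoint_left]
            intro x hx hxT
            refine hT x hxT ?_
            unfold pairVertices at hx
            split_ifs at hx
            · rw [Multiset.mem_singleton.1 hx]
            · rcases Multiset.mem_cons.1 hx with rfl | hx
              · rfl
              · rw [Multiset.mem_singleton.1 hx]
                exact h5.symm
      obtain ⟨h1, h2, h3⟩ := (isAcyclic_union_treeEdge_iff hV hF hac (T := ⟨R, hnd⟩)).2 hR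
      exact Finset.mem_image.2 ⟨⟨R, hnd⟩, Finset.mem_filter.2 ⟨(hmem _).2 ⟨h1, h3⟩, h2⟩, rfl⟩

end Bicone

/-! ### Counting 2-edge-rooted forests over a fixed forest -/

namespace Bicone

variable {α : Type u} {β : Type v} {G : Graph α β} {A B : Set α} {hAB : V(G) = A ∪ B}
  {V : Finset (BiconeVertex α)} {F : Finset (BiconeEdge α β)}

open Classical in
/-- The first and the last edge of the path of the forest `F` that joins a bicoloured pair, except
for the edge `00̄`. -/
noncomputable def pairEdges (G : Graph α β) (A B : Set α) (hAB : V(G) = A ∪ B)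
    (F : Finset (BiconeEdge α β)) (p : BiconeVertex α × BiconeVertex α) :
    Multiset (BiconeEdge α β) :=
  if h : ∃ e : BiconeEdge α β × BiconeEdge α β,
    (graph G A B hAB).EndPair (insert .cone F) p.1 p.2 e.1 e.2
  then ({h.choose.1, h.choose.2} : Multiset (BiconeEdge α β)).erase .cone else 0

theorem not_isLeft_of_inc_cone {x : BiconeVertex α} (hx : (graph G A B hAB).Inc .cone x) :
    ¬ IsLeft A x := by
  rcases inc_cone.1 hx with rfl | rfl <;> simp [IsLeft]

section

variable (hF : (F : Set (BiconeEdge α β)) ⊆ E(reduced G A B hAB))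
  (hac : ((graph G A B hAB).restrict (insert .cone (F : Set (BiconeEdge α β)))).IsAcyclic)

include hac

theorem pairEdges_eq {p : BiconeVertex α × BiconeVertex α} {e f : BiconeEdge α β}
    (h : (graph G A B hAB).EndPair (insert .cone F) p.1 p.2 e f) [DecidableEq (BiconeEdge α β)] :
    pairEdges G A B hAB F p = ({e, f} : Multiset (BiconeEdge α β)).erase .cone := by
  have hex : ∃ e : BiconeEdge α β × BiconeEdge α β,
      (graph G A B hAB).EndPair (insert .cone F) p.1 p.2 e.1 e.2 := ⟨(e, f), h⟩
  obtain ⟨h1, h2⟩ := hac.endPair_unique hex.choose_spec h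
  rw [pairEdges, dif_pos hex, h1, h2]
  congr!

include hF

omit hac in
-- The pendant edge 00̄ separates only 0 from the rest. Hence if 00̄ is the last edge of an extreme
-- pair that starts away from 0, the pair ends at 0 and not at 0̄.
theorem not_endPair_zeroBar_cone {a : BiconeVertex α} {e : BiconeEdge α β} (ha : a ≠ .zero) :
    ¬ (graph G A B hAB).EndPair (insert .cone F) a .zeroBar e .cone := by
  intro h
  refine h.cut_right ?_
  rw [Set.insert_sdiff_self_of_notMem fun h => cone_notMem (hF h)]
  exact (reach_insert_cone hF ha (by simp)).1 h.reach

/-- The first edge is not 00̄, as it has an end in `A`; the last one is 00̄ iff the second vertex is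
0. So the cores have one element in the component of 0̄ and two elsewhere, as `sum_isCoreUnion`
requires. -/
theorem exists_endPair_of_mem_bicolouredPairs (hV : ∀ x, x ∈ V ↔ x ∈ V(reduced G A B hAB))
    {p : BiconeVertex α × BiconeVertex α} (hp : p ∈ bicolouredPairs G A B hAB V F) :
    ∃ e f, (graph G A B hAB).EndPair (insert .cone F) p.1 p.2 e f ∧ e ≠ .cone ∧
      ((p.2 = .zero ∧ f = .cone ∧ pairEdges G A B hAB F p = {e}) ∨
        (p.2 ≠ .zero ∧ f ≠ .cone ∧ pairEdges G A B hAB F p = {e, f})) := by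
  classical
  obtain ⟨h1, h2, h3, h4, h5, h6⟩ := mem_bicolouredPairs.1 hp
  have hmem : p.2 ∈ V(graph G A B hAB) := by
    rcases h2 with h2 | h2
    · rw [h2]; simp [graph]
    · exact (mem_vertexSet_reduced.1 ((hV _).1 h2)).1
  obtain ⟨e, f, hef⟩ := hac.exists_endPair (Graph.comp_eq_iff.1 h5) hmem (fst_ne_snd hp)
  have he : e ≠ .cone := by rintro rfl; exact not_isLeft_of_inc_cone hef.inc_left h3
  refine ⟨e, f, hef, he, ?_⟩
  rw [pairEdges_eq hac hef]
  by_cases hp2 : p.2 = .zero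
  · have hf : f = .cone := by
      refine hef.right_mem.resolve_right fun hf => not_inc_zero (hF hf) ?_
      rw [← hp2]
      exact hef.inc_right
    refine .inl ⟨hp2, hf, ?_⟩
    rw [hf, Multiset.insert_eq_cons, Multiset.erase_cons_tail _ he]
    simp
  · have hf : f ≠ .cone := by
      rintro rfl
      rcases inc_cone.1 hef.inc_right with h | h
      · exact hp2 h
      · exact snd_ne_zeroBar hp h
    refine .inr ⟨hp2, hf, Multiset.erase_of_notMem ?_⟩
    simp [he.symm, hf.symm]

open Classical in
/-- The `2`-edge-rooted forests with underlying forest `F`. -/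
theorem isTwoEdgeRootedForest_fibre (hV : ∀ x, x ∈ V ↔ x ∈ V(reduced G A B hAB))
    {m : Multiset (BiconeEdge α β)} :
    (IsTwoEdgeRootedForest G A B hAB m ∧ m.toFinset = F) ↔
      ∃ R, IsCoreUnion ((graph G A B hAB).edgeComp (insert .cone F)) F (freeComps G A B hAB V F)
        (bicolouredPairs G A B hAB V F) (pairEdges G A B hAB F)
        (fun p => (graph G A B hAB).comp (insert .cone F) p.1) R ∧ F.val + R = m := by
  set κ := (graph G A B hAB).edgeComp (insert .cone F) with hκ
  set σ := (graph G A B hAB).comp (insert .cone F) with hσ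
  set D := freeComps G A B hAB V F with hD
  have hcone : κ .cone = σ .zeroBar := Graph.edgeComp_eq (.inl rfl) (inc_cone.2 (.inr rfl))
  have hc0 : σ .zeroBar ∉ D := zeroBar_notMem_freeComps
  have hfree : ∀ e ∈ F, κ e ≠ σ .zeroBar → κ e ∈ D := by
    intro e he hne
    obtain ⟨x, y, hl⟩ := (reduced G A B hAB).exists_isLink_of_mem_edgeSet (hF he)
    have hex : κ e = σ x := Graph.edgeComp_eq (.inr he) (reduced_isLink.1 hl).1.inc_left
    rw [hex] at hne ⊢
    exact comp_mem_freeComps ((hV x).2 hl.left_mem) hne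
  have hPT : ∀ (S : Multiset (BiconeEdge α β)) (D' : Finset (Set (BiconeVertex α))),
      (S.map κ).Nodup → (∀ e ∈ S, e ∈ F) → (∀ e ∈ S, κ e ∈ D') →
      ∃ T ∈ partialTransversals κ F D', S = T.val := by
    intro S D' h1 h2 h3
    have hS : S.Nodup := Multiset.Nodup.of_map _ h1
    exact ⟨⟨S, hS⟩, mem_partialTransversals.2 ⟨h2, Finset.nodup_map_iff_injOn.1 h1, h3⟩, rfl⟩
  constructor
  · rintro ⟨hm, hmF⟩
    obtain ⟨h1, -, h3⟩ := isTwoEdgeRootedForest_iff.1 hm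
    have hsupp : coneSupport m = insert .cone (F : Set (BiconeEdge α β)) := by
      rw [coneSupport, ← hmF]
      ext; simp
    have hdedup : m.dedup = F.val := by rw [← hmF]; rfl
    rw [hsupp] at h3
    refine ⟨m - m.dedup, ?_, by rw [← hdedup, add_tsub_cancel_of_le (Multiset.dedup_le m)]⟩
    have hRF : ∀ e ∈ m - m.dedup, e ∈ F := by
      intro e he
      rw [← hmF, Multiset.mem_toFinset]
      exact Multiset.mem_of_le (Multiset.sub_le_self _ _) he
    unfold coneRoots at h3
    generalize m - m.dedup = R at *
    rcases h3 with hnd | ⟨e, f, S, hS, hfS, a, b, ha, hb, hab⟩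
    · left
      rw [Multiset.map_cons, Multiset.nodup_cons, ← hκ] at hnd
      refine hPT R D hnd.2 hRF fun e he => hfree e (hRF e he) fun h => hnd.1 ?_
      rw [hcone, ← h]
      exact Multiset.mem_map_of_mem _ he
    right
    have he : e ≠ .cone := by rintro rfl; exact not_isLeft_of_inc_cone hab.inc_left ha
    have heF : e ∈ F := hab.left_mem.resolve_left he
    have ha0 : a ≠ .zero := by rintro rfl; simp [IsLeft] at ha
    have haV : a ∈ V := (hV a).2 (mem_vertexSet_reduced.2 ⟨hab.inc_left.vertex_mem, ha0⟩)
    have hκf : κ f = σ a := hab.edgeComp_right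
    have hcm : .cone ∈ f ::ₘ S := by
      have : .cone ∈ e ::ₘ f ::ₘ S := hS ▸ Multiset.mem_cons_self _ _
      exact (Multiset.mem_cons.1 this).resolve_left he.symm
    rw [← hκ] at hfS
    -- The edge 00̄ is always a root. If the doubled component is that of 0̄, then 00̄ is a member
    -- of the pair, and the core is `e` alone; otherwise 00̄ is among the remaining roots and
    -- excludes the component of 0̄ from the transversal.
    by_cases hac0 : σ a = σ .zeroBar
    · have hf : f = .cone := Multiset.inj_on_of_nodup_map hfS f (by simp) _ hcm
        (by rw [hκf, hac0, hcone])
      subst hf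
      have hb0 : b = .zero := by
        rcases inc_cone.1 hab.inc_right with h | rfl
        · exact h
        · exact absurd hab (not_endPair_zeroBar_cone hF ha0)
      subst hb0
      have hp : (a, .zero) ∈ bicolouredPairs G A B hAB V F := mem_bicolouredPairs.2
        ⟨haV, .inl rfl, ha, hb, hac0.trans comp_zero.symm, fun _ => rfl⟩
      obtain rfl : R = e ::ₘ S := by
        rw [Multiset.cons_swap] at hS
        exact (Multiset.cons_inj_right _).1 hS
      rw [Multiset.map_cons, Multiset.nodup_cons] at hfS
      obtain ⟨T, hT, rfl⟩ := hPT S D hfS.2 (fun g hg => hRF g (by simp [hg])) fun g hg =>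
        hfree g (hRF g (by simp [hg])) fun h => hfS.1 (by
          rw [hcone, ← h]; exact Multiset.mem_map_of_mem _ hg)
      refine ⟨_, hp, T, ?_, ?_⟩
      · simp only [hac0]
        rwa [Finset.erase_eq_of_notMem hc0]
      · rw [pairEdges_eq hac hab, Multiset.insert_eq_cons, Multiset.erase_cons_tail _ he]
        simp
    · have hf : f ≠ .cone := by
        rintro rfl
        exact hac0 (hκf.symm.trans hcone)
      obtain ⟨S, rfl⟩ := Multiset.exists_cons_of_mem
        ((Multiset.mem_cons.1 hcm).resolve_left hf.symm)
      obtain rfl : R = e ::ₘ f ::ₘ S := by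
        rw [Multiset.cons_swap f, Multiset.cons_swap e] at hS
        exact (Multiset.cons_inj_right _).1 hS
      have hσab : σ a = σ b := Graph.comp_eq_iff.2 hab.reach
      have hbV : b = .zero ∨ b ∈ V := by
        by_cases hb0 : b = .zero
        · exact .inl hb0
        · exact .inr ((hV b).2 (mem_vertexSet_reduced.2 ⟨hab.inc_right.vertex_mem, hb0⟩))
      have hp : (a, b) ∈ bicolouredPairs G A B hAB V F := mem_bicolouredPairs.2
        ⟨haV, hbV, ha, hb, hσab, fun h => absurd h hac0⟩
      rw [Multiset.map_cons, Multiset.nodup_cons, Multiset.map_cons, Multiset.nodup_cons,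
        Multiset.mem_cons, not_or] at hfS
      obtain ⟨T, hT, rfl⟩ := hPT S (D.erase (σ a)) hfS.2.2 (fun g hg => hRF g (by simp [hg]))
        fun g hg => Finset.mem_erase.2 ⟨fun h => hfS.1.2 (by
          rw [hκf, ← h]; exact Multiset.mem_map_of_mem _ hg),
          hfree g (hRF g (by simp [hg])) fun h => hfS.2.1 (by
          rw [hcone, ← h]; exact Multiset.mem_map_of_mem _ hg)⟩
      refine ⟨_, hp, T, hT, ?_⟩
      rw [pairEdges_eq hac hab, Multiset.erase_of_notMem (by simp [he.symm, hf.symm]),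
        Multiset.insert_eq_cons, Multiset.cons_add, Multiset.singleton_add]
  · rintro ⟨R, hR, rfl⟩
    have hRF : ∀ e ∈ R, e ∈ F := by
      rcases hR with ⟨T, hT, rfl⟩ | ⟨p, hp, T, hT, rfl⟩
      · exact fun e he => (mem_partialTransversals.1 hT).1 he
      · intro g hg
        rcases Multiset.mem_add.1 hg with hg | hg
        · obtain ⟨e, f, hef, he, ⟨-, -, h⟩ | ⟨-, hf, h⟩⟩ :=
            exists_endPair_of_mem_bicolouredPairs hF hac hV hp
          · rw [h, Multiset.mem_singleton] at hg
            subst hg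
            exact hef.left_mem.resolve_left he
          · rw [h, Multiset.insert_eq_cons, Multiset.mem_cons, Multiset.mem_singleton] at hg
            rcases hg with rfl | rfl
            · exact hef.left_mem.resolve_left he
            · exact hef.right_mem.resolve_left hf
        · exact (mem_partialTransversals.1 hT).1 hg
    have hmem : ∀ e, e ∈ F.val + R ↔ e ∈ F := by
      intro e
      rw [Multiset.mem_add]
      exact ⟨fun h => h.elim id (hRF e), .inl⟩
    have hdedup : (F.val + R).dedup = F.val := by
      refine (Multiset.Nodup.ext (Multiset.nodup_dedup _) F.nodup).2 fun e => ?_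
      rw [Multiset.mem_dedup, hmem]
      rfl
    refine ⟨isTwoEdgeRootedForest_iff.2 ⟨fun e he => hF ((hmem e).1 he), ?_, ?_⟩, ?_⟩
    rotate_right
    · ext e
      rw [Multiset.mem_toFinset, hmem]
    all_goals
      have hsupp : coneSupport (F.val + R) = insert .cone (F : Set (BiconeEdge α β)) := by
        rw [coneSupport]
        congr 1
        ext e
        exact hmem e
      rw [hsupp]
    · exact hac
    rw [coneRoots, hdedup, add_tsub_cancel_left]
    have hnd : ∀ T ∈ partialTransversals κ F D, ((.cone ::ₘ T.val).map κ).Nodup := by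
      intro T hT
      rw [Multiset.map_cons, Multiset.nodup_cons, hcone]
      exact ⟨not_mem_map_of_mem_partialTransversals hT hc0,
        nodup_map_of_mem_partialTransversals hT⟩
    rcases hR with ⟨T, hT, rfl⟩ | ⟨p, hp, T, hT, rfl⟩
    · exact .inl (hnd T hT)
    · obtain ⟨hT, hTp⟩ := mem_partialTransversals_erase.1 hT
      obtain ⟨h1, h2, h3, h4, h5, h6⟩ := mem_bicolouredPairs.1 hp
      obtain ⟨e, f, hef, he, ⟨hp2, hf, h⟩ | ⟨hp2, hf, h⟩⟩ :=
        exists_endPair_of_mem_bicolouredPairs hF hac hV hp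
      · subst hf
        refine .inr ⟨e, .cone, T.val, ?_, hnd T hT, p.1, p.2, h3, h4, hef⟩
        rw [h, Multiset.singleton_add, Multiset.cons_swap]
      · refine .inr ⟨e, f, .cone ::ₘ T.val, ?_, ?_, p.1, p.2, h3, h4, hef⟩
        · rw [h, Multiset.insert_eq_cons, Multiset.cons_add, Multiset.singleton_add,
            Multiset.cons_swap BiconeEdge.cone,
            Multiset.cons_swap BiconeEdge.cone]
        · rw [Multiset.map_cons, Multiset.nodup_cons, hef.edgeComp_right]
          refine ⟨?_, hnd T hT⟩
          rw [Multiset.map_cons, Multiset.mem_cons, not_or, ← hκ, hcone]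
          refine ⟨fun h => hp2 ((comp_eq_zeroBar_iff hp).1 h), ?_⟩
          rw [Multiset.mem_map]
          rintro ⟨g, hg, hgp⟩
          exact hTp g hg hgp

open Classical in
-- Subtracting `F` leaves the edge roots, which are core unions over the same components and the
-- same pairs as in `sum_acyclic_treeEdge`. The factor is `t` and not `t + 1`, because 00̄ is not
-- optional here.
theorem sum_isTwoEdgeRootedForest {S : Type*} [CommRing S] (t : S)
    (hV : ∀ x, x ∈ V ↔ x ∈ V(reduced G A B hAB)) {Ω : Finset (Multiset (BiconeEdge α β))}
    (hΩ : ∀ m, m ∈ Ω ↔ IsTwoEdgeRootedForest G A B hAB m ∧ m.toFinset = F) :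
    ∑ m ∈ Ω, t ^ ((freeComps G A B hAB V F).card + 1 + F.card - m.card) =
    t * ∑ T ∈ partialTransversals ((graph G A B hAB).edgeComp (insert .cone F)) F
        (freeComps G A B hAB V F), t ^ ((freeComps G A B hAB V F).card - T.card) +
      ∑ p ∈ bicolouredPairs G A B hAB V F,
        ∑ T ∈ partialTransversals ((graph G A B hAB).edgeComp (insert .cone F)) F
          ((freeComps G A B hAB V F).erase ((graph G A B hAB).comp (insert .cone F) p.1)),
          t ^ (((freeComps G A B hAB V F).erase
            ((graph G A B hAB).comp (insert .cone F) p.1)).card - T.card) := by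
  have hfib := fun m => (hΩ m).trans (isTwoEdgeRootedForest_fibre hF hac hV)
  rw [← sum_isCoreUnion t (κ := (graph G A B hAB).edgeComp (insert .cone F))
    (P := bicolouredPairs G A B hAB V F) (C := pairEdges G A B hAB F)
    (c := fun p => (graph G A B hAB).comp (insert .cone F) p.1)
    (c₀ := (graph G A B hAB).comp (insert .cone F) .zeroBar)
    (Ω := Ω.image fun m => m - F.val) zeroBar_notMem_freeComps]
  · rw [Finset.sum_image]
    · refine Finset.sum_congr rfl fun m hm => ?_
      obtain ⟨R, -, rfl⟩ := (hfib m).1 hm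
      rw [add_tsub_cancel_left, Multiset.card_add, Finset.card_val, add_comm F.card,
        Nat.add_sub_add_right]
    · intro m hm m' hm' h
      obtain ⟨R, -, rfl⟩ := (hfib m).1 hm
      obtain ⟨R', -, rfl⟩ := (hfib m').1 hm'
      simpa using h
  · intro p hp g hg
    obtain ⟨e, f, hef, he, ⟨-, -, h⟩ | ⟨-, -, h⟩⟩ :=
      exists_endPair_of_mem_bicolouredPairs hF hac hV hp
    · rw [h, Multiset.mem_singleton] at hg
      rw [hg]
      exact hef.edgeComp_left
    · rw [h, Multiset.insert_eq_cons, Multiset.mem_cons, Multiset.mem_singleton] at hg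
      rcases hg with rfl | rfl
      · exact hef.edgeComp_left
      · exact hef.edgeComp_right
  · intro p hp
    obtain ⟨e, f, hef, he, ⟨h0, -, h⟩ | ⟨h0, -, h⟩⟩ :=
      exists_endPair_of_mem_bicolouredPairs hF hac hV hp
    · exact .inl ⟨(comp_eq_zeroBar_iff hp).2 h0, by rw [h]; rfl⟩
    · exact .inr ⟨comp_mem_freeComps (mem_bicolouredPairs.1 hp).1
        fun h' => h0 ((comp_eq_zeroBar_iff hp).1 h'), by rw [h]; rfl⟩
  · intro p hp q hq hpq
    obtain ⟨h1, h2, h3, h4, h5, h6⟩ := mem_bicolouredPairs.1 hp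
    obtain ⟨k1, k2, k3, k4, k5, k6⟩ := mem_bicolouredPairs.1 hq
    obtain ⟨e, f, hef, he, h⟩ := exists_endPair_of_mem_bicolouredPairs hF hac hV hp
    obtain ⟨e', f', hef', he', h'⟩ := exists_endPair_of_mem_bicolouredPairs hF hac hV hq
    rw [Prod.ext_iff]
    -- The core forgets which edge comes first; the colours of the ends restore the order.
    refine hac.ends_unique hef hef' h3 h4 k3 k4 ?_
    rcases h with ⟨-, hf, h⟩ | ⟨-, hf, h⟩ <;> rcases h' with ⟨-, hf', h'⟩ | ⟨-, hf', h'⟩ <;>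
      rw [hpq, h'] at h
    · exact .inl ⟨(Multiset.singleton_inj.1 h).symm, hf.trans hf'.symm⟩
    · simpa using congrArg Multiset.card h
    · simpa using congrArg Multiset.card h
    · simp only [Multiset.insert_eq_cons, Multiset.cons_eq_cons, Multiset.singleton_inj] at h
      rcases h with ⟨rfl, rfl⟩ | ⟨-, cs, h, h'⟩
      · exact .inl ⟨rfl, rfl⟩
      · rw [Multiset.singleton_eq_cons_iff] at h h'
        exact .inr ⟨h.1.symm, h'.1⟩
  · intro R
    simp only [Finset.mem_image]
    constructor
    · rintro ⟨m, hm, rfl⟩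
      obtain ⟨R, hR, rfl⟩ := (hfib m).1 hm
      rwa [add_tsub_cancel_left]
    · intro hR
      exact ⟨F.val + R, (hfib _).2 ⟨R, hR, rfl⟩, add_tsub_cancel_left _ _⟩

end

end Bicone

/-! ## Pure `O`-sequences from pure multicomplexes -/

section Multicomplex

variable {ε : Type v} {E : Set ε} {M : Set (Multiset ε)} {s : ℕ}

/-- All these multisets lie below `n` copies of `E`, and lower intervals of multisets are finite. -/
theorem finite_multiset_of_card_le (hE : E.Finite) (n : ℕ) :
    {m : Multiset ε | (∀ e ∈ m, e ∈ E) ∧ m.card ≤ n}.Finite := by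
  classical
  refine (Set.finite_Iic (n • hE.toFinset.val)).subset fun m hm => ?_
  rw [Set.mem_Iic, Multiset.le_iff_count]
  intro e
  by_cases he : e ∈ m
  · rw [Multiset.count_nsmul, Multiset.count_eq_one_of_mem hE.toFinset.nodup (by simpa using hm.1 e he),
      mul_one]
    exact (Multiset.count_le_card e m).trans hm.2
  · rw [Multiset.count_eq_zero.2 he]
    exact Nat.zero_le _

/-- Transport along a bijection of `E` with `Fin j`. Positivity holds since a member of cardinality
`s` has sub-multisets of every smaller cardinality. -/
theorem IsMulticomplex.isPureOSequence (hE : E.Finite) (hM : IsMulticomplex E M)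
    (hpure : IsPureMulticomplex M) (hs : HasDegree M s) {a : ℕ → ℤ}
    (ha : ∀ i ≤ s, a i = faceCount M i) : IsPureOSequence s a := by
  classical
  refine ⟨fun i hi => ?_, ?_⟩
  · obtain ⟨σ, hσ, rfl⟩ := hs.1
    have hne : Multiset.powersetCard i σ ≠ 0 := by
      rw [ne_eq, ← Multiset.card_eq_zero, Multiset.card_powersetCard]
      exact (Nat.choose_pos hi).ne'
    obtain ⟨τ, hτ⟩ := Multiset.exists_mem_of_ne_zero hne
    obtain ⟨hτ, hτi⟩ := Multiset.mem_powersetCard.1 hτ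
    rw [ha i hi, Nat.cast_pos, faceCount, Set.ncard_pos ((finite_multiset_of_card_le hE i).subset
      fun m hm => ⟨hM.subset_ground m hm.1, hm.2.le⟩)]
    exact ⟨τ, hM.down_closed σ hσ τ hτ, hτi⟩
  have := hE.to_subtype
  obtain ⟨j, ⟨φ⟩⟩ := Finite.exists_equiv_fin E
  set g : Fin j → ε := fun i => (φ.symm i : ε) with hg
  have hginj : Function.Injective g := Subtype.val_injective.comp φ.symm.injective
  have hlift : ∀ σ ∈ M, ∃ τ : Multiset (Fin j), τ.map g = σ := by
    intro σ hσ
    refine ⟨σ.attach.map fun e => φ ⟨e.1, hM.subset_ground σ hσ e.1 e.2⟩, ?_⟩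
    simp [hg, Multiset.map_map]
  have hmapinj : Function.Injective (Multiset.map g) := Multiset.map_injective hginj
  refine ⟨j, {σ | σ.map g ∈ M}, ⟨fun _ _ _ _ => trivial, ?_⟩, ?_, ⟨?_, ?_⟩, ?_⟩
  · exact fun σ hσ τ hτ => hM.down_closed _ hσ _ (Multiset.map_le_map hτ)
  · have hmax : ∀ σ : Multiset (Fin j), Maximal (· ∈ {σ : Multiset (Fin j) | σ.map g ∈ M}) σ →
        Maximal (· ∈ M) (σ.map g) := by
      intro σ hσ
      refine ⟨hσ.1, fun τ hτ hle => ?_⟩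
      obtain ⟨τ, rfl⟩ := hlift τ hτ
      exact Multiset.map_le_map (hσ.2 hτ ((Multiset.map_le_map_iff hginj).1 hle))
    intro σ τ hσ hτ
    simpa using hpure _ _ (hmax σ hσ) (hmax τ hτ)
  · obtain ⟨σ, hσ, hσs⟩ := hs.1
    obtain ⟨τ, rfl⟩ := hlift σ hσ
    exact ⟨τ, hσ, by simpa using hσs⟩
  · intro σ hσ
    simpa using hs.2 _ hσ
  · intro i hi
    rw [ha i hi, Nat.cast_inj, faceCount, faceCount, ← Set.ncard_image_of_injective _ hmapinj]
    congr 1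
    ext σ
    constructor
    · rintro ⟨hσ, hσi⟩
      obtain ⟨τ, rfl⟩ := hlift σ hσ
      exact ⟨τ, ⟨hσ, by simpa using hσi⟩, rfl⟩
    · rintro ⟨τ, ⟨hτ, hτi⟩, rfl⟩
      exact ⟨hτ, by simpa using hτi⟩

end Multicomplex

/-! ### Reading the h-vector off a generating polynomial -/

namespace Matroid

open Polynomial

variable {ε : Type v}

/-- The polynomial of the `h`-vector as a sum over the independent sets. -/
theorem hPolynomial_eq_sum (M : Matroid ε) {Ω : Finset (Finset ε)}
    (hΩ : ∀ I : Finset ε, I ∈ Ω ↔ M.Indep I) (hcard : ∀ I ∈ Ω, I.card ≤ M.eRank.toNat) :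
    M.hPolynomial = ∑ I ∈ Ω, (X - 1) ^ (M.eRank.toNat - I.card) := by
  classical
  rw [hPolynomial, ← Finset.sum_fiberwise_of_maps_to (t := Finset.range (M.eRank.toNat + 1))
    (g := Finset.card) fun I hI => Finset.mem_range_succ_iff.2 (hcard I hI)]
  refine Finset.sum_congr rfl fun i _ => ?_
  have hcount : M.indepCount i = (Ω.filter fun I => I.card = i).card := by
    rw [indepCount, ← Set.ncard_coe_finset, ← Set.ncard_image_of_injective _ Finset.coe_injective]
    congr 1
    ext I
    constructor
    · rintro ⟨hI, hIi⟩
      have hfin : I.Finite := Set.finite_of_encard_eq_coe hIi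
      refine ⟨hfin.toFinset, ?_, hfin.coe_toFinset⟩
      rw [Finset.coe_filter]
      refine ⟨(hΩ _).2 (by rwa [hfin.coe_toFinset]), ?_⟩
      rw [hfin.encard_eq_coe_toFinset_card] at hIi
      exact_mod_cast hIi
    · rintro ⟨J, hJ, rfl⟩
      rw [Finset.coe_filter] at hJ
      exact ⟨(hΩ J).1 hJ.1, by rw [Set.encard_coe_eq_coe_finsetCard, hJ.2]⟩
  rw [hcount, Finset.sum_congr rfl fun I hI => by rw [(Finset.mem_filter.1 hI).2],
    Finset.sum_const, nsmul_eq_mul]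
  simp

/-- If the polynomial of the `h`-vector is `∑ t^{d-|m|}` over the members of a finite collection of
multisets, then the `h`-vector counts these members by cardinality. -/
theorem hVector_eq_faceCount {M : Matroid ε} {δ : Type*} {F : Set (Multiset δ)}
    {Ω : Finset (Multiset δ)} (hΩ : ∀ m, m ∈ Ω ↔ m ∈ F)
    (hcard : ∀ m ∈ F, m.card ≤ M.eRank.toNat)
    (h : M.hPolynomial = ∑ m ∈ Ω, X ^ (M.eRank.toNat - m.card)) (i : ℕ) :
    M.hVector i = faceCount F i := by
  classical
  have hcount : faceCount F i = (Ω.filter fun m => m.card = i).card := by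
    rw [faceCount, ← Set.ncard_coe_finset]
    congr 1
    ext m
    simp [hΩ]
  rw [hVector]
  split_ifs with hi
  · rw [h, finsetSum_coeff, hcount, Finset.card_filter, Nat.cast_sum]
    refine Finset.sum_congr rfl fun m hm => ?_
    have := hcard m ((hΩ m).1 hm)
    rw [coeff_X_pow]
    split_ifs <;> first | rfl | omega
  · rw [hcount, Finset.filter_eq_empty_iff.2, Finset.card_empty, Nat.cast_zero]
    rintro m hm rfl
    exact hi (hcard m ((hΩ m).1 hm))

end Matroid

/-! ### Comparing the two generating polynomials -/

namespace Bicone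

variable {α : Type u} {β : Type v} {G : Graph α β} {A B : Set α} {hAB : V(G) = A ∪ B}
  {V : Finset (BiconeVertex α)} {F : Finset (BiconeEdge α β)}

theorem mem_insert_zero (hV : ∀ x, x ∈ V ↔ x ∈ V(reduced G A B hAB)) [DecidableEq (BiconeVertex α)]
    (x : BiconeVertex α) : x ∈ insert .zero V ↔ x ∈ V(graph G A B hAB) := by
  rw [Finset.mem_insert, hV, mem_vertexSet_reduced]
  constructor
  · rintro (rfl | h)
    · simp [graph]
    · exact h.1
  · intro h
    by_cases hx : x = .zero
    · exact .inl hx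
    · exact .inr ⟨h, hx⟩

theorem insert_cone_subset (hF : (F : Set (BiconeEdge α β)) ⊆ E(reduced G A B hAB)) :
    insert .cone (F : Set (BiconeEdge α β)) ⊆ E(graph G A B hAB) :=
  Set.insert_subset isLink_cone.edge_mem fun _ he => (mem_edgeSet_reduced.1 (hF he)).1

section Forest

variable (hV : ∀ x, x ∈ V ↔ x ∈ V(reduced G A B hAB))
  (hF : (F : Set (BiconeEdge α β)) ⊆ E(reduced G A B hAB))
  (hac : ((graph G A B hAB).restrict F).IsAcyclic)

include hV hF hac

/-- The component count of the forest `F` with 00̄ added: the extra vertex 0 and the extra edge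
cancel, and the component of 0̄ is the 1. -/
theorem card_freeComps : V.card = F.card + ((freeComps G A B hAB V F).card + 1) := by
  classical
  have h0 : .zero ∉ V := fun h => (mem_vertexSet_reduced.1 ((hV _).1 h)).2 rfl
  have hc : .cone ∉ F := fun h => cone_notMem (hF h)
  have h := Graph.IsAcyclic.card_vertices (K := insert .cone F) (V := insert .zero V)
    (by rw [Finset.coe_insert]; exact (acyclic_insert_cone hF).2 hac)
    (by rw [Finset.coe_insert]; exact insert_cone_subset hF) (mem_insert_zero hV)
  have hz := (hV .zeroBar).2 zeroBar_mem
  rw [Finset.card_insert_of_notMem h0, Finset.card_insert_of_notMem hc, Finset.coe_insert,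
    Finset.image_insert, comp_zero, Finset.insert_eq_of_mem (Finset.mem_image_of_mem _ hz)] at h
  have := Finset.card_erase_add_one
    (Finset.mem_image_of_mem ((graph G A B hAB).comp (insert .cone (F : Set (BiconeEdge α β)))) hz)
  have e : ((V.image ((graph G A B hAB).comp (insert .cone (F : Set (BiconeEdge α β))))).erase
    ((graph G A B hAB).comp (insert .cone (F : Set (BiconeEdge α β))) .zeroBar)).card =
      (freeComps G A B hAB V F).card := by
    unfold freeComps
    congr!
  omega

/-- The passage from `t - 1` to `t`: in the product formula the factor of a component is `t - 1`
plus its number of vertices on one side and `t` plus its number of edges on the other, and these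
agree for a tree. -/
theorem sum_partialTransversals_vertices {D : Finset (Set (BiconeVertex α))}
    (hD : D ⊆ freeComps G A B hAB V F) {S : Type*} [CommRing S] (t : S) :
    ∑ T ∈ partialTransversals ((graph G A B hAB).comp (insert .cone F)) V D,
        (t - 1) ^ (D.card - T.card) =
      ∑ T ∈ partialTransversals ((graph G A B hAB).edgeComp (insert .cone F)) F D,
        t ^ (D.card - T.card) := by
  classical
  rw [sum_partialTransversals, sum_partialTransversals]
  refine Finset.prod_congr rfl fun c hc => ?_
  have hcD := hD hc
  rw [freeComps, Finset.mem_erase, Finset.mem_image] at hcD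
  obtain ⟨hc0, x, hx, rfl⟩ := hcD
  have h := Graph.IsAcyclic.card_comp (K := insert .cone F) (V := insert .zero V)
    (by rw [Finset.coe_insert]; exact (acyclic_insert_cone hF).2 hac)
    (by rw [Finset.coe_insert]; exact insert_cone_subset hF) (mem_insert_zero hV)
    (Finset.mem_insert_of_mem hx)
  have hcone : (graph G A B hAB).edgeComp (insert .cone F) .cone =
      (graph G A B hAB).comp (insert .cone F) .zeroBar :=
    Graph.edgeComp_eq (.inl rfl) (inc_cone.2 (.inr rfl))
  rw [Finset.coe_insert, Finset.filter_insert, Finset.filter_insert, if_neg, if_neg] at h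
  · have h' : ((V.filter fun v => (graph G A B hAB).comp (insert .cone F) v =
        (graph G A B hAB).comp (insert .cone F) x).card : S) =
        ((F.filter fun e => (graph G A B hAB).edgeComp (insert .cone F) e =
        (graph G A B hAB).comp (insert .cone F) x).card : S) + 1 := by
      rw [← Nat.cast_add_one]
      exact congrArg Nat.cast (by convert h)
    rw [h']
    ring
  · rw [hcone]
    exact fun h => hc0 h.symm
  · rw [comp_zero]
    exact fun h => hc0 h.symm

open Classical in
/-- The contribution of a forest `F` of the reduced graph to the `h`-polynomial. -/
theorem sum_acyclic_eq_sum_isTwoEdgeRootedForest {S : Type*} [CommRing S] (t : S)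
    {Ω : Finset (Multiset (BiconeEdge α β))}
    (hΩ : ∀ m, m ∈ Ω ↔ IsTwoEdgeRootedForest G A B hAB m ∧ m.toFinset = F) :
    ∑ T ∈ V.powerset.filter fun T : Finset (BiconeVertex α) =>
        ((graph G A B hAB).restrict (F ∪ treeEdge A '' T)).IsAcyclic,
      (t - 1) ^ (V.card - (F.card + T.card)) = ∑ m ∈ Ω, t ^ (V.card - m.card) := by
  have h1 := sum_acyclic_treeEdge (t - 1) hV hF hac
  have h2 := sum_isTwoEdgeRootedForest hF ((acyclic_insert_cone hF).2 hac) t hV hΩ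
  rw [card_freeComps hV hF hac]
  simp only [Nat.add_sub_add_left]
  -- `sub_add_cancel` turns the prefactor `(t - 1) + 1` of the vertex side into the prefactor `t` of
  -- the edge side.
  rw [h1, add_comm F.card, h2, sub_add_cancel,
    sum_partialTransversals_vertices hV hF hac subset_rfl]
  congr 1
  exact Finset.sum_congr rfl fun p _ =>
    sum_partialTransversals_vertices hV hF hac (Finset.erase_subset _ _) t

end Forest

/-- Ensures that the exponents `V.card - m.card` are genuine differences. A core with its
transversal has at most one element more than there are free components. -/
theorem IsTwoEdgeRootedForest.card_le (hV : ∀ x, x ∈ V ↔ x ∈ V(reduced G A B hAB))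
    {m : Multiset (BiconeEdge α β)} (hm : IsTwoEdgeRootedForest G A B hAB m) :
    m.card ≤ V.card := by
  classical
  have hF : (m.toFinset : Set (BiconeEdge α β)) ⊆ E(reduced G A B hAB) := fun e he =>
    hm.edges_mem e (by simpa using he)
  have hsupp : coneSupport m = insert .cone (m.toFinset : Set (BiconeEdge α β)) := by
    rw [coneSupport]
    congr 1
    ext
    simp
  have hac := (isTwoEdgeRootedForest_iff.1 hm).2.1
  rw [hsupp] at hac
  obtain ⟨R, hR, hRm⟩ := (isTwoEdgeRootedForest_fibre hF hac hV).1 ⟨hm, rfl⟩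
  rw [card_freeComps hV hF ((acyclic_insert_cone hF).1 hac), ← hRm, Multiset.card_add,
    Finset.card_val, hRm, Nat.add_le_add_iff_left]
  rcases hR with ⟨T, hT, rfl⟩ | ⟨p, hp, T, hT, rfl⟩
  · exact (card_le_of_mem_partialTransversals hT).trans (Nat.le_succ _)
  · have hTc := card_le_of_mem_partialTransversals hT
    rw [Multiset.card_add, Finset.card_val]
    obtain ⟨e, f, hef, he, ⟨h0, -, h⟩ | ⟨h0, -, h⟩⟩ :=
      exists_endPair_of_mem_bicolouredPairs hF hac hV hp
    · have := hTc.trans (Finset.card_le_card (Finset.erase_subset _ _))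
      rw [h, Multiset.card_singleton]
      omega
    · have hmem := comp_mem_freeComps (mem_bicolouredPairs.1 hp).1
        fun h' => h0 ((comp_eq_zeroBar_iff hp).1 h')
      have := Finset.card_pos.2 ⟨_, hmem⟩
      rw [Finset.card_erase_of_mem hmem] at hTc
      rw [h, Multiset.card_pair]
      omega

/-- The case of the empty forest: all vertices of `V` other than 0̄ form a transversal, and 0̄ can
be added to it. -/
theorem isAcyclic_baseTree (hV : ∀ x, x ∈ V ↔ x ∈ V(reduced G A B hAB)) :
    ((graph G A B hAB).restrict (treeEdge A '' V)).IsAcyclic := by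
  have hF : (∅ : Set (BiconeEdge α β)) ⊆ E(reduced G A B hAB) := Set.empty_subset _
  have hac : ((graph G A B hAB).restrict (∅ : Set (BiconeEdge α β))).IsAcyclic := by
    rw [Graph.isAcyclic_restrict_iff]
    simp
  have hcomp : ∀ x ∈ V, ∀ y ∈ V, (graph G A B hAB).comp (insert .cone ∅) x =
      (graph G A B hAB).comp (insert .cone ∅) y → x = y := fun x hx y hy h =>
    ((comp_insert_cone_eq hF ((hV x).1 hx) ((hV y).1 hy)).1 h).eq_of_forall_not_inc (by simp)
  have h0 := (hV .zeroBar).2 zeroBar_mem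
  have hT : IsTransversal G A B hAB ∅ (V \ {.zeroBar}) :=
    ⟨fun x hx => (hV x).1 hx.1, fun x hx y hy h => hcomp x hx.1 y hy.1 h,
      fun x hx h => hx.2 (hcomp x hx.1 _ h0 h)⟩
  have := hT.isAcyclic_insert hF hac (V.finite_toSet.subset Set.sdiff_subset) zeroBar_mem (.inl rfl)
    (by simp) (.inl rfl)
  rwa [Set.insert_sdiff_singleton, Set.insert_eq_of_mem (Finset.mem_coe.2 h0),
    Set.empty_union] at this

theorem IsAcyclic.card_le (hV : ∀ x, x ∈ V ↔ x ∈ V(reduced G A B hAB))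
    {I : Finset (BiconeEdge α β)} (hI : (I : Set (BiconeEdge α β)) ⊆ E(graph G A B hAB))
    (hac : ((graph G A B hAB).restrict I).IsAcyclic) : I.card ≤ V.card := by
  classical
  have h := hac.card_vertices hI (V := insert .zero V) (mem_insert_zero hV)
  have h1 : 0 < ((insert BiconeVertex.zero V).image ((graph G A B hAB).comp I)).card :=
    Finset.card_pos.2 ⟨_, Finset.mem_image_of_mem _ (Finset.mem_insert_self _ _)⟩
  rw [Finset.card_insert_of_notMem fun h => (mem_vertexSet_reduced.1 ((hV _).1 h)).2 rfl] at h
  omega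

theorem finite_edgeSet_graph (hV : V(G).Finite) (hE : E(G).Finite) : E(graph G A B hAB).Finite := by
  refine (((Set.finite_singleton .cone).union (hV.image .toZero)).union
    ((hV.image .toZeroBar).union (hE.image .old))).subset fun e he => ?_
  obtain ⟨x, y, hl⟩ := (graph G A B hAB).exists_isLink_of_mem_edgeSet he
  cases hl with
  | old h => exact .inr (.inr ⟨_, h.edge_mem, rfl⟩)
  | _ => simp_all

/-- The rank of the graphic matroid of a biconed graph. -/
theorem eRank_graphicMatroid (hV : ∀ x, x ∈ V ↔ x ∈ V(reduced G A B hAB))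
    (hE : E(graph G A B hAB).Finite) : (graph G A B hAB).graphicMatroid.eRank = V.card := by
  apply le_antisymm
  · obtain ⟨I, hI⟩ := (graph G A B hAB).graphicMatroid.exists_isBase
    have hi := hI.indep
    rw [Graph.graphicMatroid_indep_iff] at hi
    have hfin := hE.subset hi.1
    rw [← hI.encard_eq_eRank, hfin.encard_eq_coe_toFinset_card, Nat.cast_le]
    exact IsAcyclic.card_le (hAB := hAB) hV (by simpa using hi.1) (by simpa using hi.2)
  · have hinj : Set.InjOn (treeEdge A : _ → BiconeEdge α β) V :=
      treeEdge_injOn.mono fun x hx => (mem_vertexSet_reduced.1 ((hV x).1 hx)).2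
    rw [← Set.encard_coe_eq_coe_finsetCard, ← hinj.encard_image]
    refine Matroid.Indep.encard_le_eRank ?_
    rw [Graph.graphicMatroid_indep_iff]
    refine ⟨?_, isAcyclic_baseTree hV⟩
    rintro _ ⟨x, hx, rfl⟩
    exact (isLink_treeEdge ((hV x).1 hx)).edge_mem

open Classical Polynomial in
-- Both sums are split over the forests `F` of the reduced graph, by the part of an independent set
-- outside T₀ and by the underlying set of a multiset; `sum_acyclic_eq_sum_isTwoEdgeRootedForest`
-- compares the fibres.
theorem hPolynomial_graphicMatroid (hV : ∀ x, x ∈ V ↔ x ∈ V(reduced G A B hAB))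
    (hE : E(graph G A B hAB).Finite) {Ω : Finset (Multiset (BiconeEdge α β))}
    (hΩ : ∀ m, m ∈ Ω ↔ IsTwoEdgeRootedForest G A B hAB m) :
    (graph G A B hAB).graphicMatroid.hPolynomial =
      ∑ m ∈ Ω, X ^ ((graph G A B hAB).graphicMatroid.eRank.toNat - m.card) := by
  have hrank : (graph G A B hAB).graphicMatroid.eRank.toNat = V.card := by
    rw [eRank_graphicMatroid hV hE, ENat.toNat_natCast]
  set E₀ := hE.toFinset with hE₀
  set E₁ := E₀.filter fun e => e ∈ E(reduced G A B hAB) with hE₁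
  have hmemE₁ : ∀ e, e ∈ E₁ ↔ e ∈ E(reduced G A B hAB) := by
    intro e
    rw [hE₁, Finset.mem_filter, hE₀, Set.Finite.mem_toFinset, mem_edgeSet_reduced]
    tauto
  have hsubE₁ : ∀ F : Finset (BiconeEdge α β), F ⊆ E₁ ↔
      (F : Set (BiconeEdge α β)) ⊆ E(reduced G A B hAB) := fun F =>
    ⟨fun h e he => (hmemE₁ e).1 (h he), fun h e he => (hmemE₁ e).2 (h he)⟩
  set 𝓘 := E₀.powerset.filter fun I : Finset (BiconeEdge α β) =>
    ((graph G A B hAB).restrict (I : Set (BiconeEdge α β))).IsAcyclic with h𝓘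
  have hmem𝓘 : ∀ I : Finset (BiconeEdge α β), I ∈ 𝓘 ↔
      (I : Set (BiconeEdge α β)) ⊆ E(graph G A B hAB) ∧
        ((graph G A B hAB).restrict (I : Set (BiconeEdge α β))).IsAcyclic := by
    intro I
    rw [h𝓘, Finset.mem_filter, Finset.mem_powerset, hE₀, Set.Finite.subset_toFinset]
  set 𝓕 := E₁.powerset.filter fun F : Finset (BiconeEdge α β) =>
    ((graph G A B hAB).restrict (F : Set (BiconeEdge α β))).IsAcyclic with h𝓕
  have hmem𝓕 : ∀ F, F ∈ 𝓕 ↔ (F : Set (BiconeEdge α β)) ⊆ E(reduced G A B hAB) ∧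
      ((graph G A B hAB).restrict (F : Set (BiconeEdge α β))).IsAcyclic := by
    intro F
    rw [h𝓕, Finset.mem_filter, Finset.mem_powerset, hsubE₁]
  have hV0 : ∀ x ∈ V, x ≠ .zero := fun x hx => (mem_vertexSet_reduced.1 ((hV x).1 hx)).2
  have htree : ∀ x ∈ V, (treeEdge A x : BiconeEdge α β) ∉ E(reduced G A B hAB) := fun x hx =>
    treeEdge_notMem subset_rfl ((hV x).1 hx)
  rw [Matroid.hPolynomial_eq_sum (Ω := 𝓘) _
    (fun I => (hmem𝓘 I).trans ((graph G A B hAB).graphicMatroid_indep_iff I).symm)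
    (fun I hI => by
      rw [hrank]
      exact IsAcyclic.card_le (hAB := hAB) hV ((hmem𝓘 I).1 hI).1 ((hmem𝓘 I).1 hI).2), hrank]
  rw [← Finset.sum_fiberwise_of_maps_to (s := Ω) (t := 𝓕) (g := Multiset.toFinset)]
  · rw [Finset.sum_congr rfl fun F hF => (sum_acyclic_eq_sum_isTwoEdgeRootedForest hV
      ((hmem𝓕 F).1 hF).1 ((hmem𝓕 F).1 hF).2 X (Ω := Ω.filter fun m => m.toFinset = F)
      fun m => by rw [Finset.mem_filter, hΩ]).symm]
    rw [Finset.sum_sigma']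
    have hinj : Set.InjOn (treeEdge A : _ → BiconeEdge α β) V := treeEdge_injOn.mono hV0
    -- The edge set is the disjoint union of the reduced edges and T₀, so an independent set is the
    -- same as a forest `F` with a set `T` of vertices naming its tree edges.
    refine Finset.sum_nbij' (fun I => ⟨I.filter fun e => e ∈ E₁, V.filter fun x => treeEdge A x ∈ I⟩)
      (fun p => p.1 ∪ p.2.image (treeEdge A)) ?_ ?_ ?_ ?_ ?_
    · intro I hI
      obtain ⟨-, h2⟩ := (hmem𝓘 I).1 hI
      rw [Finset.mem_sigma, hmem𝓕, Finset.mem_filter, Finset.mem_powerset]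
      refine ⟨⟨fun e he => (hmemE₁ e).1 (Finset.mem_filter.1 he).2,
        h2.restrict_mono fun e he => (Finset.mem_filter.1 he).1⟩, Finset.filter_subset _ _,
        h2.restrict_mono ?_⟩
      rintro e (he | ⟨x, hx, rfl⟩)
      · exact (Finset.mem_filter.1 he).1
      · exact (Finset.mem_filter.1 hx).2
    · rintro ⟨F, T⟩ hp
      rw [Finset.mem_sigma, hmem𝓕, Finset.mem_filter, Finset.mem_powerset] at hp
      obtain ⟨⟨h1, -⟩, h2, h3⟩ := hp
      rw [hmem𝓘, Finset.coe_union, Finset.coe_image]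
      refine ⟨Set.union_subset (fun e he => (mem_edgeSet_reduced.1 (h1 he)).1) ?_, h3⟩
      rintro _ ⟨x, hx, rfl⟩
      exact (isLink_treeEdge ((hV x).1 (h2 hx))).edge_mem
    · intro I hI
      obtain ⟨h1, -⟩ := (hmem𝓘 I).1 hI
      ext e
      rw [Finset.mem_union, Finset.mem_filter, Finset.mem_image]
      constructor
      · rintro (h | ⟨x, hx, rfl⟩)
        · exact h.1
        · exact (Finset.mem_filter.1 hx).2
      · intro he
        by_cases heE : e ∈ E₁
        · exact .inl ⟨he, heE⟩
        · right
          rw [hmemE₁, mem_edgeSet_reduced, not_and, not_not] at heE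
          have := heE (h1 he)
          rw [← image_treeEdge (hAB := hAB)] at this
          obtain ⟨x, hx, rfl⟩ := this
          exact ⟨x, Finset.mem_filter.2 ⟨(hV x).2 hx, he⟩, rfl⟩
    · rintro ⟨F, T⟩ hp
      rw [Finset.mem_sigma, hmem𝓕, Finset.mem_filter, Finset.mem_powerset] at hp
      obtain ⟨⟨h1, -⟩, h2, -⟩ := hp
      dsimp only at h1 h2 ⊢
      congr 1
      · ext e
        rw [Finset.mem_filter, Finset.mem_union, Finset.mem_image, hmemE₁]
        constructor
        · rintro ⟨h | ⟨x, hx, rfl⟩, he⟩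
          · exact h
          · exact absurd he (htree x (h2 hx))
        · exact fun h => ⟨.inl h, h1 h⟩
      · ext x
        rw [Finset.mem_filter, Finset.mem_union, Finset.mem_image]
        constructor
        · rintro ⟨hx, h | ⟨y, hy, hyx⟩⟩
          · exact absurd (h1 h) (htree x hx)
          · rwa [← hinj (h2 hy) hx hyx]
        · exact fun hx => ⟨h2 hx, .inr ⟨x, hx, rfl⟩⟩
    · intro I hI
      obtain ⟨h1, -⟩ := (hmem𝓘 I).1 hI
      dsimp only
      congr 2
      have hI : I = (I.filter fun e => e ∈ E₁) ∪
          (V.filter fun x => treeEdge A x ∈ I).image (treeEdge A) := by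
        ext e
        rw [Finset.mem_union, Finset.mem_filter, Finset.mem_image]
        constructor
        · intro he
          by_cases heE : e ∈ E₁
          · exact .inl ⟨he, heE⟩
          · right
            rw [hmemE₁, mem_edgeSet_reduced, not_and, not_not] at heE
            have := heE (h1 he)
            rw [← image_treeEdge (hAB := hAB)] at this
            obtain ⟨x, hx, rfl⟩ := this
            exact ⟨x, Finset.mem_filter.2 ⟨(hV x).2 hx, he⟩, rfl⟩
        · rintro (h | ⟨x, hx, rfl⟩)
          · exact h.1
          · exact (Finset.mem_filter.1 hx).2
      conv_lhs => rw [hI]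
      rw [Finset.card_union_of_disjoint, Finset.card_image_of_injOn]
      · exact hinj.mono fun x hx => (Finset.mem_filter.1 hx).1
      · rw [Finset.disjoint_left]
        intro e he he'
        obtain ⟨x, hx, rfl⟩ := Finset.mem_image.1 he'
        exact htree x (Finset.mem_filter.1 hx).1 ((hmemE₁ _).1 (Finset.mem_filter.1 he).2)
  · intro m hm
    have hm := (hΩ m).1 hm
    have hF : (m.toFinset : Set (BiconeEdge α β)) ⊆ E(reduced G A B hAB) := fun e he =>
      hm.edges_mem e (by simpa using he)
    refine (hmem𝓕 _).2 ⟨hF, (acyclic_reduced hF).1 ?_⟩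
    have := hm.forest
    rw [support] at this
    convert this
    ext
    simp

theorem empty_mem_twoEdgeRootedForests : 0 ∈ twoEdgeRootedForests G A B hAB := by
  refine isTwoEdgeRootedForest_iff.2 ⟨by simp, ?_, .inl ?_⟩
  · have h : {e | e ∈ (0 : Multiset (BiconeEdge α β))} = ∅ := by ext; simp
    rw [coneSupport, h, acyclic_insert_cone (Set.empty_subset _), Graph.isAcyclic_restrict_iff]
    simp
  · simp [coneRoots]

end Bicone

/-! ### The main theorem -/

theorem mainTheorem1 {α : Type u} {β : Type v} (G : Graph α β)
    (hV : (Graph.vertexSet G).Finite) (hE : (Graph.edgeSet G).Finite)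
    (A B : Set α) (hAB : Graph.vertexSet G = A ∪ B) :
    (∃ s ≤ (Bicone.graph G A B hAB).graphicMatroid.eRank.toNat,
      (∀ i, s < i → (Bicone.graph G A B hAB).graphicMatroid.hVector i = 0) ∧
      IsPureOSequence s (Bicone.graph G A B hAB).graphicMatroid.hVector ∧
      HasDegree (Bicone.twoEdgeRootedForests G A B hAB) s) ∧
    IsMulticomplex (Graph.edgeSet (Bicone.reduced G A B hAB))
      (Bicone.twoEdgeRootedForests G A B hAB) ∧
    IsPureMulticomplex (Bicone.twoEdgeRootedForests G A B hAB) ∧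
    (∀ i : ℕ, (Bicone.graph G A B hAB).graphicMatroid.hVector i =
      (faceCount (Bicone.twoEdgeRootedForests G A B hAB) i : ℤ)) := by
  classical
  have hEf := Bicone.finite_edgeSet_graph (hAB := hAB) hV hE
  have hEr : E(Bicone.reduced G A B hAB).Finite :=
    hEf.subset fun e he => (Bicone.mem_edgeSet_reduced.1 he).1
  have hVf : V(Bicone.reduced G A B hAB).Finite :=
    (((Set.finite_singleton BiconeVertex.zeroBar).insert .zero).union
      (hV.image BiconeVertex.old)).subset fun x hx => (Bicone.mem_vertexSet_reduced.1 hx).1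
  have hVmem : ∀ x, x ∈ hVf.toFinset ↔ x ∈ V(Bicone.reduced G A B hAB) := by simp
  have hrank : (Bicone.graph G A B hAB).graphicMatroid.eRank.toNat = hVf.toFinset.card := by
    rw [Bicone.eRank_graphicMatroid hVmem hEf, ENat.toNat_natCast]
  have hcard : ∀ m ∈ Bicone.twoEdgeRootedForests G A B hAB,
      m.card ≤ (Bicone.graph G A B hAB).graphicMatroid.eRank.toNat := fun m hm =>
    hrank ▸ Bicone.IsTwoEdgeRootedForest.card_le hVmem hm
  have hmc := Bicone.isMulticomplex_twoEdgeRootedForests (hAB := hAB)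
  have hpure := Bicone.isPureMulticomplex_twoEdgeRootedForests (hAB := hAB) hV
  have hfin : (Bicone.twoEdgeRootedForests G A B hAB).Finite :=
    (finite_multiset_of_card_le hEr _).subset fun m hm => ⟨hmc.subset_ground m hm, hcard m hm⟩
  have hmem : ∀ m, m ∈ hfin.toFinset ↔ m ∈ Bicone.twoEdgeRootedForests G A B hAB := by simp
  have hvec := Matroid.hVector_eq_faceCount hmem hcard
    (Bicone.hPolynomial_graphicMatroid hVmem hEf hmem)
  -- The degree is the largest cardinality of a member; the empty multiset shows that there are
  -- members.
  obtain ⟨σ, hσ, hσmax⟩ := Set.exists_max_image _ Multiset.card hfin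
    ⟨0, Bicone.empty_mem_twoEdgeRootedForests⟩
  have hdeg : HasDegree (Bicone.twoEdgeRootedForests G A B hAB) σ.card := ⟨⟨σ, hσ, rfl⟩, hσmax⟩
  refine ⟨⟨σ.card, hcard σ hσ, fun i hi => ?_, hmc.isPureOSequence hEr hpure hdeg
    fun i _ => hvec i, hdeg⟩, hmc, hpure, hvec⟩
  have hempty : {m | m ∈ Bicone.twoEdgeRootedForests G A B hAB ∧ m.card = i} = ∅ := by
    refine Set.eq_empty_iff_forall_notMem.2 fun m hm => ?_
    have := hσmax m hm.1
    have := hm.2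
    omega
  rw [hvec i, faceCount, hempty, Set.ncard_empty, Nat.cast_zero]
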